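/- Let $p$ be a prime, and let $R$ be a commutative ring of characteristic $p$ of one of the following two types. (A) (complete case) $R$ is a complete Noetherian local ring whose residue field $k$ satisfies $[k:k^p]<\infty$. (B) (graded case) $R=\bigoplus_{n\in\mathbb N}R_n$ is an $\mathbb N$-graded, finitely generated algebra over a field $k=R_0$ with $[k:k^p]<\infty$. For an $R$-module $M$ and $e\in\mathbb N$, let ${}^e\!M$ denote the abelian group $M$ with $R$ acting through the $e$-th iterate of Frobenius, $r\cdot m=r^{p^e}m$. In case (B) all modules are $\mathbb Q$-graded, ${}^e\!M$ carries the grading $({}^e\!M)_\alpha=M_{p^e\alpha}$, submodules and direct summands are graded, and two graded modules $M,N$ are called isomorphic if $N\cong M(\alpha)$ by a degree-preserving isomorphism for some $\alpha\in\mathbb Q$, where $M(\alpha)_\beta=M_{\alpha+\beta}$. For $M$ indecomposable and $N$ a finitely generated $R$-module, the multiplicity $m(e,M,N)$ is the number of summands isomorphic to $M$ in a decomposition of ${}^e\!N$ as a finite direct sum of indecomposable modules. Assume that $R$ is strongly F-regular, i.e. $R$ is reduced, finitely generated as a module over its subring $R^p$ of $p$-th powers, and for every $c\in R$ outside all minimal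 primes there is $e\in\mathbb N$ such that the $R$-linear map $R\to{}^e\!R$, $1\mapsto c$, splits. Assume moreover that $R$ has finite F-representation type, i.e. up to isomorphism only finitely many indecomposable modules occur as direct summands of the modules ${}^e\!R$, $e\in\mathbb N$; let $M_1,\dots,M_n$ be the list of these modules, without repetition. Let $d$ be the Krull dimension of $R$. Then: 1. The multiplicities $m(e,M_i,M_j)$ are well defined for all $e\in\mathbb N$ and all $i,j$: a decomposition of ${}^e\!M_j$ into finitely many indecomposables exists, and the number of summands isomorphic to $M_i$ does not depend on it. 2. For all $i,j$ the limit $$\lim_{e\to\infty}\frac{m(e,M_i,M_j)}{p^{de}\,[k:k^p]^e}$$ exists and is strictly positive. In particular, if $k$ is perfect, then $$\lim_{e\to\infty}\frac{m(e,M_i,M_j)}{p^{de}}$$ exists and is strictly positive. 3. Some power $E^t$, $t\ge 1$, of the matrix $E=(m(1,M_i,M_j))_{i,j}$ has all entries strictly positive. -/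

import Mathlib

universe u v

/-! ### Frobenius and strong F-regularity -/

/-- `FrobeniusModule p e M` is the module `ᵉM`: the abelian group `M`, on which `r : R` acts
as `r ^ (p ^ e)`, i.e. restriction of scalars along the `e`-th iterate of Frobenius. -/
def FrobeniusModule (_p _e : ℕ) (M : Type u) : Type u := M

namespace FrobeniusModule

instance (p e : ℕ) (M : Type u) [AddCommGroup M] : AddCommGroup (FrobeniusModule p e M) :=
  inferInstanceAs (AddCommGroup M)

instance (p e : ℕ) (R : Type v) [CommRing R] [ExpChar R p] (M : Type u) [AddCommGroup M]
    [Module R M] : Module R (FrobeniusModule p e M) :=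
  Module.compHom M (iterateFrobenius R p e)

/-- The element `ᵉm` of `ᵉM` attached to `m : M`. -/
def of (p e : ℕ) {M : Type u} (m : M) : FrobeniusModule p e M := m

/-- The element of `M` underlying an element of `ᵉM`. -/
def un {p e : ℕ} {M : Type u} (m : FrobeniusModule p e M) : M := m

theorem un_smul {p e : ℕ} {R : Type v} [CommRing R] [ExpChar R p] {M : Type u} [AddCommGroup M]
    [Module R M] (r : R) (m : FrobeniusModule p e M) : (r • m).un = r ^ (p ^ e) • m.un := rfl

end FrobeniusModule

/-- The residue field of a local ring of prime characteristic `p` has characteristic `p`. -/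
instance residueField_charP (p : ℕ) [Fact p.Prime] (R : Type u) [CommRing R] [IsLocalRing R]
    [CharP R p] : CharP (IsLocalRing.ResidueField R) p := by
  refine (CharP.charP_iff_prime_eq_zero (Fact.out : p.Prime)).2 ?_
  rw [← map_natCast (IsLocalRing.residue R) p, CharP.cast_eq_zero R p, map_zero]

/-- The degree `[k : k^p]` of a field `k` over its subfield of `p`-th powers. -/
noncomputable def frobeniusDegree (p : ℕ) (k : Type u) [Field k] [ExpChar k p] : ℕ :=
  Module.finrank (frobenius k p).fieldRange k

/-- A ring `R` of characteristic `p` is strongly F-regular if it is reduced, finite over `R^p`,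
and for every `c` outside all minimal primes there is an `e` such that the `R`-linear map
`R → ᵉR` with `1 ↦ c` (equivalently `R → R^{1/p^e}`, `1 ↦ c^{1/p^e}`) splits. -/
structure IsStronglyFRegular (p : ℕ) (R : Type u) [CommRing R] [ExpChar R p] : Prop where
  isReduced : IsReduced R
  fFinite : (frobenius R p).Finite
  splits : ∀ c : R, (∀ P ∈ minimalPrimes R, c ∉ P) →
    ∃ (e : ℕ) (φ : FrobeniusModule p e R →ₗ[R] R),
      φ ∘ₗ LinearMap.toSpanSingleton R (FrobeniusModule p e R) (FrobeniusModule.of p e c) =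
        LinearMap.id

/-! ### Decompositions of modules -/

section Ungraded

/-- A module is indecomposable if it is nonzero and not the direct sum of two nonzero
submodules. -/
def IsIndecomposableModule (R : Type v) [CommRing R] (M : Type u) [AddCommGroup M] [Module R M] :
    Prop :=
  Nontrivial M ∧ ∀ A B : Submodule R M, IsCompl A B → A = ⊥ ∨ B = ⊥

/-- `M` is isomorphic to a direct summand of `N`. -/
def IsModuleSummand (R : Type v) [CommRing R] (M N : Type u) [AddCommGroup M] [Module R M]
    [AddCommGroup N] [Module R N] : Prop :=
  ∃ A B : Submodule R N, IsCompl A B ∧ Nonempty (M ≃ₗ[R] A)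

/-- `N` is a finite direct sum of indecomposable submodules, exactly `a` of which are isomorphic
to `M`. -/
def HasMultiplicity (R : Type v) [CommRing R] (M N : Type u) [AddCommGroup M] [Module R M]
    [AddCommGroup N] [Module R N] (a : ℕ) : Prop :=
  ∃ (r : ℕ) (A : Fin r → Submodule R N), DirectSum.IsInternal A ∧
    (∀ i, IsIndecomposableModule R (A i)) ∧
    Nat.card {i : Fin r // Nonempty (M ≃ₗ[R] A i)} = a

/-- Finite F-representation type: up to isomorphism only finitely many indecomposable modules
occur as direct summands of the modules `ᵉR`, `e ∈ ℕ`. -/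
def HasFFRT (p : ℕ) (R : Type u) [CommRing R] [ExpChar R p] : Prop :=
  ∃ (n : ℕ) (M : Fin n → ModuleCat.{u} R), ∀ (e : ℕ) (N : ModuleCat.{u} R),
    IsIndecomposableModule R N → IsModuleSummand R N (FrobeniusModule p e R) →
      ∃ i, Nonempty (N ≃ₗ[R] M i)

/-- `M 0, …, M (n - 1)` is the list, without repetition up to isomorphism, of all indecomposable
direct summands of the modules `ᵉR`, `e ∈ ℕ`. -/
structure IsSummandList (p : ℕ) (R : Type u) [CommRing R] [ExpChar R p] {n : ℕ}
    (M : Fin n → ModuleCat.{u} R) : Prop where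
  indecomposable : ∀ i, IsIndecomposableModule R (M i)
  summand : ∀ i, ∃ e : ℕ, IsModuleSummand R (M i) (FrobeniusModule p e R)
  not_iso : ∀ i j, Nonempty (M i ≃ₗ[R] M j) → i = j
  complete : ∀ (e : ℕ) (N : ModuleCat.{u} R), IsIndecomposableModule R N →
    IsModuleSummand R N (FrobeniusModule p e R) → ∃ i, Nonempty (N ≃ₗ[R] M i)

end Ungraded

/-! ### `ℚ`-graded modules -/

section Graded

/-- A `ℚ`-graded module over an `ℕ`-graded ring `R = ⨁ 𝒜 n`. -/
structure QGradedModule {k : Type v} {R : Type u} [CommRing k] [CommRing R] [Algebra k R]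
    (𝒜 : ℕ → Submodule k R) where
  carrier : Type u
  [addCommGroup : AddCommGroup carrier]
  [module : Module R carrier]
  /-- the homogeneous pieces -/
  piece : ℚ → AddSubgroup carrier
  /-- the sum of the pieces is direct … -/
  indep : iSupIndep piece
  /-- … and it is the whole module -/
  iSup_piece : ⨆ α, piece α = ⊤
  smul_mem : ∀ (n : ℕ) (α : ℚ) (a : R) (m : carrier),
    a ∈ 𝒜 n → m ∈ piece α → a • m ∈ piece (n + α)

namespace QGradedModule

attribute [instance] QGradedModule.addCommGroup QGradedModule.module

variable {k : Type v} {R : Type u} [CommRing k] [CommRing R] [Algebra k R]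
  {𝒜 : ℕ → Submodule k R}

/-- A submodule of `M` is homogeneous if it is the sum of its intersections with the pieces of
`M`. -/
def IsHomogeneous (M : QGradedModule 𝒜) (A : Submodule R M.carrier) : Prop :=
  A.toAddSubgroup = ⨆ α, A.toAddSubgroup ⊓ M.piece α

/-- A homogeneous submodule, as a graded module with the induced grading. -/
def sub (M : QGradedModule 𝒜) (A : Submodule R M.carrier) (hA : M.IsHomogeneous A) :
    QGradedModule 𝒜 where
  carrier := A
  piece α := (M.piece α).comap A.toAddSubgroup.subtype
  indep := by
    intro α
    rw [disjoint_iff_inf_le]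
    rintro x ⟨hx1, hx2⟩
    have h := (M.indep α).le_bot (x := (x : M.carrier)) ⟨hx1, ?_⟩
    · exact Subtype.ext h
    · have h3 : (⨆ β, ⨆ (_ : β ≠ α), (M.piece β).comap A.toAddSubgroup.subtype) ≤
          (⨆ β, ⨆ (_ : β ≠ α), M.piece β).comap A.toAddSubgroup.subtype :=
        iSup₂_le fun β hβ => AddSubgroup.comap_mono (le_iSup₂_of_le β hβ le_rfl)
      exact h3 hx2
  iSup_piece := by
    apply AddSubgroup.map_injective (f := A.toAddSubgroup.subtype) Subtype.val_injective
    rw [AddSubgroup.map_iSup]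
    have h : ∀ α, ((M.piece α).comap A.toAddSubgroup.subtype).map A.toAddSubgroup.subtype =
        A.toAddSubgroup ⊓ M.piece α := by
      intro α
      ext x
      constructor
      · rintro ⟨y, hy, rfl⟩
        exact ⟨y.2, hy⟩
      · rintro ⟨h1, h2⟩
        exact ⟨⟨x, h1⟩, h2, rfl⟩
    simp only [h]
    rw [← hA]
    ext x
    constructor
    · intro hx
      exact ⟨⟨x, hx⟩, trivial, rfl⟩
    · rintro ⟨y, _, rfl⟩
      exact y.2
  smul_mem n α a m ha hm := M.smul_mem n α a m ha hm

/-- An isomorphism of graded modules up to a shift `α` of the degrees: a graded isomorphism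
`M(α) ≅ N`, where `M(α)_β = M_{β + α}`. -/
def ShiftIso (M N : QGradedModule 𝒜) : Prop :=
  ∃ (α : ℚ) (f : M.carrier ≃ₗ[R] N.carrier),
    ∀ (β : ℚ) (x : M.carrier), x ∈ M.piece (β + α) ↔ f x ∈ N.piece β

/-- A graded module is indecomposable if it is nonzero and not the direct sum of two nonzero
homogeneous submodules. -/
def IsIndecomposable (M : QGradedModule 𝒜) : Prop :=
  Nontrivial M.carrier ∧ ∀ A B : Submodule R M.carrier,
    M.IsHomogeneous A → M.IsHomogeneous B → IsCompl A B → A = ⊥ ∨ B = ⊥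

/-- `M` is, up to a shift, isomorphic to a graded direct summand of `N`. -/
def IsSummand (M N : QGradedModule 𝒜) : Prop :=
  ∃ (A B : Submodule R N.carrier) (hA : N.IsHomogeneous A), N.IsHomogeneous B ∧ IsCompl A B ∧
    M.ShiftIso (N.sub A hA)

/-- `N` is a finite direct sum of indecomposable homogeneous submodules, exactly `a` of which are
isomorphic to `M` up to a shift. -/
def HasMultiplicity (M N : QGradedModule 𝒜) (a : ℕ) : Prop :=
  ∃ (r : ℕ) (A : Fin r → Submodule R N.carrier) (hA : ∀ i, N.IsHomogeneous (A i)),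
    DirectSum.IsInternal A ∧ (∀ i, (N.sub (A i) (hA i)).IsIndecomposable) ∧
    Nat.card {i : Fin r // M.ShiftIso (N.sub (A i) (hA i))} = a

/-- The graded ring `R` as a `ℚ`-graded module over itself: the piece of degree `α` is `𝒜 n` if
`α = n` is a natural number and `0` otherwise. -/
def self (𝒜 : ℕ → Submodule k R) [GradedAlgebra 𝒜] : QGradedModule 𝒜 where
  carrier := R
  piece α := ⨆ (n : ℕ) (_ : (n : ℚ) = α), (𝒜 n).toAddSubgroup
  indep := by
    have hind : iSupIndep fun n => (𝒜 n).toAddSubgroup :=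
      (show DirectSum.IsInternal fun n => (𝒜 n).toAddSubgroup from
        DirectSum.Decomposition.isInternal 𝒜).addSubgroup_iSupIndep
    intro α
    by_cases hα : ∃ n : ℕ, (n : ℚ) = α
    · obtain ⟨n, rfl⟩ := hα
      refine (hind n).mono (iSup₂_le fun m hm => ?_) (iSup₂_le fun β hβ => iSup₂_le fun m hm => ?_)
      · rw [Nat.cast_injective hm]
      · refine le_iSup₂_of_le m (fun h => hβ ?_) le_rfl
        rw [← hm, h]
    · have h : (⨆ (n : ℕ) (_ : (n : ℚ) = α), (𝒜 n).toAddSubgroup) = ⊥ :=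
        le_bot_iff.1 (iSup₂_le fun n hn => (hα ⟨n, hn⟩).elim)
      exact disjoint_iff_inf_le.2 (inf_le_left.trans h.le)
  iSup_piece := by
    rw [eq_top_iff]
    intro x _
    classical
    rw [← DirectSum.sum_support_decompose 𝒜 x]
    refine AddSubgroup.sum_mem _ fun n _ => ?_
    have h : (𝒜 n).toAddSubgroup ≤
        ⨆ (α : ℚ) (n : ℕ) (_ : (n : ℚ) = α), (𝒜 n).toAddSubgroup :=
      le_iSup_of_le (n : ℚ) (le_iSup₂_of_le n rfl le_rfl)
    exact h (DirectSum.decompose 𝒜 x n).2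
  smul_mem n α a m ha hm := by
    by_cases hα : ∃ l : ℕ, (l : ℚ) = α
    · obtain ⟨l, rfl⟩ := hα
      have h1 : (⨆ (n : ℕ) (_ : (n : ℚ) = (l : ℚ)), (𝒜 n).toAddSubgroup) ≤
          (𝒜 l).toAddSubgroup := iSup₂_le fun m hm => by rw [Nat.cast_injective hm]
      have h2 : (𝒜 (n + l)).toAddSubgroup ≤
          ⨆ (j : ℕ) (_ : (j : ℚ) = (n : ℚ) + (l : ℚ)), (𝒜 j).toAddSubgroup :=
        le_iSup₂_of_le (n + l) (by push_cast; rfl) le_rfl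
      exact h2 (SetLike.GradedMul.mul_mem ha (h1 hm))
    · have h : (⨆ (n : ℕ) (_ : (n : ℚ) = α), (𝒜 n).toAddSubgroup) = ⊥ :=
        le_bot_iff.1 (iSup₂_le fun n hn => (hα ⟨n, hn⟩).elim)
      rw [h] at hm
      rw [AddSubgroup.mem_bot.1 hm, smul_zero]
      exact AddSubgroup.zero_mem _

/-- The graded module `ᵉM`, with the grading `(ᵉM)_α = M_{p^e α}`. -/
def frob (p : ℕ) [Fact p.Prime] [ExpChar R p] [GradedAlgebra 𝒜] (e : ℕ) (M : QGradedModule 𝒜) :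
    QGradedModule 𝒜 where
  carrier := FrobeniusModule p e M.carrier
  piece α := M.piece ((p : ℚ) ^ e * α)
  indep := M.indep.comp (f := fun α : ℚ => (p : ℚ) ^ e * α)
    (mul_right_injective₀ (pow_ne_zero e (Nat.cast_ne_zero.2 (Fact.out : p.Prime).ne_zero)))
  iSup_piece := by
    have hs : Function.Surjective fun α : ℚ => (p : ℚ) ^ e * α :=
      mul_left_surjective₀ (pow_ne_zero e (Nat.cast_ne_zero.2 (Fact.out : p.Prime).ne_zero))
    exact (hs.iSup_comp M.piece).trans M.iSup_piece
  smul_mem n α a m ha hm := by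
    have h1 : a ^ (p ^ e) ∈ 𝒜 (p ^ e * n) := by
      simpa using SetLike.pow_mem_graded (p ^ e) ha
    have h2 := M.smul_mem (p ^ e * n) ((p : ℚ) ^ e * α) (a ^ (p ^ e)) m.un h1 hm
    have h3 : ((p ^ e * n : ℕ) : ℚ) + (p : ℚ) ^ e * α = (p : ℚ) ^ e * (n + α) := by
      push_cast
      ring
    rw [h3] at h2
    exact h2

end QGradedModule

/-- Graded finite F-representation type: up to isomorphism and shift only finitely many
indecomposable graded modules occur as graded direct summands of the `ᵉR`, `e ∈ ℕ`. -/
def HasGradedFFRT (p : ℕ) [Fact p.Prime] {k : Type v} {R : Type u} [CommRing k] [CommRing R]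
    [Algebra k R] [ExpChar R p] (𝒜 : ℕ → Submodule k R) [GradedAlgebra 𝒜] : Prop :=
  ∃ (n : ℕ) (M : Fin n → QGradedModule 𝒜), ∀ (e : ℕ) (N : QGradedModule 𝒜),
    N.IsIndecomposable → N.IsSummand ((QGradedModule.self 𝒜).frob p e) → ∃ i, N.ShiftIso (M i)

/-- `M 0, …, M (n - 1)` is the list, without repetition up to isomorphism and shift, of all
indecomposable graded direct summands of the graded modules `ᵉR`, `e ∈ ℕ`. -/
structure IsGradedSummandList (p : ℕ) [Fact p.Prime] {k : Type v} {R : Type u} [CommRing k]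
    [CommRing R] [Algebra k R] [ExpChar R p] (𝒜 : ℕ → Submodule k R) [GradedAlgebra 𝒜] {n : ℕ}
    (M : Fin n → QGradedModule 𝒜) : Prop where
  indecomposable : ∀ i, (M i).IsIndecomposable
  summand : ∀ i, ∃ e : ℕ, (M i).IsSummand ((QGradedModule.self 𝒜).frob p e)
  not_iso : ∀ i j, (M i).ShiftIso (M j) → i = j
  complete : ∀ (e : ℕ) (N : QGradedModule 𝒜), N.IsIndecomposable →
    N.IsSummand ((QGradedModule.self 𝒜).frob p e) → ∃ i, N.ShiftIso (M i)

end Graded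

universe w


/-! ### Local algebras over complete local rings -/

/-! Both cases are instances of one statement about `ℚ`-graded modules over a Noetherian graded
algebra `R` whose degree-zero part is the image of a complete Noetherian local ring `k`. In the
graded case `k` is the given field. In the complete case `k` is `R` itself, the grading is
`trivialGrading`, and ordinary modules are the graded modules concentrated in degree zero.

Krull–Schmidt. The degree-zero endomorphisms of a finitely generated graded module form a finite
`k`-algebra. If the module is indecomposable, this algebra has only the idempotents 0 and 1, and
lifting idempotents from an Artinian quotient shows that it is local. Local endomorphism rings make
the multiplicities independent of the decomposition, also when summands are counted up to shift.
Since Frobenius push-forward commutes with direct sums and is additive in its exponent, the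
multiplicities in ᵉM_j form the matrix E^e, where E is the matrix for e = 1
(`exists_multiplicity_matrix`).

Primitivity. `R` is indecomposable and a summand of ⁰R, so it is some M_{i₀}. Each M_i is a summand
of some ᵃR, which makes (E^a)_{i,i₀} positive. Conversely, strong F-regularity makes `R` a summand
of some ˢM_j: embed M_j in ᵉR, take a nonzero homogeneous element, and split off the corresponding
nonzero c in the domain `R`. Thus (E^s)_{i₀,j} is positive. Finally `R` is F-split, so E has a loop
at i₀, and some power of E is positive (`exists_pow_pos`).

Perron–Frobenius. For a primitive matrix, E^e / ρ^e converges to a positive matrix for some ρ > 0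
(`exists_tendsto_pow_div`), so only ρ has to be identified. Let m be a maximal ideal with residue
field κ and put μ_i = length(M_i / mM_i), which is positive. Taking the fibre of ᵉR gives Σ_i μ_i
(E^e)_{i,i₀} = [κ : κ^p]^e · length(R / m^[p^e]). The last length lies between two positive constant
multiples of p^{de}, which forces ρ = p^d [κ : κ^p] (`exists_tendsto_pow_div_of_bounds`). The upper
bound comes from height-many elements over which m is minimal; the lower bound comes from a chain of
primes of length d (`exists_pow_le_mul_of_ltSeries`). Convergence of length(R / m^[p^e]) / p^{de} is
not an input. -/

theorem IsPrecomplete.of_module_finite {A : Type*} [CommRing A] (I : Ideal A) [IsPrecomplete I A]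
    (M : Type*) [AddCommGroup M] [Module A M] [Module.Finite A M] : IsPrecomplete I M := by
  rw [← AdicCompletion.of_surjective_iff]
  intro z
  -- For finite M the map from Â ⊗ M to the completion of M is onto, and Â is the image of A.
  obtain ⟨t, rfl⟩ := AdicCompletion.ofTensorProduct_surjective_of_finite I M z
  induction t with
  | zero => exact ⟨0, by simp⟩
  | add x y hx hy =>
    obtain ⟨a, ha⟩ := hx
    obtain ⟨b, hb⟩ := hy
    exact ⟨a + b, by rw [map_add, map_add, ha, hb]⟩
  | tmul r m =>
    obtain ⟨a, rfl⟩ := AdicCompletion.of_surjective I A r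
    refine ⟨a • m, ?_⟩
    rw [AdicCompletion.ofTensorProduct_tmul, map_smul]
    ext n
    rfl

open IsLocalRing in
theorem isAdicComplete_map_of_module_finite (A B : Type*) [CommRing A] [IsLocalRing A]
    [IsNoetherianRing A] [IsAdicComplete (maximalIdeal A) A] [CommRing B] [Algebra A B]
    [Module.Finite A B] : IsAdicComplete ((maximalIdeal A).map (algebraMap A B)) B where
  toIsHausdorff := IsHausdorff.map_algebraMap_iff.2 inferInstance
  toIsPrecomplete := IsPrecomplete.map_algebraMap_iff.2
    (IsPrecomplete.of_module_finite _ _)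

/-- Fitting's argument: the powers of x stabilise up to divisibility, say x^(n+1) y = x^n, and then
x^n y^n is idempotent. Its value 0 makes x nilpotent, its value 1 makes x a unit. -/
theorem isUnit_or_isUnit_one_sub_of_isArtinianRing {B : Type*} [CommRing B] [IsArtinianRing B]
    (h : ∀ e : B, e * e = e → e = 0 ∨ e = 1) (x : B) : IsUnit x ∨ IsUnit (1 - x) := by
  obtain ⟨n, y, hy⟩ := IsArtinian.exists_pow_succ_smul_dvd x (1 : B)
  have hy' : x ^ (n + 1) * y = x ^ n := by simpa using hy
  have key : ∀ m, x ^ (n + m) * y ^ m = x ^ n := by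
    intro m
    induction m with
    | zero => simp
    | succ m ih =>
      calc x ^ (n + (m + 1)) * y ^ (m + 1) = x ^ m * y ^ m * (x ^ (n + 1) * y) := by ring
        _ = x ^ (n + m) * y ^ m := by rw [hy']; ring
        _ = x ^ n := ih
  have hn := key n
  rcases h (x ^ n * y ^ n) (by
    calc x ^ n * y ^ n * (x ^ n * y ^ n) = x ^ (n + n) * y ^ n * y ^ n := by ring
      _ = x ^ n * y ^ n := by rw [hn]) with h0 | h1
  · right
    have : x ^ n = 0 := by
      calc x ^ n = x ^ n * (x ^ n * y ^ n) := by rw [← mul_assoc, ← pow_add, hn]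
        _ = 0 := by rw [h0, mul_zero]
    exact IsNilpotent.isUnit_one_sub ⟨n, this⟩
  · rcases Nat.eq_zero_or_pos n with rfl | hpos
    · left
      exact IsUnit.of_mul_eq_one y (by simpa using hy')
    · left
      have : IsUnit (x ^ n) := IsUnit.of_mul_eq_one _ h1
      exact (isUnit_pow_iff hpos.ne').1 this

-- B is complete along the extension I of the maximal ideal, so (B, I) is Henselian. Idempotents of
-- the Artinian ring B/I therefore lift to B as roots of X² - X, and units lift because I lies in
-- the Jacobson radical.
open IsLocalRing Polynomial in
theorem isUnit_or_isUnit_one_sub_of_module_finite {A B : Type*} [CommRing A] [IsLocalRing A]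
    [IsNoetherianRing A] [IsAdicComplete (maximalIdeal A) A] [CommRing B] [Algebra A B]
    [Module.Finite A B] (h : ∀ e : B, e * e = e → e = 0 ∨ e = 1) (x : B) :
    IsUnit x ∨ IsUnit (1 - x) := by
  set I : Ideal B := (maximalIdeal A).map (algebraMap A B) with hI
  have : IsAdicComplete I B := isAdicComplete_map_of_module_finite A B
  have hH : HenselianRing B I := inferInstance
  have hJ := hH.jac
  have hunit : ∀ y : B, IsUnit (Ideal.Quotient.mk I y) → IsUnit y := by
    intro y hy
    obtain ⟨z, hz⟩ := hy.exists_right_inv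
    obtain ⟨z, rfl⟩ := Ideal.Quotient.mk_surjective z
    have h1 : y * z - 1 ∈ I := by
      rw [← Ideal.Quotient.eq]
      simpa using hz
    exact isUnit_of_mul_isUnit_left (Ideal.isUnit_of_sub_one_mem_jacobson_bot _ (hJ h1))
  letI : Algebra (ResidueField A) (B ⧸ I) :=
    (Ideal.quotientMap I (algebraMap A B) Ideal.le_comap_map).toAlgebra
  have : IsScalarTower A (ResidueField A) (B ⧸ I) := IsScalarTower.of_algebraMap_eq fun a => rfl
  have : Module.Finite (ResidueField A) (B ⧸ I) :=
    Module.Finite.of_restrictScalars_finite A _ _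
  have : IsArtinianRing (B ⧸ I) := IsArtinianRing.of_finite (ResidueField A) _
  have hid : ∀ e : B ⧸ I, e * e = e → e = 0 ∨ e = 1 := by
    intro e he
    obtain ⟨a, rfl⟩ := Ideal.Quotient.mk_surjective e
    obtain ⟨r, hr, hra⟩ := hH.is_henselian (X ^ 2 - X)
      (by simpa using monic_X_pow_sub (n := 2) (p := (X : B[X])) (degree_X_le.trans_lt (by norm_num))) a
      (by
        rw [← Ideal.Quotient.eq_zero_iff_mem]
        simp [pow_two, he])
      (by
        -- The derivative 2a - 1 is its own inverse modulo I: (2a - 1)² = 1 + 4(a² - a).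
        apply IsUnit.of_mul_eq_one (Ideal.Quotient.mk I (2 * a - 1))
        have h2 : (derivative (X ^ 2 - X : B[X])).eval a = 2 * a - 1 := by
          simp [one_add_one_eq_two]
        have h3 : Ideal.Quotient.mk I 2 = 2 := map_ofNat _ 2
        rw [h2, map_sub, map_mul, map_one, h3]
        linear_combination 4 * he)
    have hr' : r * r = r := by
      have : r ^ 2 - r = 0 := by simpa [IsRoot] using hr
      linear_combination this
    rw [← Ideal.Quotient.eq.2 hra]
    rcases h r hr' with rfl | rfl
    · left; simp
    · right; simp
  rcases isUnit_or_isUnit_one_sub_of_isArtinianRing hid (Ideal.Quotient.mk I x) with h1 | h1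
  · exact Or.inl (hunit x h1)
  · exact Or.inr (hunit _ (by simpa using h1))

open IsLocalRing in
/-- A module-finite algebra without nontrivial idempotents over a complete Noetherian local ring
is local. -/
theorem IsLocalRing.of_module_finite_of_idempotents {A Λ : Type*} [CommRing A] [IsLocalRing A]
    [IsNoetherianRing A] [IsAdicComplete (maximalIdeal A) A] [Ring Λ] [Nontrivial Λ] [Algebra A Λ]
    [Module.Finite A Λ] (h : ∀ e : Λ, e * e = e → e = 0 ∨ e = 1) : IsLocalRing Λ := by
  refine IsLocalRing.of_isUnit_or_isUnit_one_sub_self fun x => ?_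
  -- The subalgebra A[x] is commutative, finite over A because A is Noetherian, and its idempotents
  -- are idempotents of Λ.
  let B := Algebra.adjoin A {x}
  have := Algebra.isMulCommutative_adjoin A (s := {x}) (by simp)
  have : IsNoetherian A Λ := isNoetherian_of_isNoetherianRing_of_finite A Λ
  have : Module.Finite A B := Module.Finite.of_injective B.val.toLinearMap Subtype.val_injective
  have := isUnit_or_isUnit_one_sub_of_module_finite (A := A) (B := B) (fun e he => by
    rcases h e (congrArg Subtype.val he) with h | h
    · exact Or.inl (Subtype.ext h)
    · exact Or.inr (Subtype.ext h)) ⟨x, Algebra.self_mem_adjoin_singleton A x⟩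
  exact this.imp (fun h => h.map B.val) fun h => h.map B.val

/-! ### The Perron–Frobenius theorem for primitive matrices -/

section PerronFrobenius

open Filter Topology Matrix

variable {ι : Type*} [Fintype ι] [Nonempty ι]

theorem mulVec_nonneg_of_nonneg {A : Matrix ι ι ℝ} (hA : ∀ i j, 0 ≤ A i j) {x : ι → ℝ}
    (hx : ∀ i, 0 ≤ x i) (i : ι) : 0 ≤ (A *ᵥ x) i :=
  Finset.sum_nonneg fun j _ => mul_nonneg (hA i j) (hx j)

theorem mulVec_pos_of_pos {A : Matrix ι ι ℝ} (hA : ∀ i j, 0 < A i j) {x : ι → ℝ}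
    (hx : ∀ i, 0 ≤ x i) (hx0 : x ≠ 0) (i : ι) : 0 < (A *ᵥ x) i := by
  obtain ⟨j, hj⟩ := Function.ne_iff.1 hx0
  exact Finset.sum_pos' (fun j _ => mul_nonneg (hA i j).le (hx j))
    ⟨j, Finset.mem_univ j, mul_pos (hA i j) (lt_of_le_of_ne (hx j) (Ne.symm hj))⟩

variable [DecidableEq ι]

/-- Existence of a positive eigenvector of a primitive matrix. -/
theorem exists_pos_eigenvector {A : Matrix ι ι ℝ} (hA : ∀ i j, 0 ≤ A i j) {t : ℕ} (ht0 : t ≠ 0)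
    (ht : ∀ i j, 0 < (A ^ t) i j) :
    ∃ (ρ : ℝ) (x : ι → ℝ), 0 < ρ ∧ (∀ i, 0 < x i) ∧ A *ᵥ x = ρ • x := by
  set C : ℝ := ∑ i, ∑ j, A i j with hC
  have hbound : ∀ (x : ι → ℝ) (r : ℝ), x ∈ stdSimplex ℝ ι → (∀ i, r * x i ≤ (A *ᵥ x) i) →
      r ≤ C := by
    intro x r hx h
    calc r = ∑ i, r * x i := by rw [← Finset.mul_sum, hx.2, mul_one]
      _ ≤ ∑ i, (A *ᵥ x) i := Finset.sum_le_sum fun i _ => h i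
      _ ≤ C := Finset.sum_le_sum fun i _ => Finset.sum_le_sum fun j _ =>
        mul_le_of_le_one_right (hA i j) (by
          rw [← hx.2]
          exact Finset.single_le_sum (f := x) (fun i _ => hx.1 i) (Finset.mem_univ j))
  have hC0 : 0 ≤ C := Finset.sum_nonneg fun i _ => Finset.sum_nonneg fun j _ => hA i j
  -- Collatz–Wielandt: the eigenvalue is the largest r such that r x ≤ A x for some x in the
  -- simplex. The bound r ≤ C makes the set of such pairs compact.
  set K : Set ((ι → ℝ) × ℝ) := (stdSimplex ℝ ι ×ˢ Set.Icc 0 C) ∩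
    {q | ∀ i, q.2 * q.1 i ≤ (A *ᵥ q.1) i} with hK
  have hclosed : IsClosed {q : (ι → ℝ) × ℝ | ∀ i, q.2 * q.1 i ≤ (A *ᵥ q.1) i} := by
    rw [Set.ofPred_forall]
    refine isClosed_iInter fun i => isClosed_le (by fun_prop) ?_
    have : (fun q : (ι → ℝ) × ℝ => (A *ᵥ q.1) i) = fun q => ∑ j, A i j * q.1 j := rfl
    rw [this]
    fun_prop
  have hcomp : IsCompact K := ((isCompact_stdSimplex ℝ ι).prod isCompact_Icc).inter_right hclosed
  have hne : K.Nonempty := by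
    obtain ⟨i⟩ := ‹Nonempty ι›
    refine ⟨(Pi.single i 1, 0), ⟨single_mem_stdSimplex ℝ i, le_rfl, hC0⟩, fun j => ?_⟩
    rw [zero_mul]
    exact mulVec_nonneg_of_nonneg hA (single_mem_stdSimplex ℝ i).1 j
  obtain ⟨⟨x, r⟩, hxr, hmax⟩ := hcomp.exists_isMaxOn hne continuous_snd.continuousOn
  obtain ⟨⟨hx, hr⟩, hle⟩ := hxr
  simp only at hx hr hle
  have hx0 : x ≠ 0 := by
    rintro rfl
    simpa using hx.2
  have heig : A *ᵥ x = r • x := by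
    by_contra hne
    -- If A x - r x is nonzero, it is nonnegative, so applying A^t makes it strictly positive. Then
    -- y = A^t x satisfies A y ≥ (r + ε) y, against the maximality of r.
    set y := A ^ t *ᵥ x with hy
    set w := A ^ t *ᵥ (A *ᵥ x - r • x) with hw
    have hypos : ∀ i, 0 < y i := mulVec_pos_of_pos ht hx.1 hx0
    have hwpos : ∀ i, 0 < w i := mulVec_pos_of_pos ht
      (fun i => by simpa using hle i) (sub_ne_zero.2 hne)
    have hwy : w = A *ᵥ y - r • y := by
      rw [hw, hy, mulVec_sub, mulVec_smul, mulVec_mulVec, mulVec_mulVec, ← pow_succ, ← pow_succ']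
    set ε := Finset.univ.inf' Finset.univ_nonempty (fun i => w i / y i) with hε
    have hεpos : 0 < ε := by
      rw [hε, Finset.lt_inf'_iff]
      exact fun i _ => div_pos (hwpos i) (hypos i)
    set S := ∑ i, y i with hS
    have hSpos : 0 < S := Finset.sum_pos (fun i _ => hypos i) Finset.univ_nonempty
    have hy' : S⁻¹ • y ∈ stdSimplex ℝ ι :=
      ⟨fun i => mul_nonneg (inv_nonneg.2 hSpos.le) (hypos i).le, by
        simp only [Pi.smul_apply, smul_eq_mul, ← Finset.mul_sum]
        exact inv_mul_cancel₀ hSpos.ne'⟩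
    have hle' : ∀ i, (r + ε) * (S⁻¹ • y) i ≤ (A *ᵥ (S⁻¹ • y)) i := by
      intro i
      have h1 : ε ≤ w i / y i := Finset.inf'_le _ (Finset.mem_univ i)
      rw [le_div_iff₀ (hypos i), hwy] at h1
      simp only [Pi.sub_apply, Pi.smul_apply, smul_eq_mul] at h1
      rw [mulVec_smul]
      simp only [Pi.smul_apply, smul_eq_mul]
      rw [mul_left_comm]
      exact mul_le_mul_of_nonneg_left (by linarith) (inv_nonneg.2 hSpos.le)
    have := hmax (show (S⁻¹ • y, r + ε) ∈ K from
      ⟨⟨hy', by linarith [hr.1], hbound _ _ hy' hle'⟩, hle'⟩)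
    simp only [Set.mem_ofPred_eq] at this
    linarith
  have hpow : ∀ s : ℕ, A ^ s *ᵥ x = r ^ s • x := by
    intro s
    induction s with
    | zero => simp
    | succ s ih => rw [pow_succ, ← mulVec_mulVec, heig, mulVec_smul, ih, smul_smul, pow_succ']
  have hpos : ∀ i, 0 < r ^ t * x i := by
    intro i
    have := mulVec_pos_of_pos ht hx.1 hx0 i
    rwa [hpow] at this
  refine ⟨r, x, ?_, fun i => ?_, heig⟩
  · obtain ⟨i⟩ := ‹Nonempty ι›
    refine lt_of_le_of_ne hr.1 ?_
    rintro rfl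
    have := hpos i
    rw [zero_pow ht0, zero_mul] at this
    exact lt_irrefl _ this
  · refine lt_of_le_of_ne (hx.1 i) fun h => ?_
    have := hpos i
    rw [← h, mul_zero] at this
    exact lt_irrefl _ this

/-- The powers of a primitive matrix, divided by those of its Perron–Frobenius eigenvalue,
converge to a positive matrix. -/
theorem exists_tendsto_pow_div {A : Matrix ι ι ℝ} (hA : ∀ i j, 0 ≤ A i j) {t : ℕ} (ht0 : t ≠ 0)
    (ht : ∀ i j, 0 < (A ^ t) i j) :
    ∃ ρ : ℝ, 0 < ρ ∧ ∀ i j, ∃ L : ℝ, 0 < L ∧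
      Tendsto (fun e : ℕ => (A ^ e) i j / ρ ^ e) atTop (𝓝 L) := by
  obtain ⟨ρ, v, hρ, hv, heig⟩ := exists_pos_eigenvector hA ht0 ht
  have hpow : ∀ s : ℕ, A ^ s *ᵥ v = ρ ^ s • v := by
    intro s
    induction s with
    | zero => simp
    | succ s ih => rw [pow_succ, ← mulVec_mulVec, heig, mulVec_smul, ih, smul_smul, pow_succ']
  have hApow : ∀ s i j, 0 ≤ (A ^ s) i j := by
    intro s
    induction s with
    | zero =>
      intro i j
      rw [pow_zero, Matrix.one_apply]
      split_ifs <;> norm_num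
    | succ s ih =>
      intro i j
      rw [pow_succ, Matrix.mul_apply]
      exact Finset.sum_nonneg fun l _ => mul_nonneg (ih i l) (hA l j)
  refine ⟨ρ, hρ, fun i j => ?_⟩
  -- Conjugating A^s / ρ^s by the diagonal matrix of the eigenvector v makes it stochastic. The
  -- rescaled column `w` is then averaged by P at each step, so its minimum increases and its
  -- maximum decreases.
  set P : ℕ → ι → ι → ℝ := fun s i l => (A ^ s) i l * v l / (ρ ^ s * v i) with hP
  have hP0 : ∀ s i l, 0 ≤ P s i l := fun s i l =>
    div_nonneg (mul_nonneg (hApow s i l) (hv l).le) (mul_nonneg (pow_nonneg hρ.le s) (hv i).le)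
  have hP1 : ∀ s i, ∑ l, P s i l = 1 := by
    intro s i
    rw [← Finset.sum_div, div_eq_one_iff_eq (mul_pos (pow_pos hρ s) (hv i)).ne']
    exact congrFun (hpow s) i
  set w : ℕ → ι → ℝ := fun e i => (A ^ e) i j / (ρ ^ e * v i) with hw
  have hstep : ∀ s e i, w (e + s) i = ∑ l, P s i l * w e l := by
    intro s e i
    simp only [hw, hP]
    rw [add_comm e s, pow_add, Matrix.mul_apply, Finset.sum_div]
    refine Finset.sum_congr rfl fun l _ => ?_
    have h1 := (hv i).ne'
    have h2 := (hv l).ne'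
    have h3 := hρ.ne'
    rw [pow_add]
    field_simp
  set a : ℕ → ℝ := fun e => Finset.univ.inf' Finset.univ_nonempty (w e) with ha
  set b : ℕ → ℝ := fun e => Finset.univ.sup' Finset.univ_nonempty (w e) with hb
  have haw : ∀ e i, a e ≤ w e i := fun e i => Finset.inf'_le _ (Finset.mem_univ i)
  have hwb : ∀ e i, w e i ≤ b e := fun e i => Finset.le_sup' _ (Finset.mem_univ i)
  have hmono : Monotone a := by
    refine monotone_nat_of_le_succ fun e => ?_
    rw [ha, Finset.le_inf'_iff]
    intro i _
    rw [hstep 1 e i]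
    calc a e = ∑ l, P 1 i l * a e := by rw [← Finset.sum_mul, hP1, one_mul]
      _ ≤ _ := Finset.sum_le_sum fun l _ => mul_le_mul_of_nonneg_left (haw e l) (hP0 1 i l)
  have hanti : Antitone b := by
    refine antitone_nat_of_succ_le fun e => ?_
    rw [hb, Finset.sup'_le_iff]
    intro i _
    rw [hstep 1 e i]
    calc _ ≤ ∑ l, P 1 i l * b e := Finset.sum_le_sum fun l _ =>
          mul_le_mul_of_nonneg_left (hwb e l) (hP0 1 i l)
      _ = b e := by rw [← Finset.sum_mul, hP1, one_mul]
  set ε := Finset.univ.inf' Finset.univ_nonempty (fun q : ι × ι => P t q.1 q.2) with hε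
  have hεpos : 0 < ε := by
    rw [hε, Finset.lt_inf'_iff]
    exact fun q _ => div_pos (mul_pos (ht _ _) (hv _)) (mul_pos (pow_pos hρ t) (hv _))
  -- Every entry of P t is at least ε, so after t steps each average contains the maximum with
  -- weight at least ε. As a converges, the right-hand side tends to 0 and the oscillation b - a
  -- vanishes.
  have hgap : ∀ e, ε * (b e - a e) ≤ a (e + t) - a e := by
    intro e
    rw [le_sub_iff_add_le, ha, Finset.le_inf'_iff]
    intro i _
    obtain ⟨l, -, hl⟩ := Finset.exists_mem_eq_sup' Finset.univ_nonempty (w e)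
    rw [hstep t e i]
    calc ε * (b e - a e) + a e ≤ P t i l * (w e l - a e) + a e := by
          have h1 : ε ≤ P t i l := Finset.inf'_le (fun q : ι × ι => P t q.1 q.2)
            (Finset.mem_univ (i, l))
          have h2 : b e = w e l := hl
          rw [h2]
          have := mul_le_mul_of_nonneg_right h1 (sub_nonneg.2 (haw e l))
          linarith
      _ ≤ (∑ m, P t i m * (w e m - a e)) + a e := by
          have := Finset.single_le_sum (f := fun m => P t i m * (w e m - a e))
            (fun m _ => mul_nonneg (hP0 t i m) (sub_nonneg.2 (haw e m))) (Finset.mem_univ l)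
          linarith
      _ = ∑ m, P t i m * w e m := by
          simp only [mul_sub, Finset.sum_sub_distrib, ← Finset.sum_mul, hP1]
          ring
  have hab : ∀ e, a e ≤ b e := fun e => (haw e i).trans (hwb e i)
  have hbdd : BddAbove (Set.range a) :=
    ⟨b 0, by rintro _ ⟨e, rfl⟩; exact (hab e).trans (hanti (Nat.zero_le e))⟩
  have hlim := tendsto_atTop_ciSup hmono hbdd
  set L := ⨆ e, a e with hL
  have hL0 : 0 < L := by
    refine lt_of_lt_of_le ?_ (le_ciSup hbdd t)
    rw [ha, Finset.lt_inf'_iff]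
    exact fun i _ => div_pos (ht _ _) (mul_pos (pow_pos hρ t) (hv _))
  have hgap0 : Tendsto (fun e => ε⁻¹ * (a (e + t) - a e)) atTop (𝓝 0) := by
    have h1 : Tendsto (fun e => a (e + t)) atTop (𝓝 L) := (tendsto_add_atTop_iff_nat t).2 hlim
    simpa using (h1.sub hlim).const_mul ε⁻¹
  have hwlim : Tendsto (fun e => w e i) atTop (𝓝 L) := by
    refine tendsto_of_tendsto_of_tendsto_of_le_of_le hlim
      (by simpa using hlim.add hgap0) (fun e => haw e i) fun e => ?_
    have h1 : b e - a e ≤ ε⁻¹ * (a (e + t) - a e) := by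
      rw [le_inv_mul_iff₀ hεpos]
      exact hgap e
    have := hwb e i
    simp only
    linarith
  refine ⟨L * v i, mul_pos hL0 (hv i), ?_⟩
  refine (hwlim.mul_const (v i)).congr fun e => ?_
  have h1 := (hv i).ne'
  have h3 := hρ.ne'
  simp only [hw]
  field_simp

/-- If some weighted column sum of the powers of a primitive matrix grows like `l ^ e`, then so do
all their entries. -/
theorem exists_tendsto_pow_div_of_bounds {A : Matrix ι ι ℝ} (hA : ∀ i j, 0 ≤ A i j) {t : ℕ}
    (ht0 : t ≠ 0) (ht : ∀ i j, 0 < (A ^ t) i j) {l c C : ℝ} (hl : 0 < l) (hc : 0 < c)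
    (μ : ι → ℝ) (hμ : ∀ i, 0 < μ i) (j : ι) (hlow : ∀ e : ℕ, c * l ^ e ≤ ∑ i, μ i * (A ^ e) i j)
    (hup : ∀ e : ℕ, ∑ i, μ i * (A ^ e) i j ≤ C * l ^ e) (i i' : ι) :
    ∃ L : ℝ, 0 < L ∧ Tendsto (fun e : ℕ => (A ^ e) i i' / l ^ e) atTop (𝓝 L) := by
  obtain ⟨ρ, hρ, h⟩ := exists_tendsto_pow_div hA ht0 ht
  -- The weighted column sum divided by ρ^e has a positive finite limit T. If ρ < l the lower bound
  -- makes it diverge; if ρ > l the upper bound makes it tend to 0.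
  suffices hρl : ρ = l by
    subst hρl
    exact h i i'
  choose L hL0 hL using h
  have hsum : Tendsto (fun e : ℕ => (∑ i, μ i * (A ^ e) i j) / ρ ^ e) atTop
      (𝓝 (∑ i, μ i * L i j)) := by
    simp only [Finset.sum_div, mul_div_assoc]
    exact tendsto_finsetSum _ fun i _ => (hL i j).const_mul (μ i)
  set T := ∑ i, μ i * L i j with hT
  have hT0 : 0 < T := Finset.sum_pos (fun i _ => mul_pos (hμ i) (hL0 i j)) Finset.univ_nonempty
  rcases lt_trichotomy ρ l with hlt | heq | hlt
  · exfalso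
    have h1 : Tendsto (fun e : ℕ => c * (l / ρ) ^ e) atTop atTop :=
      (tendsto_pow_atTop_atTop_of_one_lt ((one_lt_div hρ).2 hlt)).const_mul_atTop hc
    refine not_tendsto_atTop_of_tendsto_nhds hsum (tendsto_atTop_mono (fun e => ?_) h1)
    rw [div_pow, ← mul_div_assoc]
    exact div_le_div_of_nonneg_right (hlow e) (pow_nonneg hρ.le e)
  · exact heq
  · exfalso
    have h1 : Tendsto (fun e : ℕ => C * (l / ρ) ^ e) atTop (𝓝 (C * 0)) :=
      (tendsto_pow_atTop_nhds_zero_of_lt_one (div_nonneg hl.le hρ.le)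
        ((div_lt_one hρ).2 hlt)).const_mul C
    have := le_of_tendsto_of_tendsto' hsum h1 fun e => by
      rw [div_pow, ← mul_div_assoc]
      exact div_le_div_of_nonneg_right (hup e) (pow_nonneg hρ.le e)
    rw [mul_zero] at this
    exact absurd hT0 (not_lt.2 this)

end PerronFrobenius

/-! ### Lengths and restriction of scalars -/

section Length

/-- The length of an `R`-module over `S`, where `S` acts through the ring homomorphism `φ`. -/
noncomputable def lengthAlong {S : Type*} {R : Type*} [CommRing S] [CommRing R] (φ : S →+* R)
    (N : Type*) [AddCommGroup N] [Module R N] : ℕ∞ :=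
  @Module.length S N _ _ (Module.compHom N φ)

variable {S : Type*} {R : Type*} [CommRing S] [CommRing R] (φ : S →+* R)

theorem lengthAlong_congr {N N' : Type*} [AddCommGroup N] [Module R N] [AddCommGroup N']
    [Module R N'] (f : N ≃ₗ[R] N') : lengthAlong φ N = lengthAlong φ N' := by
  let := Module.compHom N φ
  let := Module.compHom N' φ
  exact LinearEquiv.length_eq (R := S)
    { f with map_smul' := fun r x => f.map_smul (φ r) x }

theorem lengthAlong_eq_add {N : Type*} [AddCommGroup N] [Module R N] (K : Submodule R N) :
    lengthAlong φ N = lengthAlong φ K + lengthAlong φ (N ⧸ K) := by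
  let := Module.compHom N φ
  let := Module.compHom K φ
  let := Module.compHom (N ⧸ K) φ
  exact Module.length_eq_add_of_exact (R := S)
    { K.subtype with map_smul' := fun r x => K.subtype.map_smul (φ r) x }
    { K.mkQ with map_smul' := fun r x => K.mkQ.map_smul (φ r) x }
    (Submodule.subtype_injective K) (Submodule.mkQ_surjective K)
    (LinearMap.exact_subtype_mkQ K)

theorem lengthAlong_of_subsingleton (N : Type*) [AddCommGroup N] [Module R N] [Subsingleton N] :
    lengthAlong φ N = 0 := by
  let := Module.compHom N φ
  exact Module.length_eq_zero

theorem lengthAlong_pos (N : Type*) [AddCommGroup N] [Module R N] [Nontrivial N] :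
    0 < lengthAlong φ N := by
  let := Module.compHom N φ
  exact Module.length_pos

theorem lengthAlong_comp_of_surjective {T : Type*} [CommRing T] (ψ : T →+* S)
    (hψ : Function.Surjective ψ) (N : Type*) [AddCommGroup N] [Module R N] :
    lengthAlong (φ.comp ψ) N = lengthAlong φ N := by
  let : Algebra T S := ψ.toAlgebra
  let := Module.compHom N φ
  let := Module.compHom N (φ.comp ψ)
  have : IsScalarTower T S N := ⟨fun a b c => by
    change φ (ψ a * b) • c = φ (ψ a) • φ b • c
    rw [map_mul, mul_smul]⟩
  exact Module.length_eq_of_surjective hψ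

theorem lengthAlong_quotient_ker {κ : Type*} [CommRing κ] (π : R →+* κ)
    (hπ : Function.Surjective π) :
    lengthAlong φ (R ⧸ RingHom.ker π) = lengthAlong (π.comp φ) κ := by
  let := Module.compHom κ π
  exact lengthAlong_congr φ (N' := κ)
    { RingHom.quotientKerEquivOfSurjective hπ with
      map_smul' := fun r x => by
        obtain ⟨x, rfl⟩ := Ideal.Quotient.mk_surjective x
        change RingHom.quotientKerEquivOfSurjective hπ (Ideal.Quotient.mk _ (r * x)) = π r * _
        simp }

/-- Length over `S` of an `R`-module of finite length killed by a power of `m`. -/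
theorem lengthAlong_eq_mul {N : Type w} [AddCommGroup N] [Module R N] {m : Ideal R}
    (hm : m.IsMaximal) (s : ℕ) (hN : IsFiniteLength R N)
    (hs : ∀ r ∈ m ^ s, ∀ x : N, r • x = 0) :
    lengthAlong φ N = lengthAlong φ (R ⧸ m) * Module.length R N := by
  induction hN with
  | of_subsingleton =>
    rw [lengthAlong_of_subsingleton, Module.length_eq_zero, mul_zero]
  | @of_simple_quotient M _ _ K hK _ ih =>
    -- A simple quotient is R/I with I maximal; being killed by m^s forces m ≤ I, hence I = m.
    have hquot : Nonempty ((M ⧸ K) ≃ₗ[R] R ⧸ m) := by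
      obtain ⟨I, hI, ⟨e⟩⟩ := isSimpleModule_iff_quot_maximal.1 hK
      have : m ≤ I := by
        refine hI.isPrime.le_of_pow_le (n := s) fun r hr => ?_
        have h1 : r • (Ideal.Quotient.mk I 1) = 0 := by
          apply e.symm.injective
          rw [map_smul, map_zero]
          obtain ⟨y, hy⟩ := K.mkQ_surjective (e.symm (Ideal.Quotient.mk I 1))
          rw [← hy, ← map_smul, hs r hr, map_zero]
        rw [← Ideal.Quotient.eq_zero_iff_mem, ← h1]
        change _ = Ideal.Quotient.mk I (r * 1)
        rw [mul_one]
      obtain rfl := hm.eq_of_le hI.ne_top this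
      exact ⟨e⟩
    obtain ⟨e⟩ := hquot
    have h1 : Module.length R M = Module.length R K + Module.length R (M ⧸ K) :=
      Module.length_eq_add_of_exact K.subtype K.mkQ K.subtype_injective K.mkQ_surjective
        (LinearMap.exact_subtype_mkQ K)
    rw [lengthAlong_eq_add φ K, h1, lengthAlong_congr φ e,
      ih (fun r hr x => Subtype.ext (hs r hr x)), Module.length_eq_one R (M ⧸ K), mul_add, mul_one]

/-- Length over `R` of a field `κ`, on which `R` acts through a surjection `π` followed by
Frobenius. -/
theorem lengthAlong_frobenius_field {p : ℕ} {κ : Type*} [Field κ] [ExpChar κ p] [ExpChar R p]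
    (hfin : (frobenius κ p).Finite) (π : R →+* κ) (hπ : Function.Surjective π) :
    lengthAlong (π.comp (frobenius R p)) κ = frobeniusDegree p κ := by
  -- Frobenius commutes with π and factors as κ → κ^p ⊆ κ. The surjective factors do not change
  -- lengths, which leaves the length of κ over κ^p.
  have h1 : π.comp (frobenius R p) =
      ((frobenius κ p).fieldRange.subtype.comp (frobenius κ p).rangeRestrictField).comp π := by
    ext r
    simp [frobenius_def]
  rw [h1, lengthAlong_comp_of_surjective _ _ hπ,
    lengthAlong_comp_of_surjective _ _ (RingHom.rangeRestrictField_bijective _).2]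
  change Module.length (frobenius κ p).fieldRange κ = _
  have : Module.Finite (frobenius κ p).fieldRange κ :=
    RingHom.Finite.of_comp_finite (f := (frobenius κ p).rangeRestrictField)
      (g := (frobenius κ p).fieldRange.subtype) hfin
  rw [Module.length_eq_finrank]
  rfl

/-- `frobeniusDegree` is a `finrank`, with default value 0 in the infinite case. Finiteness
identifies it with the length of a nonzero module. -/
theorem frobeniusDegree_pos {p : ℕ} {κ : Type*} [Field κ] [ExpChar κ p]
    (hfin : (frobenius κ p).Finite) : 0 < frobeniusDegree p κ := by
  have h := lengthAlong_frobenius_field hfin (RingHom.id κ) Function.surjective_id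
  have h1 := lengthAlong_pos ((RingHom.id κ).comp (frobenius κ p)) κ
  rw [h] at h1
  exact_mod_cast h1

theorem frobeniusDegree_eq_one {p : ℕ} [Fact p.Prime] {κ : Type*} [Field κ] [CharP κ p]
    [PerfectField κ] : frobeniusDegree p κ = 1 := by
  have : PerfectRing κ p := PerfectField.toPerfectRing p
  have hsurj : Function.Surjective (frobenius κ p) := surjective_frobenius κ p
  have h := lengthAlong_frobenius_field (p := p) (RingHom.Finite.of_surjective _ hsurj)
    (RingHom.id κ) Function.surjective_id
  rw [RingHom.id_comp] at h
  have h2 : lengthAlong (frobenius κ p) κ = 1 := by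
    have := lengthAlong_comp_of_surjective (RingHom.id κ) (frobenius κ p) hsurj κ
    rw [RingHom.id_comp] at this
    rw [this]
    change Module.length κ κ = 1
    exact Module.length_eq_one κ κ
  rw [h2] at h
  exact_mod_cast h.symm

/-- Every prime containing I contains m, so R/I is Noetherian of dimension at most zero, hence
Artinian. -/
theorem isFiniteLength_quotient_pow [IsNoetherianRing R] {m : Ideal R} (hm : m.IsMaximal)
    {I : Ideal R} {s : ℕ} (hI : m ^ s ≤ I) : IsFiniteLength R (R ⧸ I) := by
  have : IsArtinianRing (R ⧸ I) := by
    rw [isArtinianRing_iff_isNoetherianRing_krullDimLE_zero]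
    refine ⟨inferInstance, Ideal.krullDimLE_zero_quotient_iff_forall_minimalPrimes_isMaximal.2 fun J hJ => ?_⟩
    have hJp := hJ.isPrime
    have := hm.eq_of_le hJp.ne_top (hJp.le_of_pow_le (hI.trans hJ.le))
    exact this ▸ hm
  rw [isFiniteLength_iff_isNoetherian_isArtinian]
  exact ⟨inferInstance,
    isArtinian_of_surjective_algebraMap (R := R ⧸ I) Ideal.Quotient.mk_surjective⟩
end Length

/-! ### Growth of the lengths of quotients by Frobenius powers -/

section Growth

variable {R : Type u} [CommRing R]

theorem length_le_add_of_exact {M N P : Type*} [AddCommGroup M] [Module R M] [AddCommGroup N]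
    [Module R N] [AddCommGroup P] [Module R P] (f : N →ₗ[R] M) (g : M →ₗ[R] P)
    (hg : Function.Surjective g) (H : Function.Exact f g) :
    Module.length R M ≤ Module.length R N + Module.length R P := by
  rw [Module.length_eq_add_of_exact (LinearMap.ker g).subtype g (Submodule.subtype_injective _) hg
    (LinearMap.exact_subtype_ker_map g)]
  gcongr
  rw [LinearMap.exact_iff.1 H]
  exact Module.length_le_of_surjective f.rangeRestrict f.surjective_rangeRestrict

theorem length_quotient_antitone {I J : Ideal R} (h : I ≤ J) :
    Module.length R (R ⧸ J) ≤ Module.length R (R ⧸ I) :=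
  Module.length_le_of_surjective (Submodule.factor h) (Submodule.factor_surjective h)

-- Induction on q through the right exact sequence R/(I + x) → R/(I + x^(q+1)) → R/(I + x^q) → 0,
-- whose first map is multiplication by x^q.
open Ideal in
theorem length_quotient_sup_span_pow_le (I : Ideal R) (x : R) (q : ℕ) :
    Module.length R (R ⧸ (I ⊔ span {x ^ q})) ≤ q * Module.length R (R ⧸ (I ⊔ span {x})) := by
  induction q with
  | zero =>
    have : Subsingleton (R ⧸ (I ⊔ span {x ^ 0})) :=
      Ideal.Quotient.subsingleton_iff.2 (by simp)
    rw [Module.length_eq_zero]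
    exact zero_le
  | succ q ih =>
    have hle1 : I ⊔ span {x} ≤
        Submodule.comap (LinearMap.mulLeft R (x ^ q)) (I ⊔ span {x ^ (q + 1)}) := by
      rw [sup_le_iff, Ideal.span_le, Set.singleton_subset_iff]
      refine ⟨fun y hy => ?_, ?_⟩
      · exact Ideal.mem_sup_left (I.mul_mem_left _ hy)
      · refine Ideal.mem_sup_right ?_
        rw [pow_succ]
        exact mem_span_singleton_self _
    have hle2 : I ⊔ span {x ^ (q + 1)} ≤ I ⊔ span {x ^ q} := by
      refine sup_le_sup_left ?_ I
      rw [Ideal.span_singleton_le_span_singleton]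
      exact pow_dvd_pow x (Nat.le_succ q)
    have := length_le_add_of_exact (Submodule.mapQ _ _ _ hle1) (Submodule.factor hle2)
      (Submodule.factor_surjective hle2) (by
        intro y
        obtain ⟨y, rfl⟩ := Ideal.Quotient.mk_surjective y
        constructor
        · intro hy
          have hy' : y ∈ I ⊔ span {x ^ q} := (Submodule.Quotient.mk_eq_zero _).1 hy
          obtain ⟨a, ha, b, hb, rfl⟩ := Submodule.mem_sup.1 hy'
          obtain ⟨c, rfl⟩ := Ideal.mem_span_singleton'.1 hb
          refine ⟨Ideal.Quotient.mk _ c, ?_⟩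
          change Ideal.Quotient.mk _ (x ^ q * c) = _
          rw [Ideal.Quotient.eq]
          have : x ^ q * c - (a + c * x ^ q) = -a := by ring
          rw [this]
          exact neg_mem (Ideal.mem_sup_left ha)
        · rintro ⟨c, hc⟩
          obtain ⟨c, rfl⟩ := Ideal.Quotient.mk_surjective c
          rw [← hc]
          change Submodule.Quotient.mk (x ^ q * c) = 0
          rw [Submodule.Quotient.mk_eq_zero]
          exact Ideal.mem_sup_right (Ideal.mul_mem_right _ _ (mem_span_singleton_self _)))
    calc _ ≤ _ := this
      _ ≤ _ := by
        rw [Nat.cast_succ, add_mul, one_mul, add_comm]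
        gcongr

-- One generator is treated at a time. The ideal I varies in the induction so that it can absorb the
-- power of the generator just removed.
open Ideal in
theorem length_quotient_sup_span_image_pow_le (s : Finset R) (I : Ideal R) (q : ℕ) :
    Module.length R (R ⧸ (I ⊔ span ((fun x => x ^ q) '' (s : Set R)))) ≤
      (q : ℕ∞) ^ s.card * Module.length R (R ⧸ (I ⊔ span (s : Set R))) := by
  classical
  induction s using Finset.induction_on generalizing I with
  | empty =>
    rw [Finset.coe_empty, Set.image_empty]
    simp
  | insert a s ha ih =>
    rw [Finset.card_insert_of_notMem ha, Finset.coe_insert, Set.image_insert_eq, span_insert,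
      span_insert, ← sup_assoc, pow_succ]
    calc _ ≤ (q : ℕ∞) ^ s.card *
          Module.length R (R ⧸ (I ⊔ span {a ^ q} ⊔ span (s : Set R))) := ih (I ⊔ span {a ^ q})
      _ ≤ (q : ℕ∞) ^ s.card *
          (q * Module.length R (R ⧸ (I ⊔ (span {a} ⊔ span (s : Set R))))) := by
        gcongr
        rw [sup_right_comm, sup_comm (span {a}), ← sup_assoc]
        exact length_quotient_sup_span_pow_le _ _ _
      _ = _ := by rw [mul_assoc]

open Ideal in
/-- A maximal ideal minimal over `J` has a power contained in `J + m ^ L` for every `L`. -/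
theorem exists_pow_le_sup_pow [IsNoetherianRing R] {m : Ideal R} [hm : m.IsMaximal] {J : Ideal R}
    (hJ : m ∈ J.minimalPrimes) : ∃ N : ℕ, ∀ L : ℕ, m ^ N ≤ m ^ L ⊔ J := by
  have hrad : m ≤ (⨅ L : ℕ, m ^ L ⊔ J).radical := by
    intro x hx
    have h1 := IsLocalization.AtPrime.radical_map_of_mem_minimalPrimes
      (Localization.AtPrime m) m J hJ
    obtain ⟨n, hn⟩ : algebraMap R (Localization.AtPrime m) x ∈
        (J.map (algebraMap R (Localization.AtPrime m))).radical := by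
      rw [h1]
      exact Ideal.mem_map_of_mem _ hx
    rw [← map_pow, IsLocalization.algebraMap_mem_map_algebraMap_iff m.primeCompl] at hn
    obtain ⟨u, hu, hux⟩ := hn
    refine ⟨n, ?_⟩
    rw [Submodule.mem_iInf]
    intro L
    -- From x^n ∈ J R_m one gets u x^n ∈ J with u ∉ m. Such u is invertible modulo every m^L, so the
    -- one exponent n serves all L. This replaces locality of R: J itself need not contain a power
    -- of m.
    have hun : IsUnit (Ideal.Quotient.mk (m ^ L) u) := by
      obtain ⟨y, i, hi, hyi⟩ := hm.exists_inv (show u ∉ m from hu)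
      have h2 : IsNilpotent (Ideal.Quotient.mk (m ^ L) i) := ⟨L, by
        rw [← map_pow, Ideal.Quotient.eq_zero_iff_mem]
        exact Ideal.pow_mem_pow hi L⟩
      have h3 : IsUnit (1 - Ideal.Quotient.mk (m ^ L) i) := h2.isUnit_one_sub
      rw [← map_one (Ideal.Quotient.mk (m ^ L)), ← map_sub, ← hyi, add_sub_cancel_right,
        map_mul] at h3
      exact isUnit_of_mul_isUnit_right h3
    obtain ⟨v, hv⟩ := hun.exists_right_inv
    obtain ⟨v, rfl⟩ := Ideal.Quotient.mk_surjective v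
    rw [← map_mul, ← map_one (Ideal.Quotient.mk (m ^ L)), Ideal.Quotient.eq] at hv
    have h4 : x ^ n = -((u * v - 1) * x ^ n) + v * (u * x ^ n) := by ring
    rw [h4]
    exact add_mem (neg_mem (Ideal.mem_sup_left (Ideal.mul_mem_right _ _ hv)))
      (Ideal.mem_sup_right (J.mul_mem_left _ hux))
  obtain ⟨N, hN⟩ := Ideal.exists_pow_le_of_le_radical_of_fg hrad (IsNoetherian.noetherian m)
  exact ⟨N, fun L => hN.trans (iInf_le _ L)⟩

/-- The p^e-th power of every element of m lies in the Frobenius power, and m is finitely generated.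
-/
theorem exists_pow_le_map_iterateFrobenius [IsNoetherianRing R] (p : ℕ) [ExpChar R p]
    (m : Ideal R) (e : ℕ) : ∃ L : ℕ, m ^ L ≤ m.map (iterateFrobenius R p e) := by
  refine Ideal.exists_pow_le_of_le_radical_of_fg (fun x hx => ⟨p ^ e, ?_⟩)
    (IsNoetherian.noetherian m)
  exact Ideal.mem_map_of_mem (iterateFrobenius R p e) hx

/-- Upper bound for the length of `R / m^[q]`. -/
theorem exists_length_quotient_frobenius_le [IsNoetherianRing R] (p : ℕ) [ExpChar R p]
    {m : Ideal R} [hm : m.IsMaximal] {d : ℕ} (hd : m.height ≤ d) :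
    ∃ B : ℕ, ∀ e : ℕ, Module.length R (R ⧸ m.map (iterateFrobenius R p e)) ≤
      (B * p ^ (d * e) : ℕ) := by
  have hp : 1 ≤ p := by
    rcases ‹ExpChar R p› with h | h
    · exact le_rfl
    · exact (by assumption : p.Prime).one_le
  -- The ideal m is minimal over height-many elements s. With q = p^e, the ideal m^[q] contains m^L
  -- and the q-th powers of s, which costs a factor q^(card s) over R/(m^L + (s)). The latter is a
  -- quotient of R/m^N with N independent of e.
  obtain ⟨s, hs, hcard⟩ := m.exists_finset_card_eq_height_of_isNoetherianRing
  obtain ⟨N, hN⟩ := exists_pow_le_sup_pow hs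
  have hfin : Module.length R (R ⧸ m ^ N) ≠ ⊤ :=
    Module.length_ne_top_iff.2 (isFiniteLength_quotient_pow hm le_rfl)
  obtain ⟨B, hB⟩ := ENat.ne_top_iff_exists.1 hfin
  refine ⟨B, fun e => ?_⟩
  obtain ⟨L, hL⟩ := exists_pow_le_map_iterateFrobenius p m e
  have hsd : s.card ≤ d := by
    rw [← hcard] at hd
    exact_mod_cast hd
  calc _ ≤ Module.length R (R ⧸ (m ^ L ⊔ Ideal.span ((fun x => x ^ (p ^ e)) '' (s : Set R)))) := by
        refine length_quotient_antitone (sup_le hL (Ideal.span_le.2 ?_))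
        rintro _ ⟨x, hx, rfl⟩
        exact Ideal.mem_map_of_mem (iterateFrobenius R p e) (hs.le (Ideal.subset_span hx))
    _ ≤ ((p ^ e : ℕ) : ℕ∞) ^ s.card * Module.length R (R ⧸ (m ^ L ⊔ Ideal.span (s : Set R))) :=
        length_quotient_sup_span_image_pow_le s _ _
    _ ≤ ((p ^ e : ℕ) : ℕ∞) ^ d * B := by
        gcongr
        · exact_mod_cast Nat.one_le_pow e p hp
        · rw [hB]
          exact length_quotient_antitone (hN L)
    _ = _ := by
        push_cast
        rw [mul_comm, ← pow_mul, mul_comm d e]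

/-- Discrete form of ∫ (h + 1) x^h = x^(h+1); it lets growth of order h in the increments sum to
growth of order h + 1. -/
theorem succ_pow_succ_le (m h : ℕ) : (m + 1) ^ (h + 1) ≤ m ^ (h + 1) + (h + 1) * (m + 1) ^ h := by
  induction h with
  | zero => simp
  | succ h ih =>
    calc (m + 1) ^ (h + 2) = (m + 1) * (m + 1) ^ (h + 1) := by ring
      _ ≤ m * (m ^ (h + 1) + (h + 1) * (m + 1) ^ h) + (m + 1) ^ (h + 1) := by nlinarith
      _ = m ^ (h + 2) + (h + 1) * (m * (m + 1) ^ h) + (m + 1) ^ (h + 1) := by ring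
      _ ≤ m ^ (h + 2) + (h + 1) * ((m + 1) * (m + 1) ^ h) + (m + 1) ^ (h + 1) := by
        gcongr; omega
      _ = _ := by ring

/-- A growth function on ideals which, for every prime `P` and `x ∉ P`, satisfies
`G P n + G (P + x) (n + c) ≤ G P (n + c)`, grows at least like `n ^ h` at the bottom of a chain of
primes of length `h`. -/
theorem exists_pow_le_mul_of_ltSeries {G : Ideal R → ℕ → ℕ∞} (hanti : ∀ n, Antitone fun I => G I n)
    (hmono : ∀ I, Monotone (G I))
    (hstep : ∀ (P : Ideal R), P.IsPrime → ∀ x ∉ P, ∃ c : ℕ, 0 < c ∧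
      ∀ n, G P n + G (P ⊔ Ideal.span {x}) (n + c) ≤ G P (n + c))
    (s : LTSeries (PrimeSpectrum R)) (hlast : ∀ n, 1 ≤ n → 1 ≤ G s.last.asIdeal n) :
    ∃ D : ℕ, ∀ n : ℕ, 1 ≤ n → ((n ^ s.length : ℕ) : ℕ∞) ≤ D * G s.head.asIdeal n := by
  suffices H : ∀ (h : ℕ) (s : LTSeries (PrimeSpectrum R)), s.length = h →
      (∀ n, 1 ≤ n → 1 ≤ G s.last.asIdeal n) →
      ∃ D : ℕ, ∀ n : ℕ, 1 ≤ n → ((n ^ h : ℕ) : ℕ∞) ≤ D * G s.head.asIdeal n from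
    H _ s rfl hlast
  clear hlast s
  intro h
  induction h with
  | zero =>
    intro s hs hlast
    refine ⟨1, fun n hn => ?_⟩
    have : s.head = s.last := by
      unfold RelSeries.head RelSeries.last
      congr 1
      exact Fin.ext (by simp [hs])
    rw [this]
    simpa using hlast n hn
  | succ h ih =>
    intro s hs hlast
    have hs0 : s.length ≠ 0 := by omega
    obtain ⟨D, hD⟩ := ih (s.tail hs0) (by simp [hs]) (by simpa using hlast)
    set P := s.head.asIdeal with hP
    set P' := (s.tail hs0).head.asIdeal with hP'
    have hlt : P < P' := by
      have := s.step ⟨0, by omega⟩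
      have h2 : (s.tail hs0).head = s.toFun ⟨1, by omega⟩ := by
        simp only [RelSeries.head_tail]
        congr 1
        exact Fin.ext (by simp; omega)
      rw [hP', h2]
      exact this
    obtain ⟨x, hx', hx⟩ := SetLike.exists_of_lt hlt
    obtain ⟨c, hc, hG⟩ := hstep P s.head.isPrime x hx
    have hG' : ∀ n, G P n + G P' (n + c) ≤ G P (n + c) := fun n =>
      le_trans (by
        gcongr
        exact hanti _ (sup_le hlt.le ((Ideal.span_singleton_le_iff_mem _).2 hx'))) (hG n)
    -- Along multiples of c, each step adds at least G P' ((m+1)c), which is of order (m+1)^h by the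
    -- induction hypothesis.
    have hmul : ∀ m : ℕ, ((m ^ (h + 1) : ℕ) : ℕ∞) ≤ ((h + 1) * D : ℕ) * G P (m * c) := by
      intro m
      induction m with
      | zero => simp
      | succ m ihm =>
        calc (((m + 1) ^ (h + 1) : ℕ) : ℕ∞)
            ≤ ((m ^ (h + 1) + (h + 1) * (m + 1) ^ h : ℕ) : ℕ∞) := by
              exact_mod_cast succ_pow_succ_le m h
          _ = (m ^ (h + 1) : ℕ) + (h + 1 : ℕ) * ((m + 1) ^ h : ℕ) := by push_cast; ring
          _ ≤ ((h + 1) * D : ℕ) * G P (m * c) + (h + 1 : ℕ) * (D * G P' ((m + 1) * c)) := by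
              gcongr
              refine le_trans ?_ (hD ((m + 1) * c) (Nat.mul_pos m.succ_pos hc))
              exact_mod_cast Nat.pow_le_pow_left (Nat.le_mul_of_pos_right _ hc) h
          _ = ((h + 1) * D : ℕ) * (G P (m * c) + G P' (m * c + c)) := by
              rw [add_mul m 1 c, one_mul]
              push_cast
              ring
          _ ≤ _ := by
              rw [add_mul m 1 c, one_mul]
              gcongr
              exact hG' _
    -- The first summand handles n ≥ c, where n ≤ 2c⌊n/c⌋ reduces to multiples of c. The second
    -- handles n < c, where n^(h+1) ≤ c n^h.
    refine ⟨(2 * c) ^ (h + 1) * ((h + 1) * D) + c * D, fun n hn => ?_⟩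
    rcases lt_or_ge n c with hnc | hnc
    · calc ((n ^ (h + 1) : ℕ) : ℕ∞) = n * (n ^ h : ℕ) := by push_cast; ring
        _ ≤ c * (D * G P' n) := by
            gcongr
            exact hD n hn
        _ ≤ c * (D * G P n) := by
            gcongr
            exact hanti n hlt.le
        _ = (c * D : ℕ) * G P n := by push_cast; ring
        _ ≤ _ := by
            gcongr
            exact Nat.le_add_left _ _
    · set m := n / c with hm
      have hm1 : 1 ≤ m := (Nat.one_le_div_iff hc).2 hnc
      have hn1 : n ≤ 2 * c * m := by
        have := Nat.lt_div_mul_add hc (a := n)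
        rw [← hm] at this
        nlinarith
      calc ((n ^ (h + 1) : ℕ) : ℕ∞) ≤ ((2 * c * m) ^ (h + 1) : ℕ) := by
            exact_mod_cast Nat.pow_le_pow_left hn1 _
        _ = ((2 * c) ^ (h + 1) : ℕ) * (m ^ (h + 1) : ℕ) := by
            rw [mul_pow]
            push_cast
            rfl
        _ ≤ ((2 * c) ^ (h + 1) : ℕ) * (((h + 1) * D : ℕ) * G P (m * c)) := by
            gcongr
            exact hmul m
        _ ≤ ((2 * c) ^ (h + 1) : ℕ) * (((h + 1) * D : ℕ) * G P n) := by
            gcongr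
            exact hmono P (Nat.div_mul_le_self n c)
        _ = ((2 * c) ^ (h + 1) * ((h + 1) * D) : ℕ) * G P n := by
            rw [← mul_assoc]
            push_cast
            rfl
        _ ≤ _ := by
            gcongr
            exact Nat.le_add_right _ _

end Growth

/-! ### Lower bounds for lengths in the local case -/

section LowerBound

variable {R : Type u} [CommRing R]

/-- The image of h is A/ker h and lies in ker g, so its length and that of P fit inside M. With h
multiplication by x, this supplies the step inequality for growth functions. -/
theorem length_quotient_ker_add_le {S : Type*} [CommRing S] {A M P : Type*} [AddCommGroup A]
    [Module S A] [AddCommGroup M] [Module S M] [AddCommGroup P] [Module S P] (h : A →ₗ[S] M)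
    (g : M →ₗ[S] P) (hg : Function.Surjective g) (hgh : g ∘ₗ h = 0) {K : Submodule S A}
    (hK : LinearMap.ker h ≤ K) :
    Module.length S (A ⧸ K) + Module.length S P ≤ Module.length S M := by
  rw [Module.length_eq_add_of_exact (LinearMap.ker g).subtype g (Submodule.subtype_injective _) hg
    (LinearMap.exact_subtype_ker_map g)]
  gcongr
  calc Module.length S (A ⧸ K) ≤ Module.length S (A ⧸ LinearMap.ker h) :=
        Module.length_le_of_surjective (Submodule.factor hK) (Submodule.factor_surjective hK)
    _ = Module.length S (LinearMap.range h) := h.quotKerEquivRange.length_eq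
    _ ≤ _ := Module.length_le_of_injective
        (Submodule.inclusion (LinearMap.range_le_ker_iff.2 hgh)) (Submodule.inclusion_injective _)

/-- Artin–Rees for a principal ideal of the domain `R / P`. -/
theorem exists_mem_sup_pow_of_mul_mem [IsNoetherianRing R] (m P : Ideal R) (hP : P.IsPrime)
    {x : R} (hx : x ∉ P) : ∃ c : ℕ, ∀ n y, x * y ∈ P ⊔ m ^ (n + c) → y ∈ P ⊔ m ^ n := by
  have hpow : ∀ (n : ℕ) (y : R), Submodule.Quotient.mk y ∈ (m ^ n • ⊤ : Submodule R (R ⧸ P)) ↔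
      y ∈ P ⊔ m ^ n := by
    intro n y
    have h1 : (m ^ n • ⊤ : Submodule R (R ⧸ P)) = Submodule.map P.mkQ (m ^ n) := by
      have h2 : (m ^ n • ⊤ : Submodule R R) = m ^ n := Ideal.mul_top _
      nth_rw 2 [← h2]
      rw [Submodule.map_smul'', Submodule.map_top, Submodule.range_mkQ]
    rw [h1]
    have h2 : y ∈ Submodule.comap P.mkQ (Submodule.map P.mkQ (m ^ n)) ↔ y ∈ P ⊔ m ^ n := by
      rw [Submodule.comap_map_mkQ]
    exact h2
  -- Artin–Rees for the submodule xR of R/P; cancelling x afterwards uses that P is prime.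
  obtain ⟨c, hc⟩ := Ideal.exists_pow_inf_eq_pow_smul m
    (Submodule.span R {(Submodule.Quotient.mk x : R ⧸ P)})
  refine ⟨c, fun n y hy => ?_⟩
  have h1 : (Submodule.Quotient.mk (x * y) : R ⧸ P) ∈
      (m ^ (n + c) • ⊤ ⊓ Submodule.span R {Submodule.Quotient.mk x} : Submodule R (R ⧸ P)) := by
    refine ⟨(hpow _ _).2 hy, ?_⟩
    rw [mul_comm]
    exact Submodule.smul_mem _ y (Submodule.mem_span_singleton_self _)
  rw [hc (n + c) (Nat.le_add_left _ _), Nat.add_sub_cancel] at h1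
  have h2 : (Submodule.Quotient.mk (x * y) : R ⧸ P) ∈
      m ^ n • Submodule.span R {(Submodule.Quotient.mk x : R ⧸ P)} :=
    Submodule.smul_mono le_rfl inf_le_right h1
  obtain ⟨z, hz, hzx⟩ := Submodule.mem_smul_span_singleton.1 h2
  have h3 : x * (y - z) ∈ P := by
    rw [mul_sub, ← Submodule.Quotient.eq, ← hzx, mul_comm x z]
    rfl
  rw [← sub_add_cancel y z]
  exact add_mem (Ideal.mem_sup_left ((hP.mem_or_mem h3).resolve_left hx))
    (Ideal.mem_sup_right hz)

/-- Lower bound for the length of `R / m^n` in a Noetherian local ring. -/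
theorem exists_pow_le_mul_length_quotient_pow [IsNoetherianRing R] [IsLocalRing R] {d : ℕ}
    (hd : ringKrullDim R = d) : ∃ D : ℕ, ∀ n : ℕ, 1 ≤ n → ((n ^ d : ℕ) : ℕ∞) ≤
      D * Module.length R (R ⧸ IsLocalRing.maximalIdeal R ^ n) := by
  set m := IsLocalRing.maximalIdeal R with hm
  obtain ⟨s, hs⟩ := Order.le_krullDim_iff.1 (show (d : WithBot ℕ∞) ≤ ringKrullDim R from hd.ge)
  -- The growth function is the Hilbert–Samuel function n ↦ length(R/(I + m^n)); locality ensures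
  -- that it is nonzero for the last prime of the chain.
  obtain ⟨D, hD⟩ := exists_pow_le_mul_of_ltSeries
    (G := fun I n => Module.length R (R ⧸ (I ⊔ m ^ n)))
    (fun n I J h => length_quotient_antitone (sup_le_sup_right h _))
    (fun I a b h => length_quotient_antitone (sup_le_sup_left (Ideal.pow_le_pow_right h) I))
    (fun P hP x hx => by
      obtain ⟨c, hc⟩ := exists_mem_sup_pow_of_mul_mem m P hP hx
      refine ⟨c + 1, c.succ_pos, fun n => ?_⟩
      refine length_quotient_ker_add_le
        ((P ⊔ m ^ (n + (c + 1))).mkQ ∘ₗ LinearMap.mulLeft R x)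
        (Submodule.factor (sup_le_sup_right le_sup_left _)) (Submodule.factor_surjective _) ?_ ?_
      · ext
        change Submodule.Quotient.mk (x * 1) = 0
        rw [Submodule.Quotient.mk_eq_zero, mul_one]
        exact Ideal.mem_sup_left (Ideal.mem_sup_right (Ideal.mem_span_singleton_self x))
      · intro y hy
        have hy' : x * y ∈ P ⊔ m ^ (n + (c + 1)) := (Submodule.Quotient.mk_eq_zero _).1 hy
        exact hc n y ((sup_le_sup_left (Ideal.pow_le_pow_right (by omega)) P :
          P ⊔ m ^ (n + (c + 1)) ≤ P ⊔ m ^ (n + c)) hy'))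
    s (fun n hn => by
      rw [Order.one_le_iff_pos, Module.length_pos_iff]
      refine Ideal.Quotient.nontrivial_iff.2 fun h => ?_
      exact (IsLocalRing.maximalIdeal.isMaximal R).ne_top (top_le_iff.1 (h ▸ sup_le
        (IsLocalRing.le_maximalIdeal s.last.isPrime.ne_top) (Ideal.pow_le_self (by omega)))))
  refine ⟨D, fun n hn => ?_⟩
  rw [← hs]
  refine (hD n hn).trans ?_
  gcongr
  exact length_quotient_antitone le_sup_right

/-- Passage from ordinary to Frobenius powers in lower bounds of lengths. -/
theorem exists_pow_le_mul_length_quotient_frobenius {m : Ideal R} {d : ℕ}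
    (h : ∃ D : ℕ, ∀ n : ℕ, 1 ≤ n → ((n ^ d : ℕ) : ℕ∞) ≤ D * Module.length R (R ⧸ m ^ n))
    (p : ℕ) [Fact p.Prime] [ExpChar R p] : ∃ D : ℕ, ∀ e : ℕ, ((p ^ (d * e) : ℕ) : ℕ∞) ≤
      D * Module.length R (R ⧸ m.map (iterateFrobenius R p e)) := by
  obtain ⟨D, hD⟩ := h
  refine ⟨D, fun e => ?_⟩
  have := hD (p ^ e) (Nat.one_le_pow e p (Fact.out : p.Prime).pos)
  rw [← pow_mul, mul_comm e d] at this
  refine this.trans ?_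
  gcongr
  -- The Frobenius power m^[q] is contained in the ordinary power m^q.
  refine length_quotient_antitone (Ideal.map_le_iff_le_comap.2 fun x hx => ?_)
  exact Ideal.pow_mem_pow hx _

end LowerBound

/-! ### Lower bounds for lengths in the graded case -/

section Graded

variable {k : Type v} {R : Type u} [CommRing k] [CommRing R] [Algebra k R]
  (𝒜 : ℕ → Submodule k R) [GradedAlgebra 𝒜]

/-- For an ℕ-grading the projection to degree zero is a ring homomorphism, and here its target is a
copy of k. The kernel of π is the irrelevant ideal. -/
theorem exists_augmentation (h0 : 𝒜 0 = 1) (hinj : Function.Injective (algebraMap k R)) :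
    ∃ π : R →+* k, ∀ r, algebraMap k R (π r) = DirectSum.decompose 𝒜 r 0 := by
  let e := RingEquiv.ofBijective (algebraMap k R).rangeRestrict
    ⟨fun a b h => hinj (congrArg Subtype.val h), (algebraMap k R).rangeRestrict_surjective⟩
  have hmem : ∀ r, GradedRing.projZeroRingHom 𝒜 r ∈ (algebraMap k R).range := by
    intro r
    have : (DirectSum.decompose 𝒜 r 0 : R) ∈ 𝒜 0 := (DirectSum.decompose 𝒜 r 0).2
    have := h0.le this
    rw [Submodule.mem_one] at this
    exact this
  refine ⟨e.symm.toRingHom.comp ((GradedRing.projZeroRingHom 𝒜).codRestrict _ hmem), fun r => ?_⟩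
  exact congrArg Subtype.val (e.apply_symm_apply
    ((GradedRing.projZeroRingHom 𝒜).codRestrict _ hmem r))

/-- The elements of degree less than `n`. -/
def degreeLT (n : ℕ) : Submodule k R := ⨆ (i) (_ : i < n), 𝒜 i

/-- The elements of degree at least `n`. -/
def degreeGE (n : ℕ) : Submodule k R := ⨆ (i) (_ : n ≤ i), 𝒜 i

theorem disjoint_degreeLT_degreeGE (n : ℕ) : Disjoint (degreeLT 𝒜 n) (degreeGE 𝒜 n) := by
  have hind : iSupIndep 𝒜 := (DirectSum.Decomposition.isInternal 𝒜).submodule_iSupIndep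
  have := hind.disjoint_biSup_biSup (s := {i | i < n}) (t := {i | n ≤ i})
    (Set.disjoint_left.2 fun i hi hi' => absurd (show n ≤ i from hi') (not_le.2 hi))
  exact this

theorem exists_mem_degreeLT (x : R) : ∃ n, x ∈ degreeLT 𝒜 n := by
  classical
  refine ⟨(DirectSum.decompose 𝒜 x).support.sup id + 1, ?_⟩
  rw [← DirectSum.sum_support_decompose 𝒜 x]
  refine Submodule.sum_mem _ fun i hi => ?_
  rw [DirectSum.sum_support_decompose 𝒜 x]
  have h : 𝒜 i ≤ degreeLT 𝒜 ((DirectSum.decompose 𝒜 x).support.sup id + 1) :=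
    le_iSup₂_of_le i (Nat.lt_succ_of_le (Finset.le_sup (f := id) hi)) le_rfl
  exact h (DirectSum.decompose 𝒜 x i).2

theorem degreeLT_mono {m n : ℕ} (h : m ≤ n) : degreeLT 𝒜 m ≤ degreeLT 𝒜 n :=
  iSup₂_le fun i hi => le_iSup₂_of_le i (hi.trans_le h) le_rfl

theorem mul_mem_degreeLT {m n : ℕ} {x y : R} (hx : x ∈ degreeLT 𝒜 m) (hy : y ∈ degreeLT 𝒜 n) :
    x * y ∈ degreeLT 𝒜 (m + n) := by
  have h : degreeLT 𝒜 m * degreeLT 𝒜 n ≤ degreeLT 𝒜 (m + n) := by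
    simp only [degreeLT, Submodule.iSup_mul, Submodule.mul_iSup]
    refine iSup₂_le fun i hi => iSup₂_le fun j hj => le_iSup₂_of_le (j + i) (by omega) ?_
    rw [Submodule.mul_le]
    exact fun a ha b hb => SetLike.GradedMul.mul_mem ha hb
  exact h (Submodule.mul_mem_mul hx hy)

theorem mul_mem_degreeGE {m n : ℕ} {x y : R} (hx : x ∈ degreeGE 𝒜 m) (hy : y ∈ degreeGE 𝒜 n) :
    x * y ∈ degreeGE 𝒜 (m + n) := by
  have h : degreeGE 𝒜 m * degreeGE 𝒜 n ≤ degreeGE 𝒜 (m + n) := by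
    simp only [degreeGE, Submodule.iSup_mul, Submodule.mul_iSup]
    refine iSup₂_le fun i hi => iSup₂_le fun j hj => le_iSup₂_of_le (j + i) (by omega) ?_
    rw [Submodule.mul_le]
    exact fun a ha b hb => SetLike.GradedMul.mul_mem ha hb
  exact h (Submodule.mul_mem_mul hx hy)

/-- Elements of m have no component in degree zero, so each factor raises the degree by at least
one. -/
theorem mem_degreeGE_of_mem_pow {m : Ideal R} (hm : ∀ r ∈ m, (DirectSum.decompose 𝒜 r 0 : R) = 0)
    (n : ℕ) {x : R} (hx : x ∈ m ^ n) : x ∈ degreeGE 𝒜 n := by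
  classical
  have htop : ∀ r, r ∈ degreeGE 𝒜 0 := by
    intro r
    rw [← DirectSum.sum_support_decompose 𝒜 r]
    refine Submodule.sum_mem _ fun i hi => ?_
    exact (le_iSup₂_of_le i (Nat.zero_le i) le_rfl : 𝒜 i ≤ degreeGE 𝒜 0)
      (DirectSum.decompose 𝒜 _ i).2
  have hone : ∀ r ∈ m, r ∈ degreeGE 𝒜 1 := by
    intro r hr
    have : ∑ i ∈ (DirectSum.decompose 𝒜 r).support, (DirectSum.decompose 𝒜 r i : R) ∈
        degreeGE 𝒜 1 := by
      refine Submodule.sum_mem _ fun i hi => ?_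
      rcases Nat.eq_zero_or_pos i with rfl | hpos
      · rw [hm r hr]
        exact Submodule.zero_mem _
      · exact (le_iSup₂_of_le i hpos le_rfl : 𝒜 i ≤ degreeGE 𝒜 1) (DirectSum.decompose 𝒜 _ i).2
    rwa [DirectSum.sum_support_decompose 𝒜 r] at this
  induction n generalizing x with
  | zero => exact htop x
  | succ n ih =>
    rw [pow_succ] at hx
    refine Submodule.mul_induction_on hx (fun a ha b hb => ?_) fun a b ha hb =>
      Submodule.add_mem _ ha hb
    exact mul_mem_degreeGE 𝒜 (ih ha) (hone b hb)

theorem one_mem_degreeLT {n : ℕ} (hn : 1 ≤ n) : (1 : R) ∈ degreeLT 𝒜 n :=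
  (le_iSup₂_of_le 0 hn le_rfl : 𝒜 0 ≤ degreeLT 𝒜 n) SetLike.GradedOne.one_mem

/-- The elements of an ideal of degree less than `n`. -/
def idealDegreeLT (I : Ideal R) (n : ℕ) : Submodule k (degreeLT 𝒜 n) :=
  (I.restrictScalars k).comap (degreeLT 𝒜 n).subtype

theorem mem_idealDegreeLT {I : Ideal R} {n : ℕ} {x : degreeLT 𝒜 n} :
    x ∈ idealDegreeLT 𝒜 I n ↔ (x : R) ∈ I := Iff.rfl

theorem idealDegreeLT_mono {I J : Ideal R} (h : I ≤ J) (n : ℕ) :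
    idealDegreeLT 𝒜 I n ≤ idealDegreeLT 𝒜 J n := fun _ hx => h hx

theorem length_degreeLT_quotient_mono (I : Ideal R) {a b : ℕ} (h : a ≤ b) :
    Module.length k (degreeLT 𝒜 a ⧸ idealDegreeLT 𝒜 I a) ≤
      Module.length k (degreeLT 𝒜 b ⧸ idealDegreeLT 𝒜 I b) := by
  have hle : idealDegreeLT 𝒜 I a ≤
      (idealDegreeLT 𝒜 I b).comap (Submodule.inclusion (degreeLT_mono 𝒜 h)) := by
    intro x hx
    rw [Submodule.mem_comap, mem_idealDegreeLT, Submodule.coe_inclusion]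
    exact (mem_idealDegreeLT 𝒜).1 hx
  refine Module.length_le_of_injective (Submodule.mapQ _ _ _ hle) ?_
  rw [← LinearMap.ker_eq_bot, LinearMap.ker_eq_bot']
  intro x hx
  obtain ⟨x, rfl⟩ := Submodule.mkQ_surjective _ x
  rw [Submodule.mkQ_apply, Submodule.mapQ_apply, Submodule.Quotient.mk_eq_zero, mem_idealDegreeLT,
    Submodule.coe_inclusion] at hx
  rw [Submodule.mkQ_apply, Submodule.Quotient.mk_eq_zero]
  exact (mem_idealDegreeLT 𝒜).2 hx

/-- Multiplication by x raises the degree filtration by at most c and is injective modulo P.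
Filtering from below makes Artin–Rees unnecessary. -/
theorem length_degreeLT_quotient_add_le {P : Ideal R} (hP : P.IsPrime) {x : R} (hx : x ∉ P)
    {c : ℕ} (hc : x ∈ degreeLT 𝒜 c) (n : ℕ) :
    Module.length k (degreeLT 𝒜 n ⧸ idealDegreeLT 𝒜 P n) +
      Module.length k (degreeLT 𝒜 (n + c) ⧸ idealDegreeLT 𝒜 (P ⊔ Ideal.span {x}) (n + c)) ≤
      Module.length k (degreeLT 𝒜 (n + c) ⧸ idealDegreeLT 𝒜 P (n + c)) := by
  have hmul : ∀ y ∈ degreeLT 𝒜 n, LinearMap.mulLeft k x y ∈ degreeLT 𝒜 (n + c) := by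
    intro y hy
    rw [add_comm]
    exact mul_mem_degreeLT 𝒜 hc hy
  have hle := idealDegreeLT_mono 𝒜 (le_sup_left : P ≤ P ⊔ Ideal.span {x}) (n + c)
  refine length_quotient_ker_add_le
    ((idealDegreeLT 𝒜 P (n + c)).mkQ ∘ₗ (LinearMap.mulLeft k x).restrict hmul)
    (Submodule.factor hle) (Submodule.factor_surjective _) ?_ ?_
  · refine LinearMap.ext fun y => ?_
    rw [LinearMap.comp_apply, LinearMap.comp_apply, Submodule.mkQ_apply, LinearMap.zero_apply]
    refine (Submodule.Quotient.mk_eq_zero _).2 ?_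
    rw [mem_idealDegreeLT]
    exact Ideal.mem_sup_right (Ideal.mul_mem_right _ _ (Ideal.mem_span_singleton_self x))
  · intro y hy
    rw [LinearMap.mem_ker, LinearMap.comp_apply, Submodule.mkQ_apply,
      Submodule.Quotient.mk_eq_zero, mem_idealDegreeLT] at hy
    exact (hP.mem_or_mem hy).resolve_left hx

/-- Lower bound for the dimension of the space of elements of degree less than `n`. -/
theorem exists_pow_le_mul_length_degreeLT {d : ℕ} (hd : ringKrullDim R = d) :
    ∃ D : ℕ, ∀ n : ℕ, 1 ≤ n → ((n ^ d : ℕ) : ℕ∞) ≤ D * Module.length k (degreeLT 𝒜 n) := by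
  obtain ⟨s, hs⟩ := Order.le_krullDim_iff.1 (show (d : WithBot ℕ∞) ≤ ringKrullDim R from hd.ge)
  -- The primes of the chain need be neither homogeneous nor contained in the irrelevant ideal, so
  -- powers of that ideal could see nothing of R/P. The images in R/P of the spaces of elements of
  -- bounded degree work for every prime.
  obtain ⟨D, hD⟩ := exists_pow_le_mul_of_ltSeries
    (G := fun I n => Module.length k (degreeLT 𝒜 n ⧸ idealDegreeLT 𝒜 I n))
    (fun n I J h => Module.length_le_of_surjective
      (Submodule.factor (idealDegreeLT_mono 𝒜 h n)) (Submodule.factor_surjective _))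
    (fun I a b h => length_degreeLT_quotient_mono 𝒜 I h)
    (fun P hP x hx => by
      obtain ⟨c, hc⟩ := exists_mem_degreeLT 𝒜 x
      exact ⟨c + 1, c.succ_pos, length_degreeLT_quotient_add_le 𝒜 hP hx
        (degreeLT_mono 𝒜 (Nat.le_succ c) hc)⟩)
    s (fun n hn => by
      rw [Order.one_le_iff_pos, Module.length_pos_iff]
      refine Submodule.Quotient.nontrivial_iff.2 fun h => ?_
      have h1 : (⟨1, one_mem_degreeLT 𝒜 hn⟩ : degreeLT 𝒜 n) ∈
          idealDegreeLT 𝒜 s.last.asIdeal n := by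
        rw [h]; trivial
      exact s.last.isPrime.ne_top ((Ideal.eq_top_iff_one _).2 h1))
  refine ⟨D, fun n hn => ?_⟩
  rw [← hs]
  refine (hD n hn).trans ?_
  gcongr
  exact Module.length_le_of_surjective (Submodule.mkQ _) (Submodule.mkQ_surjective _)

/-- Lower bound for the length of `R / m^n`, where `m` is the irrelevant ideal of a graded
algebra. -/
theorem exists_pow_le_mul_length_quotient_ker_pow {k : Type v} [Field k] [Algebra k R]
    (𝒜 : ℕ → Submodule k R) [GradedAlgebra 𝒜] [IsNoetherianRing R] {d : ℕ}
    (hd : ringKrullDim R = d) (π : R →+* k)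
    (hπ : ∀ r, algebraMap k R (π r) = DirectSum.decompose 𝒜 r 0)
    (hπk : ∀ a, π (algebraMap k R a) = a) :
    ∃ D : ℕ, ∀ n : ℕ, 1 ≤ n → ((n ^ d : ℕ) : ℕ∞) ≤
      D * Module.length R (R ⧸ RingHom.ker π ^ n) := by
  obtain ⟨D, hD⟩ := exists_pow_le_mul_length_degreeLT 𝒜 hd
  refine ⟨D, fun n hn => (hD n hn).trans ?_⟩
  gcongr
  have hsurj : Function.Surjective π := fun a => ⟨_, hπk a⟩
  have hmax : (RingHom.ker π).IsMaximal := RingHom.ker_isMaximal_of_surjective π hsurj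
  -- The residue field is k, so length over R equals length over k. It is then enough that elements
  -- of degree less than n inject, and this holds because the n-th power of the kernel lives in
  -- degrees at least n.
  have h1 : lengthAlong (algebraMap k R) (R ⧸ RingHom.ker π ^ n) =
      Module.length R (R ⧸ RingHom.ker π ^ n) := by
    rw [lengthAlong_eq_mul (algebraMap k R) hmax n (isFiniteLength_quotient_pow hmax le_rfl),
      lengthAlong_quotient_ker (algebraMap k R) π hsurj]
    · have : π.comp (algebraMap k R) = RingHom.id k := RingHom.ext hπk
      rw [this]
      change Module.length k k * _ = _
      rw [Module.length_eq_one k k, one_mul]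
    · intro r hr x
      obtain ⟨x, rfl⟩ := Ideal.Quotient.mk_surjective x
      exact (Submodule.Quotient.mk_eq_zero _).2 (Ideal.mul_mem_right x _ hr)
  rw [← h1]
  let := Module.compHom (R ⧸ RingHom.ker π ^ n) (algebraMap k R)
  let f : degreeLT 𝒜 n →ₗ[k] R ⧸ RingHom.ker π ^ n :=
    { toFun := fun x => Submodule.Quotient.mk (x : R)
      map_add' := fun x y => rfl
      map_smul' := fun a x => by
        change Submodule.Quotient.mk (a • (x : R)) = _
        rw [Algebra.smul_def]
        rfl }
  refine Module.length_le_of_injective f ((injective_iff_map_eq_zero f).2 fun x hx => ?_)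
  have hx' : (x : R) ∈ RingHom.ker π ^ n := (Submodule.Quotient.mk_eq_zero _).1 hx
  have h2 := mem_degreeGE_of_mem_pow 𝒜 (fun r hr => by
    rw [← hπ r, (RingHom.mem_ker).1 hr, map_zero]) n hx'
  exact Subtype.ext ((Submodule.disjoint_def.1 (disjoint_degreeLT_degreeGE 𝒜 n)) _ x.2 h2)

end Graded

/-! ### Graded modules: projections and maps of degree zero -/

namespace QGradedModule

section Basic

variable {k : Type v} {R : Type u} [CommRing k] [CommRing R] [Algebra k R]
  {𝒜 : ℕ → Submodule k R} (M N P : QGradedModule 𝒜)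

theorem isInternal : DirectSum.IsInternal M.piece := by
  have h1 : iSupIndep fun α => AddSubgroup.toIntSubmodule (M.piece α) :=
    (iSupIndep_map_orderIso_iff (AddSubgroup.toIntSubmodule (M := M.carrier))).2 M.indep
  have h2 : ⨆ α, AddSubgroup.toIntSubmodule (M.piece α) = ⊤ := by
    rw [← OrderIso.map_iSup, M.iSup_piece, OrderIso.map_top]
  exact DirectSum.isInternal_submodule_of_iSupIndep_of_iSup_eq_top h1 h2

/-- The decomposition of a graded module into its pieces. -/
noncomputable def decomp : (DirectSum ℚ fun α => M.piece α) ≃+ M.carrier :=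
  AddEquiv.ofBijective (DirectSum.coeAddMonoidHom M.piece) M.isInternal

/-- The projection to the piece of degree `α`. -/
noncomputable def proj (α : ℚ) : M.carrier →+ M.carrier where
  toFun x := M.decomp.symm x α
  map_zero' := by simp
  map_add' x y := by simp

theorem proj_mem (α : ℚ) (x : M.carrier) : M.proj α x ∈ M.piece α := (M.decomp.symm x α).2

theorem decomp_symm_of_mem {α : ℚ} {x : M.carrier} (hx : x ∈ M.piece α) :
    M.decomp.symm x = DirectSum.of (fun α => M.piece α) α (⟨x, hx⟩ : M.piece α) := by
  rw [AddEquiv.symm_apply_eq]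
  exact (DirectSum.coeAddMonoidHom_of M.piece α ⟨x, hx⟩).symm

theorem proj_of_mem {α : ℚ} {x : M.carrier} (hx : x ∈ M.piece α) : M.proj α x = x := by
  change ((M.decomp.symm x) α : M.carrier) = x
  rw [M.decomp_symm_of_mem hx, DirectSum.of_eq_same]

theorem proj_of_mem_ne {α β : ℚ} {x : M.carrier} (hx : x ∈ M.piece α) (h : α ≠ β) :
    M.proj β x = 0 := by
  change ((M.decomp.symm x) β : M.carrier) = 0
  rw [M.decomp_symm_of_mem hx, DirectSum.of_eq_of_ne _ _ _ h.symm]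
  rfl

theorem proj_of_mem_eq_ite {α β : ℚ} {x : M.carrier} (hx : x ∈ M.piece α) :
    M.proj β x = if α = β then x else 0 := by
  split_ifs with h
  · subst h
    exact M.proj_of_mem hx
  · exact M.proj_of_mem_ne hx h

variable {M N P} in
theorem mem_piece_iff {α : ℚ} {x : M.carrier} : x ∈ M.piece α ↔ M.proj α x = x :=
  ⟨M.proj_of_mem, fun h => h ▸ M.proj_mem α x⟩

theorem mem_of_forall_proj_mem {A : AddSubgroup M.carrier} {x : M.carrier}
    (h : ∀ α, M.proj α x ∈ A) : x ∈ A := by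
  classical
  have h1 : ∑ α ∈ (M.decomp.symm x).support, M.proj α x = x := by
    conv_rhs => rw [← M.decomp.apply_symm_apply x]
    change _ = DirectSum.coeAddMonoidHom M.piece (M.decomp.symm x)
    rw [DirectSum.coeAddMonoidHom_eq_dfinsuppSum]
    rfl
  rw [← h1]
  exact AddSubgroup.sum_mem _ fun α _ => h α

theorem eq_zero_of_forall_proj {x : M.carrier} (h : ∀ α, M.proj α x = 0) : x = 0 :=
  M.mem_of_forall_proj_mem (A := ⊥) fun α => by simp [h α]

variable {M} in
theorem homogeneous_induction {p : M.carrier → Prop} (x : M.carrier) (hzero : p 0)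
    (hom : ∀ α, ∀ x ∈ M.piece α, p x) (hadd : ∀ x y, p x → p y → p (x + y)) : p x := by
  have hx : x ∈ ⨆ α, M.piece α := by rw [M.iSup_piece]; trivial
  exact AddSubgroup.iSup_induction M.piece (C := p) hx hom hzero hadd

theorem proj_smul {n : ℕ} {a : R} (ha : a ∈ 𝒜 n) (β : ℚ) (x : M.carrier) :
    M.proj β (a • x) = a • M.proj (β - n) x := by
  induction x using homogeneous_induction with
  | hzero => simp
  | hom α x hx =>
    rw [M.proj_of_mem_eq_ite (M.smul_mem n α a x ha hx), M.proj_of_mem_eq_ite hx]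
    by_cases h : α = β - n
    · rw [if_pos h, if_pos (by rw [h]; ring)]
    · rw [if_neg h, if_neg (fun h' => h (by rw [← h']; ring)), smul_zero]
  | hadd x y hx hy => rw [smul_add, map_add, hx, hy, map_add, smul_add]

variable {M} in
theorem isHomogeneous_iff {A : Submodule R M.carrier} :
    M.IsHomogeneous A ↔ ∀ x ∈ A, ∀ α, M.proj α x ∈ A := by
  constructor
  · intro h x hx α
    have hx' : x ∈ ⨆ α, A.toAddSubgroup ⊓ M.piece α := by
      rw [← show A.toAddSubgroup = _ from h]
      exact hx
    refine AddSubgroup.iSup_induction (fun α => A.toAddSubgroup ⊓ M.piece α)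
      (C := fun x => M.proj α x ∈ A) hx' (fun β y hy => ?_) ?_ fun y z hy hz => ?_
    · rw [M.proj_of_mem_eq_ite hy.2]
      split_ifs
      · exact hy.1
      · exact A.zero_mem
    · rw [map_zero]
      exact A.zero_mem
    · rw [map_add]
      exact A.add_mem hy hz
  · intro h
    refine le_antisymm (fun x hx => ?_) (iSup_le fun α => inf_le_left)
    refine M.mem_of_forall_proj_mem fun α => ?_
    exact AddSubgroup.mem_iSup_of_mem α ⟨h x hx α, M.proj_mem α x⟩

variable {M N P}

/-- Linear maps of degree zero. -/
def IsHom (f : M.carrier →ₗ[R] N.carrier) : Prop := ∀ α, ∀ x ∈ M.piece α, f x ∈ N.piece α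

theorem IsHom.proj_apply {f : M.carrier →ₗ[R] N.carrier} (hf : IsHom f) (α : ℚ) (x : M.carrier) :
    N.proj α (f x) = f (M.proj α x) := by
  induction x using homogeneous_induction with
  | hzero => simp
  | hom β x hx =>
    rw [M.proj_of_mem_eq_ite hx, N.proj_of_mem_eq_ite (hf β x hx)]
    split_ifs <;> simp
  | hadd x y hx hy => rw [map_add, map_add, hx, hy, map_add, map_add]

theorem isHom_of_proj_apply {f : M.carrier →ₗ[R] N.carrier}
    (hf : ∀ α x, N.proj α (f x) = f (M.proj α x)) : IsHom f := fun α x hx => by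
  rw [mem_piece_iff, hf, M.proj_of_mem hx]

theorem IsHom.id : IsHom (LinearMap.id : M.carrier →ₗ[R] M.carrier) := fun _ _ hx => hx

theorem IsHom.comp {g : N.carrier →ₗ[R] P.carrier} {f : M.carrier →ₗ[R] N.carrier} (hg : IsHom g)
    (hf : IsHom f) : IsHom (g ∘ₗ f) := fun α x hx => hg α _ (hf α x hx)

theorem IsHom.zero : IsHom (0 : M.carrier →ₗ[R] N.carrier) := fun α _ _ => (N.piece α).zero_mem

theorem IsHom.add {f g : M.carrier →ₗ[R] N.carrier} (hf : IsHom f) (hg : IsHom g) :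
    IsHom (f + g) := fun α x hx => (N.piece α).add_mem (hf α x hx) (hg α x hx)

theorem IsHom.neg {f : M.carrier →ₗ[R] N.carrier} (hf : IsHom f) : IsHom (-f) :=
  fun α x hx => (N.piece α).neg_mem (hf α x hx)

theorem IsHom.isHomogeneous_range {f : M.carrier →ₗ[R] N.carrier} (hf : IsHom f) :
    N.IsHomogeneous (LinearMap.range f) := by
  rw [isHomogeneous_iff]
  rintro _ ⟨x, rfl⟩ α
  exact ⟨M.proj α x, (hf.proj_apply α x).symm⟩

theorem IsHom.isHomogeneous_ker {f : M.carrier →ₗ[R] N.carrier} (hf : IsHom f) :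
    M.IsHomogeneous (LinearMap.ker f) := by
  rw [isHomogeneous_iff]
  intro x hx α
  rw [LinearMap.mem_ker, ← hf.proj_apply, LinearMap.mem_ker.1 hx, map_zero]

theorem isHom_subtype {A : Submodule R M.carrier} (hA : M.IsHomogeneous A) :
    IsHom (M := M.sub A hA) (N := M) A.subtype := fun _ _ hx => hx

theorem IsHom.codRestrict {A : Submodule R N.carrier} (hA : N.IsHomogeneous A)
    {f : M.carrier →ₗ[R] N.carrier} (hf : IsHom f) (h : ∀ x, f x ∈ A) :
    IsHom (M := M) (N := N.sub A hA) (f.codRestrict A h) := fun α x hx => hf α x hx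

/-! ### Isomorphisms and shifts -/

variable (M N) in
/-- Isomorphism of graded modules (of degree zero). -/
def GIso : Prop := ∃ (f : M.carrier →ₗ[R] N.carrier) (g : N.carrier →ₗ[R] M.carrier),
  IsHom f ∧ IsHom g ∧ g ∘ₗ f = LinearMap.id ∧ f ∘ₗ g = LinearMap.id

theorem GIso.refl (M : QGradedModule 𝒜) : M.GIso M := ⟨_, _, IsHom.id, IsHom.id, rfl, rfl⟩

theorem GIso.symm (h : M.GIso N) : N.GIso M := by
  obtain ⟨f, g, hf, hg, h1, h2⟩ := h
  exact ⟨g, f, hg, hf, h2, h1⟩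

theorem GIso.trans (h : M.GIso N) (h' : N.GIso P) : M.GIso P := by
  obtain ⟨f, g, hf, hg, h1, h2⟩ := h
  obtain ⟨f', g', hf', hg', h1', h2'⟩ := h'
  refine ⟨f' ∘ₗ f, g ∘ₗ g', hf'.comp hf, hg.comp hg', ?_, ?_⟩
  · rw [LinearMap.comp_assoc, ← LinearMap.comp_assoc f, h1', LinearMap.id_comp, h1]
  · rw [LinearMap.comp_assoc, ← LinearMap.comp_assoc g', h2, LinearMap.id_comp, h2']

theorem gIso_of_equiv (f : M.carrier ≃ₗ[R] N.carrier)
    (h : ∀ α x, x ∈ M.piece α ↔ f x ∈ N.piece α) : M.GIso N :=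
  ⟨f, f.symm, fun α x hx => (h α x).1 hx, fun α x hx => (h α _).2 (by simpa using hx),
    by ext; simp, by ext; simp⟩

theorem GIso.exists_equiv (h : M.GIso N) : ∃ f : M.carrier ≃ₗ[R] N.carrier,
    ∀ α x, x ∈ M.piece α ↔ f x ∈ N.piece α := by
  obtain ⟨f, g, hf, hg, h1, h2⟩ := h
  refine ⟨LinearEquiv.ofLinear f g h2 h1, fun α x => ⟨fun hx => hf α x hx, fun hx => ?_⟩⟩
  have := hg α _ hx
  rwa [LinearEquiv.ofLinear_apply, ← LinearMap.comp_apply, h1] at this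

theorem GIso.shiftIso (h : M.GIso N) : M.ShiftIso N := by
  obtain ⟨f, hf⟩ := h.exists_equiv
  exact ⟨0, f, fun β x => by rw [add_zero]; exact hf β x⟩

theorem ShiftIso.refl (M : QGradedModule 𝒜) : M.ShiftIso M := (GIso.refl M).shiftIso

theorem ShiftIso.symm (h : M.ShiftIso N) : N.ShiftIso M := by
  obtain ⟨α, f, hf⟩ := h
  refine ⟨-α, f.symm, fun β x => ?_⟩
  have := hf (β + -α) (f.symm x)
  rw [neg_add_cancel_right, f.apply_symm_apply] at this
  exact this.symm

theorem ShiftIso.trans (h : M.ShiftIso N) (h' : N.ShiftIso P) : M.ShiftIso P := by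
  obtain ⟨α, f, hf⟩ := h
  obtain ⟨α', f', hf'⟩ := h'
  refine ⟨α' + α, f.trans f', fun β x => ?_⟩
  rw [← add_assoc, hf, hf']
  rfl

variable (M) in
/-- The shifted graded module `M(α)`, with `M(α)_β = M_{β + α}`. -/
def shift (α : ℚ) : QGradedModule 𝒜 where
  carrier := M.carrier
  piece β := M.piece (β + α)
  indep := M.indep.comp (add_left_injective α)
  iSup_piece := ((add_right_surjective α).iSup_comp M.piece).trans M.iSup_piece
  smul_mem n β a m ha hm := by
    rw [add_assoc]
    exact M.smul_mem n (β + α) a m ha hm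

theorem shiftIso_iff : M.ShiftIso N ↔ ∃ α, (M.shift α).GIso N := by
  constructor
  · rintro ⟨α, f, hf⟩
    exact ⟨α, gIso_of_equiv (M := M.shift α) f hf⟩
  · rintro ⟨α, h⟩
    obtain ⟨f, hf⟩ := h.exists_equiv
    exact ⟨α, f, hf⟩

theorem shiftIso_shift (α : ℚ) : M.ShiftIso (M.shift α) := shiftIso_iff.2 ⟨α, GIso.refl _⟩

theorem IsHom.shift {f : M.carrier →ₗ[R] N.carrier} (hf : IsHom f) (α : ℚ) :
    IsHom (M := M.shift α) (N := N.shift α) f := fun β x hx => hf (β + α) x hx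

/-! ### Indecomposable graded modules -/

/-- Homogeneous splittings correspond to idempotents of degree zero by range and kernel; the
projection along homogeneous complements commutes with taking components. -/
theorem isIndecomposable_iff : M.IsIndecomposable ↔ Nontrivial M.carrier ∧
    ∀ e : M.carrier →ₗ[R] M.carrier, IsHom e → e ∘ₗ e = e → e = 0 ∨ e = LinearMap.id := by
  refine and_congr_right fun _ => ⟨fun h e he hee => ?_, fun h A B hA hB hAB => ?_⟩
  · have hee' : IsIdempotentElem e := hee
    rcases h _ _ he.isHomogeneous_range he.isHomogeneous_ker
      (LinearMap.IsIdempotentElem.isCompl hee') with h1 | h1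
    · exact Or.inl (LinearMap.range_eq_bot.1 h1)
    · right
      ext x
      have : x - e x ∈ LinearMap.ker e := by
        rw [LinearMap.mem_ker, map_sub, ← LinearMap.comp_apply, hee, sub_self]
      rw [h1, Submodule.mem_bot, sub_eq_zero] at this
      exact this.symm
  · have hp : IsHom (M := M) (N := M) (A.projection B hAB) := by
      refine isHom_of_proj_apply fun α x => ?_
      conv_rhs => rw [← Submodule.projection_add_projection_eq_self hAB x]
      rw [map_add, map_add, Submodule.projection_apply_of_mem_left hAB
          (isHomogeneous_iff.1 hA _ (Submodule.projection_apply_mem _ _) _),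
        (Submodule.projection_apply_eq_zero_iff hAB).2
          (isHomogeneous_iff.1 hB _ (Submodule.projection_apply_mem _ _) _), add_zero]
    rcases h _ hp (Submodule.isIdempotentElem_projection hAB) with h1 | h1
    · left
      rw [← Submodule.range_projection hAB, h1, LinearMap.range_zero]
    · right
      rw [← Submodule.ker_projection hAB, h1, LinearMap.ker_id]

theorem ShiftIso.isIndecomposable (h : M.ShiftIso N) (hM : M.IsIndecomposable) :
    N.IsIndecomposable := by
  obtain ⟨α, f, hf⟩ := h
  rw [isIndecomposable_iff] at hM ⊢
  obtain ⟨h1, h2⟩ := hM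
  refine ⟨f.symm.toEquiv.nontrivial, fun e he hee => ?_⟩
  have := h2 (f.symm.toLinearMap ∘ₗ e ∘ₗ f.toLinearMap) (fun β x hx => by
    have h3 := hf (β - α) x
    rw [sub_add_cancel] at h3
    have h4 := hf (β - α) (f.symm (e (f x)))
    rw [sub_add_cancel, f.apply_symm_apply] at h4
    exact h4.2 (he _ _ (h3.1 hx))) (by
    ext x
    have := LinearMap.congr_fun hee (f x)
    simpa using this)
  refine this.imp (fun h => ?_) fun h => ?_
  · ext x
    have := LinearMap.congr_fun h (f.symm x)
    simpa using this
  · ext x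
    have := LinearMap.congr_fun h (f.symm x)
    simpa using this

end Basic

end QGradedModule

/-! ### Direct sum decompositions of graded modules -/

namespace QGradedModule

section Decomposition

variable {k : Type v} {R : Type u} [CommRing k] [CommRing R] [Algebra k R]
  {𝒜 : ℕ → Submodule k R} {M N P : QGradedModule 𝒜}

/-- `N` is isomorphic to the direct sum of the graded modules `A j`. -/
def IsDecomp {ι : Type*} [Fintype ι] (N : QGradedModule 𝒜) (A : ι → QGradedModule 𝒜) : Prop :=
  ∃ (i : ∀ j, (A j).carrier →ₗ[R] N.carrier) (q : ∀ j, N.carrier →ₗ[R] (A j).carrier),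
    (∀ j, IsHom (i j)) ∧ (∀ j, IsHom (q j)) ∧ (∀ j, q j ∘ₗ i j = LinearMap.id) ∧
    (∀ j l, j ≠ l → q j ∘ₗ i l = 0) ∧ ∑ j, i j ∘ₗ q j = LinearMap.id

variable {ι : Type*} [Fintype ι] {A : ι → QGradedModule 𝒜}

theorem IsDecomp.of_gIso (h : N.IsDecomp A) (e : N.GIso P) : P.IsDecomp A := by
  obtain ⟨i, q, hi, hq, h1, h2, h3⟩ := h
  obtain ⟨f, g, hf, hg, h4, h5⟩ := e
  have key : ∀ j l, (q j ∘ₗ g) ∘ₗ f ∘ₗ i l = q j ∘ₗ i l := by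
    intro j l
    rw [LinearMap.comp_assoc, ← LinearMap.comp_assoc (i l), h4, LinearMap.id_comp]
  refine ⟨fun j => f ∘ₗ i j, fun j => q j ∘ₗ g, fun j => hf.comp (hi j), fun j => (hq j).comp hg,
    fun j => by rw [key, h1], fun j l hjl => by rw [key, h2 j l hjl], ?_⟩
  ext x
  have := congrArg f (LinearMap.congr_fun h3 (g x))
  simp only [LinearMap.sum_apply, map_sum, LinearMap.comp_apply, LinearMap.id_apply] at this ⊢
  rw [this]
  exact LinearMap.congr_fun h5 x

theorem IsDecomp.reindex {κ : Type*} [Fintype κ] (h : N.IsDecomp A) (e : κ ≃ ι) :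
    N.IsDecomp fun j => A (e j) := by
  obtain ⟨i, q, hi, hq, h1, h2, h3⟩ := h
  exact ⟨fun j => i (e j), fun j => q (e j), fun j => hi _, fun j => hq _, fun j => h1 _,
    fun j l hjl => h2 _ _ (e.injective.ne hjl),
    (e.sum_comp fun j => i j ∘ₗ q j).trans h3⟩

theorem IsDecomp.shift (h : N.IsDecomp A) (α : ℚ) :
    (N.shift α).IsDecomp fun j => (A j).shift α := by
  obtain ⟨i, q, hi, hq, h1, h2, h3⟩ := h
  exact ⟨i, q, fun j => (hi j).shift α, fun j => (hq j).shift α, h1, h2, h3⟩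

theorem isDecomp_unit (N : QGradedModule 𝒜) : N.IsDecomp fun _ : Unit => N :=
  ⟨fun _ => LinearMap.id, fun _ => LinearMap.id, fun _ => IsHom.id, fun _ => IsHom.id,
    fun _ => rfl, fun _ _ h => (h rfl).elim, by simp⟩

theorem isDecomp_empty [Subsingleton N.carrier] (A : Empty → QGradedModule 𝒜) : N.IsDecomp A :=
  ⟨fun j => j.elim, fun j => j.elim, fun j => j.elim, fun j => j.elim, fun j => j.elim,
    fun j => j.elim, by ext x; exact Subsingleton.elim _ _⟩

theorem IsDecomp.sigma {κ : ι → Type*} [∀ j, Fintype (κ j)]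
    {B : ∀ j, κ j → QGradedModule 𝒜} (h : N.IsDecomp A) (hB : ∀ j, (A j).IsDecomp (B j)) :
    N.IsDecomp fun x : Σ j, κ j => B x.1 x.2 := by
  obtain ⟨i, q, hi, hq, h1, h2, h3⟩ := h
  choose i' q' hi' hq' h1' h2' h3' using hB
  refine ⟨fun x => i x.1 ∘ₗ i' x.1 x.2, fun x => q' x.1 x.2 ∘ₗ q x.1,
    fun x => (hi _).comp (hi' _ _), fun x => (hq' _ _).comp (hq _), fun x => ?_, ?_, ?_⟩
  · rw [LinearMap.comp_assoc, ← LinearMap.comp_assoc (i' x.1 x.2), h1, LinearMap.id_comp, h1']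
  · rintro ⟨j, x⟩ ⟨l, y⟩ hne
    simp only
    rw [LinearMap.comp_assoc, ← LinearMap.comp_assoc (i' l y)]
    by_cases hjl : j = l
    · subst hjl
      rw [h1, LinearMap.id_comp, h2']
      rintro rfl
      exact hne rfl
    · rw [h2 _ _ hjl, LinearMap.zero_comp, LinearMap.comp_zero]
  · ext x
    rw [LinearMap.sum_apply, Fintype.sum_sigma]
    have h4 : ∀ j, ∑ y, i' j y (q' j y (q j x)) = q j x := by
      intro j
      have := LinearMap.congr_fun (h3' j) (q j x)
      rwa [LinearMap.sum_apply] at this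
    have h5 := LinearMap.congr_fun h3 x
    rw [LinearMap.sum_apply] at h5
    refine Eq.trans ?_ h5
    refine Finset.sum_congr rfl fun j _ => ?_
    simp only [LinearMap.comp_apply]
    rw [← map_sum (i j), h4]

theorem coeLinearMap_eq_sum [DecidableEq ι] {M : Type*} [AddCommGroup M] [Module R M]
    (B : ι → Submodule R M) (y : DirectSum ι fun j => B j) :
    DirectSum.coeLinearMap B y = ∑ j, (y j : M) := by
  conv_lhs => rw [← DirectSum.sum_univ_of y]
  rw [map_sum]
  exact Finset.sum_congr rfl fun j _ => DirectSum.coeLinearMap_lof B j (y j)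

theorem isDecomp_of_isInternal [DecidableEq ι] {B : ι → Submodule R N.carrier}
    (hB : ∀ j, N.IsHomogeneous (B j)) (h : DirectSum.IsInternal B) :
    N.IsDecomp fun j => N.sub (B j) (hB j) := by
  let e : (DirectSum ι fun j => B j) ≃ₗ[R] N.carrier :=
    LinearEquiv.ofBijective (DirectSum.coeLinearMap B) h
  let q : ∀ j, N.carrier →ₗ[R] B j := fun j => DirectSum.component R ι _ j ∘ₗ e.symm.toLinearMap
  have he : ∀ j (x : B j), e.symm x = DirectSum.lof R ι (fun j => B j) j x := by
    intro j x
    rw [LinearEquiv.symm_apply_eq]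
    exact (DirectSum.coeLinearMap_lof B j x).symm
  have hq1 : ∀ j (x : B j), q j x = x := by
    intro j x
    change DirectSum.component R ι _ j (e.symm x) = x
    rw [he, DirectSum.component.lof_self]
  have hq2 : ∀ j l (x : B l), l ≠ j → q j x = 0 := by
    intro j l x hjl
    change DirectSum.component R ι _ j (e.symm x) = 0
    rw [he, DirectSum.component.of, dif_neg hjl]
  have hsum : ∀ x, ∑ j, (q j x : N.carrier) = x := by
    intro x
    conv_rhs => rw [← e.apply_symm_apply x]
    change _ = DirectSum.coeLinearMap B (e.symm x)
    rw [coeLinearMap_eq_sum]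
    rfl
  have hqsum : ∀ l (y : ∀ j, B j), q l (∑ j, (y j : N.carrier)) = y l := by
    intro l y
    rw [map_sum, Finset.sum_eq_single l]
    · exact hq1 l (y l)
    · exact fun j _ hj => hq2 l j (y j) hj
    · exact fun h => (h (Finset.mem_univ l)).elim
  refine ⟨fun j => (B j).subtype, q, fun j => isHom_subtype (hB j), fun l α x hx => ?_,
    fun j => LinearMap.ext (hq1 j), fun j l hjl => LinearMap.ext fun x => hq2 j l x hjl.symm, ?_⟩
  · change (q l x : N.carrier) ∈ N.piece α
    -- Homogeneity keeps the degree-α components inside the summands. By uniqueness of the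
    -- decomposition of x they are the q j x, so these have degree α.
    have h1 : ∀ j, N.proj α (q j x) ∈ B j := fun j =>
      isHomogeneous_iff.1 (hB j) _ (q j x).2 α
    have h2 : ∑ j, ((⟨N.proj α (q j x), h1 j⟩ : B j) : N.carrier) = x := by
      simp only
      rw [← map_sum, hsum, N.proj_of_mem hx]
    have h3 := hqsum l fun j => ⟨N.proj α (q j x), h1 j⟩
    rw [h2] at h3
    rw [h3]
    exact N.proj_mem α _
  · ext x
    rw [LinearMap.sum_apply]
    exact hsum x

theorem IsDecomp.exists_isInternal [DecidableEq ι] (h : N.IsDecomp A) :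
    ∃ (B : ι → Submodule R N.carrier) (hB : ∀ j, N.IsHomogeneous (B j)),
      DirectSum.IsInternal B ∧ ∀ j, (A j).GIso (N.sub (B j) (hB j)) := by
  obtain ⟨i, q, hi, hq, h1, h2, h3⟩ := h
  refine ⟨fun j => LinearMap.range (i j), fun j => (hi j).isHomogeneous_range, ?_, fun j => ?_⟩
  · have hz : ∀ (l) (y : DirectSum ι fun j => LinearMap.range (i j)),
        i l (q l (DirectSum.coeLinearMap (fun j => LinearMap.range (i j)) y)) = y l := by
      intro l y
      rw [coeLinearMap_eq_sum, map_sum, map_sum,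
        Finset.sum_eq_single l]
      · obtain ⟨z, hz⟩ := (y l).2
        rw [← hz, ← LinearMap.comp_apply (q l), h1, LinearMap.id_apply]
      · intro j _ hj
        obtain ⟨z, hz⟩ := (y j).2
        rw [← hz, ← LinearMap.comp_apply (q l), h2 _ _ hj.symm, LinearMap.zero_apply, map_zero]
      · exact fun h => (h (Finset.mem_univ l)).elim
    refine ⟨fun y z hyz => ?_, fun x => ?_⟩
    · refine DFinsupp.ext fun l => Subtype.ext ?_
      have hyz' : DirectSum.coeLinearMap (fun j => LinearMap.range (i j)) y =
        DirectSum.coeLinearMap (fun j => LinearMap.range (i j)) z := hyz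
      rw [← hz l y, hyz', hz l z]
    · refine ⟨∑ j, DirectSum.lof R ι (fun j => LinearMap.range (i j)) j ⟨i j (q j x), q j x, rfl⟩,
        ?_⟩
      change DirectSum.coeLinearMap (fun j => LinearMap.range (i j)) _ = x
      rw [map_sum]
      have := LinearMap.congr_fun h3 x
      rw [LinearMap.sum_apply] at this
      refine Eq.trans (Finset.sum_congr rfl fun j _ => ?_) this
      rw [DirectSum.coeLinearMap_lof]
      rfl
  · refine ⟨(i j).codRestrict _ fun x => ⟨x, rfl⟩, q j ∘ₗ (LinearMap.range (i j)).subtype,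
      (hi j).codRestrict _ _, (hq j).comp (isHom_subtype _), ?_, ?_⟩
    · ext x
      exact LinearMap.congr_fun (h1 j) x
    · refine LinearMap.ext fun y => Subtype.ext ?_
      obtain ⟨_, x, rfl⟩ := y
      change i j (q j (i j x)) = i j x
      rw [← LinearMap.comp_apply (q j), h1, LinearMap.id_apply]

/-- Passage from internal decompositions into submodules to external ones given by maps, which are
transported by isomorphisms, shifts and Frobenius push-forward. -/
theorem hasMultiplicity_iff {a : ℕ} : M.HasMultiplicity N a ↔
    ∃ (r : ℕ) (A : Fin r → QGradedModule 𝒜), N.IsDecomp A ∧ (∀ j, (A j).IsIndecomposable) ∧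
      Nat.card {j // M.ShiftIso (A j)} = a := by
  constructor
  · rintro ⟨r, B, hB, hint, hind, hcard⟩
    exact ⟨r, fun j => N.sub (B j) (hB j), isDecomp_of_isInternal hB hint, hind, hcard⟩
  · rintro ⟨r, A, hA, hind, hcard⟩
    obtain ⟨B, hB, hint, hiso⟩ := hA.exists_isInternal
    refine ⟨r, B, hB, hint, fun j => (hiso j).shiftIso.isIndecomposable (hind j), ?_⟩
    rw [← hcard]
    refine Nat.card_congr (Equiv.subtypeEquivRight fun j => ?_)
    exact ⟨fun h => h.trans (hiso j).shiftIso.symm, fun h => h.trans (hiso j).shiftIso⟩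

variable (N) in
/-- `N` is a finite direct sum of indecomposable graded modules. -/
def HasDecomp : Prop := ∃ (ι : Type) (_ : Fintype ι) (A : ι → QGradedModule 𝒜),
  N.IsDecomp A ∧ ∀ j, (A j).IsIndecomposable

theorem HasDecomp.exists_fin (h : N.HasDecomp) : ∃ (r : ℕ) (A : Fin r → QGradedModule 𝒜),
    N.IsDecomp A ∧ ∀ j, (A j).IsIndecomposable := by
  obtain ⟨ι, _, A, hA, hind⟩ := h
  exact ⟨Fintype.card ι, _, hA.reindex (Fintype.equivFin ι).symm, fun j => hind _⟩

theorem HasDecomp.of_isDecomp {ι : Type} [Fintype ι] {A : ι → QGradedModule 𝒜}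
    (h : N.IsDecomp A) (hA : ∀ j, (A j).HasDecomp) : N.HasDecomp := by
  choose κ hκ B hB hind using hA
  exact ⟨Σ j, κ j, inferInstance, fun x => B x.1 x.2, h.sigma hB, fun x => hind _ _⟩

/-- Noetherian induction over the retracts X of N, measured by the kernel of the projection N → X:
splitting X enlarges this kernel for both summands. -/
theorem hasDecomp_of_isNoetherian (N : QGradedModule 𝒜) [IsNoetherian R N.carrier] :
    N.HasDecomp := by
  suffices H : ∀ (K : Submodule R N.carrier) (X : QGradedModule 𝒜)
      (i : X.carrier →ₗ[R] N.carrier) (q : N.carrier →ₗ[R] X.carrier), q ∘ₗ i = LinearMap.id →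
      LinearMap.ker q = K → X.HasDecomp from
    H _ N LinearMap.id LinearMap.id rfl rfl
  intro K
  induction K using WellFoundedGT.induction with
  | _ K ih =>
  intro X i q hqi hK
  by_cases hnt : Nontrivial X.carrier
  swap
  · rw [not_nontrivial_iff_subsingleton] at hnt
    exact ⟨Empty, inferInstance, fun j => j.elim, isDecomp_empty _, fun j => j.elim⟩
  by_cases hX : X.IsIndecomposable
  · exact ⟨Unit, inferInstance, fun _ => X, isDecomp_unit X, fun _ => hX⟩
  have hX' : ¬ ∀ A B : Submodule R X.carrier,
    X.IsHomogeneous A → X.IsHomogeneous B → IsCompl A B → A = ⊥ ∨ B = ⊥ := fun h => hX ⟨hnt, h⟩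
  push Not at hX'
  obtain ⟨A, B, hA, hB, hAB, hA0, hB0⟩ := hX'
  have hsub : ∀ (A B : Submodule R X.carrier) (hA : X.IsHomogeneous A), IsCompl A B → B ≠ ⊥ →
      (X.sub A hA).HasDecomp := by
    intro A B hA hAB hB
    refine ih (LinearMap.ker (A.projectionOnto B hAB ∘ₗ q)) ?_ (X.sub A hA) (i ∘ₗ A.subtype)
      (A.projectionOnto B hAB ∘ₗ q) ?_ rfl
    · rw [← hK, SetLike.lt_iff_le_and_exists]
      refine ⟨LinearMap.ker_le_ker_comp _ _, ?_⟩
      obtain ⟨b, hb, hb0⟩ := Submodule.exists_mem_ne_zero_of_ne_bot hB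
      have hqib : q (i b) = b := LinearMap.congr_fun hqi b
      refine ⟨i b, ?_, ?_⟩
      · rw [LinearMap.mem_ker, LinearMap.comp_apply, hqib]
        exact (Submodule.projectionOnto_apply_eq_zero_iff hAB).2 hb
      · rw [LinearMap.mem_ker, hqib]
        exact hb0
    · refine LinearMap.ext fun (x : A) => ?_
      change A.projectionOnto B hAB (q (i (x : X.carrier))) = x
      rw [← LinearMap.comp_apply q, hqi, LinearMap.id_apply, Submodule.projectionOnto_apply_left]
  let F : Bool → Submodule R X.carrier := fun b => cond b A B
  have hF : ∀ b, X.IsHomogeneous (F b) := by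
    rintro (_ | _)
    exacts [hB, hA]
  have hint : DirectSum.IsInternal F :=
    (DirectSum.isInternal_submodule_iff_isCompl F (i := true) (j := false) (by simp)
      (by ext b; cases b <;> simp)).2 hAB
  refine HasDecomp.of_isDecomp (isDecomp_of_isInternal hF hint) ?_
  rintro (_ | _)
  exacts [hsub B A hB hAB.symm hA0, hsub A B hA hAB hB0]

end Decomposition

end QGradedModule

/-! ### The Krull–Schmidt theorem for graded modules -/

section LocalRing

variable {Λ : Type*} [Ring Λ] [IsLocalRing Λ]

/-- The product ab is idempotent. In a local ring it is 0 or 1, and 0 would give a = aba = 0. -/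
theorem IsLocalRing.isUnit_of_mul_eq_one_left {a b : Λ} (h : b * a = 1) : IsUnit a := by
  have hid : (a * b) * (a * b) = a * b := by
    rw [mul_assoc, ← mul_assoc b, h, one_mul]
  have hab : a * b = 1 := by
    rcases IsLocalRing.isUnit_or_isUnit_of_add_one (show a * b + (1 - a * b) = 1 by abel) with h1 | h1
    · exact h1.mul_left_cancel (by rw [hid, mul_one])
    · exfalso
      have h2 : a * b = 0 := by
        refine h1.mul_left_cancel ?_
        rw [sub_mul, one_mul, hid, sub_self, mul_zero]
      have h3 : a = 0 := by
        rw [← mul_one a, ← h, ← mul_assoc, h2, zero_mul]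
      rw [h3, mul_zero] at h
      exact zero_ne_one h
  exact ⟨⟨a, b, hab, h⟩, rfl⟩

/-- If a maximal left ideal missed a, some y in it would satisfy y + ba = 1. As y is not a unit, ba
is one, so a has a left inverse and is a unit. -/
theorem IsLocalRing.mem_ringJacobson {a : Λ} (ha : ¬ IsUnit a) : a ∈ Ring.jacobson Λ := by
  rw [Ring.jacobson_eq_sInf_isMaximal, Ideal.mem_sInf]
  intro m hm
  have hm : m.IsMaximal := hm
  by_contra ham
  obtain ⟨y, hy, z, hz, hyz⟩ := Submodule.mem_sup.1 (show (1 : Λ) ∈ m ⊔ Ideal.span {a} by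
    rw [hm.out.2 _ (left_lt_sup.2 fun h => ham (h (Ideal.mem_span_singleton_self a)))]
    trivial)
  obtain ⟨b, rfl⟩ := Ideal.mem_span_singleton'.1 hz
  rcases IsLocalRing.isUnit_or_isUnit_of_add_one hyz with h1 | h1
  · exact hm.ne_top (Ideal.eq_top_of_isUnit_mem m hy h1)
  · obtain ⟨u, hu⟩ := h1
    apply ha
    refine IsLocalRing.isUnit_of_mul_eq_one_left (b := ↑u⁻¹ * b) ?_
    rw [mul_assoc, ← hu, Units.inv_mul]

theorem IsLocalRing.one_notMem_ringJacobson : (1 : Λ) ∉ Ring.jacobson Λ := fun h =>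
  (Ring.jacobson_lt_top Λ).ne ((Ideal.eq_top_iff_one _).2 h)

/-- Matrices over a local ring whose product is the identity modulo the radical. -/
theorem IsLocalRing.card_le_card_of_mul {I J : Type*} [Fintype I] [Fintype J] [DecidableEq I]
    (Q : Matrix I J Λ) (P : Matrix J I Λ) (h : ∀ i i', (1 - Q * P : Matrix I I Λ) i i' ∈ Ring.jacobson Λ) :
    Fintype.card I ≤ Fintype.card J := by
  let D := Λ ⧸ Ring.jacobson Λ
  let π : Λ →+* D := Ideal.Quotient.mk _
  have : Nontrivial D := Ideal.Quotient.nontrivial_iff.2 (Ring.jacobson_lt_top Λ).ne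
  -- Modulo the radical the scalars form a division ring and Q P = 1. Right multiplication by Q then
  -- embeds D^I into D^J.
  let _ : DivisionRing D := DivisionRing.ofIsUnitOrEqZero fun a => by
    obtain ⟨a, rfl⟩ := Ideal.Quotient.mk_surjective a
    by_cases ha : IsUnit a
    · exact Or.inl (ha.map π)
    · exact Or.inr (Ideal.Quotient.eq_zero_iff_mem.2 (IsLocalRing.mem_ringJacobson ha))
  have hQP : Q.map π * P.map π = 1 := by
    rw [← Matrix.map_mul]
    ext i i'
    have h1 : π ((1 - Q * P : Matrix I I Λ) i i') = 0 := Ideal.Quotient.eq_zero_iff_mem.2 (h i i')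
    rw [Matrix.sub_apply, map_sub, sub_eq_zero] at h1
    rw [Matrix.map_apply, ← h1, Matrix.one_apply, Matrix.one_apply]
    split_ifs <;> simp
  refine card_le_of_injective D (Q.map π).vecMulLinear fun v w hvw => ?_
  have h1 : Matrix.vecMul v (Q.map π) = Matrix.vecMul w (Q.map π) := hvw
  have h2 := congrArg (fun z => Matrix.vecMul z (P.map π)) h1
  simpa only [Matrix.vecMul_vecMul, hQP, Matrix.vecMul_one] using h2

end LocalRing

namespace QGradedModule

section KrullSchmidt

variable {k : Type v} {R : Type u} [CommRing k] [CommRing R] [Algebra k R]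
  {𝒜 : ℕ → Submodule k R} {M N P : QGradedModule 𝒜}

variable (M) in
/-- The ring of endomorphisms of degree zero of a graded module. -/
def endRing : Subring (Module.End R M.carrier) where
  carrier := {f | IsHom (M := M) (N := M) f}
  mul_mem' hf hg := IsHom.comp hf hg
  one_mem' := IsHom.id
  add_mem' hf hg := IsHom.add hf hg
  zero_mem' := IsHom.zero
  neg_mem' hf := IsHom.neg hf

/-- If b inverts gf, then fbg is an idempotent of N. It is nonzero because M is, so it is the
identity and f is invertible. -/
theorem GIso.of_isUnit_comp [Nontrivial M.carrier] (hN : N.IsIndecomposable)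
    {f : M.carrier →ₗ[R] N.carrier} {g : N.carrier →ₗ[R] M.carrier} (hf : IsHom f) (hg : IsHom g)
    (h : IsUnit (⟨g ∘ₗ f, hg.comp hf⟩ : M.endRing)) : M.GIso N := by
  obtain ⟨⟨⟨a, ha⟩, ⟨b, hb⟩, hab, hba⟩, hu⟩ := h
  obtain rfl : a = g ∘ₗ f := congrArg Subtype.val hu
  have h1 : ∀ x, g (f (b x)) = x := fun x => LinearMap.congr_fun (congrArg Subtype.val hab) x
  have h2 : ∀ x, b (g (f x)) = x := fun x => LinearMap.congr_fun (congrArg Subtype.val hba) x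
  have hb' : IsHom (M := M) (N := M) b := hb
  rcases (isIndecomposable_iff.1 hN).2 (f ∘ₗ b ∘ₗ g) (hf.comp (hb'.comp hg))
    (by ext x; simp [h2]) with h3 | h3
  · exfalso
    obtain ⟨x, hx⟩ := exists_ne (0 : M.carrier)
    have h4 := LinearMap.congr_fun h3 (f x)
    simp only [LinearMap.comp_apply, h2, LinearMap.zero_apply] at h4
    apply hx
    rw [← h2 x, h4, map_zero, map_zero]
  · exact ⟨f, b ∘ₗ g, hf, hb'.comp hg, LinearMap.ext h2, h3⟩

theorem nontrivial_of_isLocalRing_endRing [IsLocalRing M.endRing] : Nontrivial M.carrier := by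
  by_contra h
  rw [not_nontrivial_iff_subsingleton] at h
  exact zero_ne_one (α := M.endRing) (Subtype.ext (LinearMap.ext fun x => Subsingleton.elim _ _))

/-- A retract with local endomorphism ring occurs in every decomposition into indecomposables. -/
theorem IsDecomp.exists_gIso_of_retract [IsLocalRing M.endRing] {ι : Type*} [Fintype ι]
    {A : ι → QGradedModule 𝒜} (h : N.IsDecomp A) (hA : ∀ j, (A j).IsIndecomposable)
    {f : M.carrier →ₗ[R] N.carrier} {g : N.carrier →ₗ[R] M.carrier} (hf : IsHom f) (hg : IsHom g)
    (hgf : g ∘ₗ f = LinearMap.id) : ∃ j, M.GIso (A j) := by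
  have := nontrivial_of_isLocalRing_endRing (M := M)
  obtain ⟨i, q, hi, hq, h1, h2, h3⟩ := h
  by_contra! hno
  apply IsLocalRing.one_notMem_ringJacobson (Λ := M.endRing)
  have hsum : (1 : M.endRing) = ∑ j, ⟨(g ∘ₗ i j) ∘ₗ (q j ∘ₗ f),
      (hg.comp (hi j)).comp ((hq j).comp hf)⟩ := by
    refine Subtype.ext (LinearMap.ext fun x => ?_)
    rw [AddSubmonoidClass.coe_finsetSum, LinearMap.sum_apply]
    have h4 := LinearMap.congr_fun h3 (f x)
    rw [LinearMap.sum_apply] at h4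
    have h5 := congrArg g h4
    rw [map_sum] at h5
    exact ((LinearMap.congr_fun hgf x).symm.trans h5.symm)
  rw [hsum]
  exact Submodule.sum_mem _ fun j _ => IsLocalRing.mem_ringJacobson fun hunit =>
    hno j (GIso.of_isUnit_comp (hA j) ((hq j).comp hf) (hg.comp (hi j)) hunit)

/-- Compose inclusions and projections between the copies of M in the two decompositions to get
matrices over the local ring End M. The identity of N is the sum over all B j, and the terms for B j
not isomorphic to M are non-units, hence radical. So the product of the matrices is 1 modulo the
radical. -/
theorem IsDecomp.card_gIso_le [IsLocalRing M.endRing] {ι κ : Type*} [Fintype ι] [Fintype κ]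
    {A : ι → QGradedModule 𝒜} {B : κ → QGradedModule 𝒜} (hA : N.IsDecomp A) (hB : N.IsDecomp B)
    (hind : ∀ j, (B j).IsIndecomposable) :
    Nat.card {i // M.GIso (A i)} ≤ Nat.card {j // M.GIso (B j)} := by
  classical
  have := nontrivial_of_isLocalRing_endRing (M := M)
  obtain ⟨i, q, hi, hq, h1, h2, h3⟩ := hA
  obtain ⟨i', q', hi', hq', h1', h2', h3'⟩ := hB
  choose f g hf hg hgf hfg using fun x : {i // M.GIso (A i)} => x.2
  choose f' g' hf' hg' hgf' hfg' using fun x : {j // M.GIso (B j)} => x.2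
  rw [Nat.card_eq_fintype_card, Nat.card_eq_fintype_card]
  refine IsLocalRing.card_le_card_of_mul (Λ := M.endRing)
    (Matrix.of fun x y => ⟨(g x ∘ₗ q x) ∘ₗ (i' y ∘ₗ f' y),
      ((hg x).comp (hq x)).comp ((hi' y).comp (hf' y))⟩)
    (Matrix.of fun y x => ⟨(g' y ∘ₗ q' y) ∘ₗ (i x ∘ₗ f x),
      ((hg' y).comp (hq' y)).comp ((hi x).comp (hf x))⟩) fun x z => ?_
  let T : κ → M.endRing := fun j => ⟨(g x ∘ₗ q x ∘ₗ i' j) ∘ₗ (q' j ∘ₗ i z ∘ₗ f z),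
    ((hg x).comp ((hq x).comp (hi' j))).comp ((hq' j).comp ((hi z).comp (hf z)))⟩
  have hsum : ∑ j, T j = (1 : Matrix _ _ M.endRing) x z := by
    refine Subtype.ext (LinearMap.ext fun m => ?_)
    rw [AddSubmonoidClass.coe_finsetSum, LinearMap.sum_apply]
    have h4 := LinearMap.congr_fun h3' (i z (f z m))
    rw [LinearMap.sum_apply] at h4
    have h5 := congrArg (fun y => g x (q x y)) h4
    simp only [map_sum] at h5
    refine h5.trans ?_
    rw [LinearMap.id_apply, ← LinearMap.comp_apply (q x)]
    by_cases hxz : x = z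
    · subst hxz
      rw [h1, LinearMap.id_apply, Matrix.one_apply_eq]
      exact LinearMap.congr_fun (hgf x) m
    · rw [h2 _ _ fun h => hxz (Subtype.ext h), Matrix.one_apply_ne hxz, LinearMap.zero_apply,
        map_zero]
      rfl
  have hsplit := Fintype.sum_subtype_add_sum_subtype (fun j => M.GIso (B j)) T
  rw [Matrix.sub_apply, ← hsum, ← hsplit, Matrix.mul_apply, add_sub_assoc, add_sub_left_comm]
  refine Submodule.add_mem _ (Submodule.sum_mem _ fun j _ => ?_) ?_
  · exact IsLocalRing.mem_ringJacobson fun hunit => j.2 (GIso.of_isUnit_comp (hind j)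
      ((hq' j).comp ((hi z).comp (hf z))) ((hg x).comp ((hq x).comp (hi' j))) hunit)
  · rw [← Finset.sum_sub_distrib]
    refine Submodule.sum_mem _ fun y _ => ?_
    convert Submodule.zero_mem _
    rw [sub_eq_zero]
    refine Subtype.ext (LinearMap.ext fun m => ?_)
    change g x (q x (i' y (q' y (i z (f z m))))) = g x (q x (i' y (f' y (g' y (q' y (i z (f z m)))))))
    rw [← LinearMap.comp_apply (f' y), hfg', LinearMap.id_apply]

/-- Isomorphism of graded modules, as an equivalence relation. -/
def gIsoSetoid (𝒜 : ℕ → Submodule k R) : Setoid (QGradedModule 𝒜) where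
  r := GIso
  iseqv := ⟨GIso.refl, GIso.symm, GIso.trans⟩

theorem IsDecomp.card_gIso_le' {ι κ : Type} [Fintype ι] [Fintype κ]
    {A : ι → QGradedModule 𝒜} {B : κ → QGradedModule 𝒜} (hA : N.IsDecomp A) (hB : N.IsDecomp B)
    (hBi : ∀ j, (B j).IsIndecomposable) (hAl : ∀ j, IsLocalRing (A j).endRing)
    (X : QGradedModule 𝒜) : Nat.card {i // X.GIso (A i)} ≤ Nat.card {j // X.GIso (B j)} := by
  rcases isEmpty_or_nonempty {i // X.GIso (A i)} with h | ⟨⟨i, hi⟩⟩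
  · rw [Nat.card_of_isEmpty]
    exact Nat.zero_le _
  · have := hAl i
    have h1 : ∀ {ι : Type} (A' : ι → QGradedModule 𝒜), Nat.card {j // X.GIso (A' j)} =
        Nat.card {j // (A i).GIso (A' j)} := fun A' => Nat.card_congr
      (Equiv.subtypeEquivRight fun j => ⟨fun h => hi.symm.trans h, fun h => hi.trans h⟩)
    rw [h1 A, h1 B]
    exact hA.card_gIso_le hB hBi

theorem IsDecomp.card_gIso_eq {ι κ : Type} [Fintype ι] [Fintype κ]
    {A : ι → QGradedModule 𝒜} {B : κ → QGradedModule 𝒜} (hA : N.IsDecomp A) (hB : N.IsDecomp B)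
    (hAi : ∀ j, (A j).IsIndecomposable) (hBi : ∀ j, (B j).IsIndecomposable)
    (hAl : ∀ j, IsLocalRing (A j).endRing) (hBl : ∀ j, IsLocalRing (B j).endRing)
    (X : QGradedModule 𝒜) : Nat.card {i // X.GIso (A i)} = Nat.card {j // X.GIso (B j)} :=
  le_antisymm (hA.card_gIso_le' hB hBi hAl X) (hB.card_gIso_le' hA hAi hBl X)

/-- The Krull–Schmidt theorem: multiplicities do not depend on the decomposition. -/
theorem IsDecomp.card_shiftIso_eq {ι κ : Type} [Fintype ι] [Fintype κ]
    {A : ι → QGradedModule 𝒜} {B : κ → QGradedModule 𝒜} (hA : N.IsDecomp A) (hB : N.IsDecomp B)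
    (hAi : ∀ j, (A j).IsIndecomposable) (hBi : ∀ j, (B j).IsIndecomposable)
    (hAl : ∀ j, IsLocalRing (A j).endRing) (hBl : ∀ j, IsLocalRing (B j).endRing)
    (M : QGradedModule 𝒜) :
    Nat.card {i // M.ShiftIso (A i)} = Nat.card {j // M.ShiftIso (B j)} := by
  classical
  let cls : QGradedModule 𝒜 → Quotient (gIsoSetoid 𝒜) := fun X => Quotient.mk _ X
  -- Equal counts for each degree-zero isomorphism class give equal multisets of classes.
  -- Isomorphism up to shift is a coarser predicate on classes, so its count agrees too.
  have hmap : (Finset.univ.val.map fun i => cls (A i)) =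
      Finset.univ.val.map fun j => cls (B j) := by
    ext c
    obtain ⟨X, rfl⟩ := Quotient.exists_rep c
    have h1 : ∀ {ι : Type} [Fintype ι] (A : ι → QGradedModule 𝒜),
        Multiset.count (cls X) (Finset.univ.val.map fun i => cls (A i)) =
          Nat.card {i // X.GIso (A i)} := by
      intro ι _ A
      rw [Multiset.count_map, Nat.card_eq_fintype_card, Fintype.card_subtype]
      change (Finset.univ.filter fun i => cls X = cls (A i)).card = _
      congr 1
      ext i
      simp only [Finset.mem_filter, Finset.mem_univ, true_and]
      exact Quotient.eq
    exact (h1 A).trans ((hA.card_gIso_eq hB hAi hBi hAl hBl X).trans (h1 B).symm)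
  let Q : Quotient (gIsoSetoid 𝒜) → Prop := Quotient.lift (fun X => M.ShiftIso X)
    fun X Y h => propext ⟨fun h1 => h1.trans (GIso.shiftIso h),
      fun h1 => h1.trans (GIso.shiftIso (GIso.symm h))⟩
  have h2 : ∀ {ι : Type} [Fintype ι] (A : ι → QGradedModule 𝒜),
      Multiset.countP Q (Finset.univ.val.map fun i => cls (A i)) =
        Nat.card {i // M.ShiftIso (A i)} := by
    intro ι _ A
    rw [Multiset.countP_map, Nat.card_eq_fintype_card, Fintype.card_subtype]
    rfl
  rw [← h2 A, ← h2 B, hmap]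

end KrullSchmidt

end QGradedModule

/-! ### Endomorphism rings of indecomposable graded modules are local -/

namespace QGradedModule

section EndLocal

variable {k : Type v} {R : Type u} [CommRing k] [CommRing R] [Algebra k R]
  {𝒜 : ℕ → Submodule k R} [GradedAlgebra 𝒜]

/-- A graded module as a module over the base ring of the graded ring. -/
abbrev baseModule (M : QGradedModule 𝒜) : Module k M.carrier :=
  Module.compHom M.carrier (algebraMap k R)

attribute [local instance] baseModule

/-- The homogeneous pieces, as modules over the base ring. -/
def pieceBase (M : QGradedModule 𝒜) (α : ℚ) : Submodule k M.carrier where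
  carrier := M.piece α
  add_mem' := (M.piece α).add_mem
  zero_mem' := (M.piece α).zero_mem
  smul_mem' c m hm := by
    have h := M.smul_mem 0 α (algebraMap k R c) m (SetLike.algebraMap_mem_graded 𝒜 c) hm
    rwa [Nat.cast_zero, zero_add] at h

/-- Only the degree-zero part of R, which is the image of k, maps degree α to degree α. Hence the
R-span of K meets degree α in K alone. -/
theorem proj_mem_of_mem_span (h0 : 𝒜 0 = 1) (M : QGradedModule 𝒜) {α : ℚ}
    {K : Submodule k M.carrier} (hK : K ≤ M.pieceBase α) {x : M.carrier}
    (hx : x ∈ Submodule.span R (K : Set M.carrier)) : M.proj α x ∈ K := by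
  induction hx using Submodule.closure_induction with
  | zero => rw [map_zero]; exact K.zero_mem
  | add x y _ _ hx hy => rw [map_add]; exact K.add_mem hx hy
  | smul_mem a x hx =>
    induction a using DirectSum.Decomposition.inductionOn 𝒜 with
    | zero => rw [zero_smul, map_zero]; exact K.zero_mem
    | add a b ha hb => rw [add_smul, map_add]; exact K.add_mem ha hb
    | @homogeneous n a =>
      rw [M.proj_smul a.2, M.proj_of_mem_eq_ite (hK hx)]
      split_ifs with h
      · obtain rfl : n = 0 := by
          rw [eq_sub_iff_add_eq, add_eq_left] at h
          exact_mod_cast h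
        obtain ⟨c, hc⟩ := Submodule.mem_one.1 (h0.le a.2)
        rw [← hc]
        exact K.smul_mem c hx
      · rw [smul_zero]
        exact K.zero_mem

/-- Taking R-spans embeds the k-submodules of a piece, in an order-preserving way, into the
R-submodules of M. -/
theorem isNoetherian_pieceBase (h0 : 𝒜 0 = 1) (M : QGradedModule 𝒜) [IsNoetherian R M.carrier]
    (α : ℚ) : IsNoetherian k (M.pieceBase α) := by
  rw [isNoetherian_iff']
  let F : Submodule k (M.pieceBase α) → Submodule R M.carrier := fun K =>
    Submodule.span R (K.map (M.pieceBase α).subtype : Set M.carrier)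
  have hle : ∀ K : Submodule k (M.pieceBase α), K.map (M.pieceBase α).subtype ≤ M.pieceBase α :=
    fun K => Submodule.map_subtype_le _ _
  have hF : Monotone F := fun K L h => Submodule.span_mono (Submodule.map_mono h)
  refine (hF.strictMono_of_injective fun K L h => ?_).wellFoundedGT
  have key : ∀ K L, F K = F L → K ≤ L := by
    intro K L h x hx
    have h1 : (x : M.carrier) ∈ F L := h ▸ Submodule.subset_span (Submodule.mem_map_of_mem hx)
    have h2 := proj_mem_of_mem_span h0 M (hle L) h1
    rw [M.proj_of_mem x.2] at h2
    obtain ⟨y, hy, hyx⟩ := h2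
    obtain rfl : y = x := Subtype.ext hyx
    exact hy
  exact le_antisymm (key K L h) (key L K h.symm)

/-- Multiplication by elements of the base ring. -/
def baseToEnd (M : QGradedModule 𝒜) : k →+* M.endRing where
  toFun c := ⟨algebraMap k R c • LinearMap.id, fun α x hx => (M.pieceBase α).smul_mem c hx⟩
  map_one' := Subtype.ext (LinearMap.ext fun x => by
    change algebraMap k R 1 • x = x
    rw [map_one, one_smul])
  map_mul' c d := Subtype.ext (LinearMap.ext fun x => by
    change algebraMap k R (c * d) • x = algebraMap k R c • algebraMap k R d • x
    rw [map_mul, mul_smul])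
  map_zero' := Subtype.ext (LinearMap.ext fun x => by
    change algebraMap k R 0 • x = 0
    rw [map_zero, zero_smul])
  map_add' c d := Subtype.ext (LinearMap.ext fun x => by
    change algebraMap k R (c + d) • x = algebraMap k R c • x + algebraMap k R d • x
    rw [map_add, add_smul])

/-- The endomorphism ring of a graded module is an algebra over the base ring. -/
abbrev algebraEndRing (M : QGradedModule 𝒜) : Algebra k M.endRing :=
  M.baseToEnd.toAlgebra' fun c f => Subtype.ext (LinearMap.ext fun x => by
    change algebraMap k R c • f.1 x = f.1 (algebraMap k R c • x)
    rw [map_smul])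

attribute [local instance] algebraEndRing

/-- A degree-zero endomorphism is determined by its values on finitely many homogeneous generators,
and these lie in pieces that are Noetherian over k. -/
theorem finite_endRing [IsNoetherianRing k] (h0 : 𝒜 0 = 1) (M : QGradedModule 𝒜)
    [IsNoetherian R M.carrier] : Module.Finite k M.endRing := by
  have hspan : Submodule.span R {x : M.carrier | ∃ α, x ∈ M.piece α} = ⊤ := by
    rw [eq_top_iff]
    intro x _
    induction x using homogeneous_induction with
    | hzero => exact Submodule.zero_mem _
    | hom α x hx => exact Submodule.subset_span ⟨α, hx⟩
    | hadd x y hx hy => exact Submodule.add_mem _ (hx trivial) (hy trivial)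
  obtain ⟨s, hs, hs'⟩ := Submodule.fg_span_iff_fg_span_finset_subset _ |>.1
    (IsNoetherian.noetherian (Submodule.span R {x : M.carrier | ∃ α, x ∈ M.piece α}))
  rw [hspan] at hs'
  choose deg hdeg using hs
  have hN : ∀ x : s, IsNoetherian k (M.pieceBase (deg x.2)) := fun x =>
    isNoetherian_pieceBase h0 M _
  let ev : M.endRing →ₗ[k] ∀ x : s, M.pieceBase (deg x.2) :=
    { toFun := fun f x => ⟨f.1 x, f.2 _ _ (hdeg x.2)⟩
      map_add' := fun f g => rfl
      map_smul' := fun c f => rfl }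
  have hev : Function.Injective ev := fun f g hfg => by
    refine Subtype.ext (LinearMap.ext_on hs'.symm fun x hx => ?_)
    exact congrArg Subtype.val (congrFun hfg ⟨x, hx⟩)
  have := isNoetherian_of_injective ev hev
  infer_instance

theorem IsIndecomposable.isLocalRing_endRing [IsLocalRing k] [IsNoetherianRing k]
    [IsAdicComplete (IsLocalRing.maximalIdeal k) k] (h0 : 𝒜 0 = 1) {M : QGradedModule 𝒜}
    [IsNoetherian R M.carrier] (hM : M.IsIndecomposable) : IsLocalRing M.endRing := by
  have := finite_endRing h0 M
  rw [isIndecomposable_iff] at hM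
  obtain ⟨hn, hM⟩ := hM
  have : Nontrivial M.endRing := by
    obtain ⟨x, hx⟩ := exists_ne (0 : M.carrier)
    exact ⟨1, 0, fun h => hx (LinearMap.congr_fun (congrArg Subtype.val h) x)⟩
  refine IsLocalRing.of_module_finite_of_idempotents (A := k) fun e he => ?_
  rcases hM e.1 e.2 (congrArg Subtype.val he) with h | h
  · exact Or.inl (Subtype.ext h)
  · exact Or.inr (Subtype.ext h)

end EndLocal

end QGradedModule

/-! ### Retracts and Frobenius push-forward of graded modules -/

theorem Module.Finite.compHom {S R : Type*} [CommRing S] [CommRing R] {φ : S →+* R}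
    (hφ : φ.Finite) (N : Type*) [AddCommGroup N] [Module R N] [Module.Finite R N] :
    @Module.Finite S N _ _ (Module.compHom N φ) := by
  let : Algebra S R := φ.toAlgebra
  let : Module S N := Module.compHom N φ
  have : IsScalarTower S R N := ⟨fun a b c => mul_smul (φ a) b c⟩
  have : Module.Finite S R := hφ
  exact Module.Finite.trans R N

namespace QGradedModule

section Retract

variable {k : Type v} {R : Type u} [CommRing k] [CommRing R] [Algebra k R]
  {𝒜 : ℕ → Submodule k R} {M N P : QGradedModule 𝒜}

variable (M N) in
/-- `M` is a retract of `N` by graded maps of degree zero. -/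
def IsRetract : Prop := ∃ (f : M.carrier →ₗ[R] N.carrier) (g : N.carrier →ₗ[R] M.carrier),
  IsHom f ∧ IsHom g ∧ g ∘ₗ f = LinearMap.id

theorem GIso.isRetract (h : M.GIso N) : M.IsRetract N := by
  obtain ⟨f, g, hf, hg, h1, h2⟩ := h
  exact ⟨f, g, hf, hg, h1⟩

theorem IsRetract.trans (h : M.IsRetract N) (h' : N.IsRetract P) : M.IsRetract P := by
  obtain ⟨f, g, hf, hg, h1⟩ := h
  obtain ⟨f', g', hf', hg', h1'⟩ := h'
  refine ⟨f' ∘ₗ f, g ∘ₗ g', hf'.comp hf, hg.comp hg', ?_⟩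
  rw [LinearMap.comp_assoc, ← LinearMap.comp_assoc f, h1', LinearMap.id_comp, h1]

theorem IsRetract.shift (h : M.IsRetract N) (α : ℚ) : (M.shift α).IsRetract (N.shift α) := by
  obtain ⟨f, g, hf, hg, h1⟩ := h
  exact ⟨f, g, hf.shift α, hg.shift α, h1⟩

theorem IsRetract.finite [Module.Finite R N.carrier] (h : M.IsRetract N) :
    Module.Finite R M.carrier := by
  obtain ⟨f, g, hf, hg, h1⟩ := h
  exact Module.Finite.of_surjective g fun x => ⟨f x, LinearMap.congr_fun h1 x⟩

theorem IsDecomp.isRetract {ι : Type*} [Fintype ι] {A : ι → QGradedModule 𝒜} (h : N.IsDecomp A)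
    (j : ι) : (A j).IsRetract N := by
  obtain ⟨i, q, hi, hq, h1, h2, h3⟩ := h
  exact ⟨i j, q j, hi j, hq j, h1 j⟩

theorem shift_shift_gIso (M : QGradedModule 𝒜) (α β : ℚ) :
    ((M.shift α).shift β).GIso (M.shift (β + α)) :=
  gIso_of_equiv (LinearEquiv.refl R M.carrier) fun γ x => by
    change x ∈ M.piece _ ↔ x ∈ M.piece _
    rw [add_assoc]

theorem shift_zero_gIso (M : QGradedModule 𝒜) : (M.shift 0).GIso M :=
  gIso_of_equiv (LinearEquiv.refl R M.carrier) fun γ x => by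
    change x ∈ M.piece _ ↔ x ∈ M.piece _
    rw [add_zero]

theorem GIso.shift (h : M.GIso N) (α : ℚ) : (M.shift α).GIso (N.shift α) := by
  obtain ⟨f, g, hf, hg, h1, h2⟩ := h
  exact ⟨f, g, hf.shift α, hg.shift α, h1, h2⟩

theorem isHom_linearProjOfIsCompl {A B : Submodule R N.carrier} (hA : N.IsHomogeneous A)
    (hB : N.IsHomogeneous B) (h : IsCompl A B) :
    IsHom (M := N) (N := N.sub A hA) (A.projectionOnto B h) := by
  intro α x hx
  have h1 := Submodule.projection_add_projection_eq_self h x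
  have h2 : N.proj α (A.projectionOnto B h x) + N.proj α (B.projectionOnto A h.symm x) = x := by
    rw [← map_add]
    exact (congrArg (N.proj α) h1).trans (N.proj_of_mem hx)
  have h3 := isHomogeneous_iff.1 hA _ (A.projectionOnto B h x).2 α
  have h4 := isHomogeneous_iff.1 hB _ (B.projectionOnto A h.symm x).2 α
  have h5 := congrArg (fun y => (A.projectionOnto B h y : N.carrier)) h2
  simp only [map_add, Submodule.projectionOnto_apply_of_mem_left h h3,
    Submodule.projectionOnto_apply_of_mem_right h h4, add_zero] at h5
  change (A.projectionOnto B h x : N.carrier) ∈ N.piece α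
  rw [← h5]
  exact N.proj_mem α _

/-- For a retraction g of f, the image of f and the kernel of g are homogeneous complements.
Retracts compose and push forward without mention of submodules. -/
theorem isSummand_iff : M.IsSummand N ↔ ∃ α, (M.shift α).IsRetract N := by
  constructor
  · rintro ⟨A, B, hA, hB, hAB, hM⟩
    obtain ⟨α, hα⟩ := shiftIso_iff.1 hM
    refine ⟨α, hα.isRetract.trans ⟨A.subtype, A.projectionOnto B hAB, isHom_subtype hA,
      isHom_linearProjOfIsCompl hA hB hAB, ?_⟩⟩
    exact LinearMap.ext fun x => Submodule.projectionOnto_apply_left hAB x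
  · rintro ⟨α, f, g, hf, hg, hgf⟩
    have hgf' : ∀ x, g (f x) = x := fun x => LinearMap.congr_fun hgf x
    refine ⟨_, _, hf.isHomogeneous_range, hg.isHomogeneous_ker, ?_, shiftIso_iff.2 ⟨α, ?_⟩⟩
    · refine isCompl_iff.2 ⟨Submodule.disjoint_def.2 ?_, codisjoint_iff.2 (eq_top_iff.2 ?_)⟩
      · rintro _ ⟨x, rfl⟩ hx
        rw [LinearMap.mem_ker, hgf'] at hx
        rw [hx, map_zero]
      · intro x _
        refine Submodule.mem_sup.2 ⟨f (g x), ⟨_, rfl⟩, x - f (g x), ?_, by abel⟩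
        rw [LinearMap.mem_ker, map_sub, hgf', sub_self]
    · refine ⟨f.codRestrict _ fun x => ⟨x, rfl⟩, g ∘ₗ (LinearMap.range f).subtype,
        hf.codRestrict hf.isHomogeneous_range _,
        hg.comp (isHom_subtype hf.isHomogeneous_range), LinearMap.ext hgf', LinearMap.ext ?_⟩
      rintro ⟨_, x, rfl⟩
      refine Subtype.ext ?_
      change f (g (f x)) = f x
      rw [hgf']

end Retract

section Frobenius

variable {p : ℕ} [Fact p.Prime] {k : Type v} {R : Type u} [CommRing k] [CommRing R] [Algebra k R]
  [ExpChar R p] {𝒜 : ℕ → Submodule k R} [GradedAlgebra 𝒜] {M N : QGradedModule 𝒜}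

variable (p) in
/-- The map `ᵉM → ᵉN` attached to a map `M → N`. -/
def frobMap (e : ℕ) (f : M.carrier →ₗ[R] N.carrier) :
    (M.frob p e).carrier →ₗ[R] (N.frob p e).carrier where
  toFun x := f x
  map_add' x y := f.map_add x y
  map_smul' r x := f.map_smul (r ^ p ^ e) x

theorem IsHom.frob {f : M.carrier →ₗ[R] N.carrier} (hf : IsHom f) (e : ℕ) :
    IsHom (M := M.frob p e) (N := N.frob p e) (frobMap p e f) := fun α x hx => hf _ x hx

theorem GIso.frob (h : M.GIso N) (e : ℕ) : (M.frob p e).GIso (N.frob p e) := by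
  obtain ⟨f, g, hf, hg, h1, h2⟩ := h
  exact ⟨_, _, hf.frob e, hg.frob e, LinearMap.ext (LinearMap.congr_fun h1 :),
    LinearMap.ext (LinearMap.congr_fun h2 :)⟩

theorem IsRetract.frob (h : M.IsRetract N) (e : ℕ) : (M.frob p e).IsRetract (N.frob p e) := by
  obtain ⟨f, g, hf, hg, h1⟩ := h
  exact ⟨_, _, hf.frob e, hg.frob e, LinearMap.ext (LinearMap.congr_fun h1 :)⟩

theorem IsDecomp.frob {ι : Type*} [Fintype ι] {A : ι → QGradedModule 𝒜} (h : N.IsDecomp A)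
    (e : ℕ) : (N.frob p e).IsDecomp fun j => (A j).frob p e := by
  obtain ⟨i, q, hi, hq, h1, h2, h3⟩ := h
  refine ⟨fun j => frobMap p e (i j), fun j => frobMap p e (q j), fun j => (hi j).frob e,
    fun j => (hq j).frob e, fun j => LinearMap.ext (LinearMap.congr_fun (h1 j) :),
    fun j l hjl => LinearMap.ext (LinearMap.congr_fun (h2 j l hjl) :), LinearMap.ext fun x => ?_⟩
  have h4 : ∀ y : N.carrier, ∑ j, i j (q j y) = y := fun y => by
    conv_rhs => rw [← LinearMap.id_apply (R := R) y, ← h3, LinearMap.sum_apply]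
    rfl
  exact (LinearMap.sum_apply _ _ _).trans (h4 x)

/-- Push-forward divides shifts by p^e; here rational degrees are needed. -/
theorem frob_shift_gIso (M : QGradedModule 𝒜) (α : ℚ) (e : ℕ) :
    ((M.shift α).frob p e).GIso ((M.frob p e).shift (α / (p : ℚ) ^ e)) :=
  gIso_of_equiv (LinearEquiv.refl R (M.frob p e).carrier) fun β x => by
    have hp : (p : ℚ) ^ e ≠ 0 := pow_ne_zero e (Nat.cast_ne_zero.2 (Fact.out : p.Prime).ne_zero)
    change x ∈ M.piece ((p : ℚ) ^ e * β + α) ↔ x ∈ M.piece ((p : ℚ) ^ e * (β + α / (p : ℚ) ^ e))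
    rw [mul_add, mul_div_cancel₀ _ hp]

theorem frob_frob_gIso (M : QGradedModule 𝒜) (e e' : ℕ) :
    ((M.frob p e).frob p e').GIso (M.frob p (e + e')) :=
  gIso_of_equiv
    { toFun := fun x => x
      invFun := fun x => x
      map_add' := fun _ _ => rfl
      map_smul' := fun r (x : M.carrier) => by
        change (r ^ p ^ e') ^ p ^ e • x = r ^ p ^ (e + e') • x
        rw [← pow_mul, ← pow_add, add_comm]
      left_inv := fun _ => rfl
      right_inv := fun _ => rfl } fun β (x : M.carrier) => by
    change x ∈ M.piece ((p : ℚ) ^ e * ((p : ℚ) ^ e' * β)) ↔ x ∈ M.piece ((p : ℚ) ^ (e + e') * β)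
    rw [pow_add, mul_assoc]

theorem frob_zero_gIso (M : QGradedModule 𝒜) : (M.frob p 0).GIso M :=
  gIso_of_equiv
    { toFun := fun x => x
      invFun := fun x => x
      map_add' := fun _ _ => rfl
      map_smul' := fun r (x : M.carrier) => by
        change r ^ p ^ 0 • x = r • x
        rw [pow_zero, pow_one]
      left_inv := fun _ => rfl
      right_inv := fun _ => rfl } fun β (x : M.carrier) => by
    change x ∈ M.piece ((p : ℚ) ^ 0 * β) ↔ x ∈ M.piece β
    rw [pow_zero, one_mul]

theorem ShiftIso.frob (h : M.ShiftIso N) (e : ℕ) : (M.frob p e).ShiftIso (N.frob p e) := by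
  obtain ⟨α, hα⟩ := shiftIso_iff.1 h
  exact shiftIso_iff.2 ⟨_, (frob_shift_gIso M α e).symm.trans (hα.frob e)⟩

theorem finite_frob (hR : (frobenius R p).Finite) (M : QGradedModule 𝒜)
    [Module.Finite R M.carrier] (e : ℕ) : Module.Finite R (M.frob p e).carrier := by
  induction e with
  | zero => exact M.frob_zero_gIso.isRetract.finite
  | succ e ih =>
    have : Module.Finite R ((M.frob p e).frob p 1).carrier :=
      Module.Finite.compHom (N := (M.frob p e).carrier)
        (by rwa [iterateFrobenius_one] : (iterateFrobenius R p 1).Finite)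
    exact (frob_frob_gIso M e 1).symm.isRetract.finite

end Frobenius

end QGradedModule

/-! ### The multiplicity matrices -/

namespace QGradedModule

section IsSumOf

variable {k : Type v} {R : Type u} [CommRing k] [CommRing R] [Algebra k R]
  {𝒜 : ℕ → Submodule k R} {n : ℕ} {M : Fin n → QGradedModule 𝒜} {N P : QGradedModule 𝒜}

/-- `N` is the direct sum of modules isomorphic to the `M (σ l)` up to shifts. -/
def IsSumOf {ι : Type} [Fintype ι] (M : Fin n → QGradedModule 𝒜) (N : QGradedModule 𝒜)
    (σ : ι → Fin n) : Prop :=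
  ∃ A : ι → QGradedModule 𝒜, N.IsDecomp A ∧ ∀ l, (M (σ l)).ShiftIso (A l)

variable {ι κ : Type} [Fintype ι] [Fintype κ] {σ : ι → Fin n}

theorem IsSumOf.shiftIso (h : N.IsSumOf M σ) (h' : N.ShiftIso P) : P.IsSumOf M σ := by
  obtain ⟨A, hA, hσ⟩ := h
  obtain ⟨α, hα⟩ := shiftIso_iff.1 h'
  exact ⟨_, (hA.shift α).of_gIso hα, fun l => (hσ l).trans (shiftIso_shift α)⟩

theorem isSumOf_unit (j : Fin n) : (M j).IsSumOf M fun _ : Unit => j :=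
  ⟨_, isDecomp_unit _, fun _ => ShiftIso.refl _⟩

theorem IsSumOf.sigma {ρ : ι → Type} [∀ l, Fintype (ρ l)] {A : ι → QGradedModule 𝒜}
    {τ : ∀ l, ρ l → Fin n} (h : N.IsDecomp A) (hA : ∀ l, (A l).IsSumOf M (τ l)) :
    N.IsSumOf M fun x : Σ l, ρ l => τ x.1 x.2 := by
  choose B hB hτ using hA
  exact ⟨_, h.sigma hB, fun x => hτ _ _⟩

/-- The given decomposition realises the count, and Krull–Schmidt shows that every other one gives
the same. -/
theorem IsSumOf.hasMultiplicity_iff (h : N.IsSumOf M σ) (hi : ∀ i, (M i).IsIndecomposable)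
    (hl : ∀ (N : QGradedModule 𝒜), N.IsIndecomposable → N.IsRetract P → IsLocalRing N.endRing)
    (hP : N.IsRetract P)
    (hM : ∀ i j, (M i).ShiftIso (M j) → i = j) (i : Fin n) {a : ℕ} :
    (M i).HasMultiplicity N a ↔ a = Nat.card {l // σ l = i} := by
  obtain ⟨A, hA, hσ⟩ := h
  have hcard : Nat.card {l // σ l = i} = Nat.card {l // (M i).ShiftIso (A l)} := by
    refine Nat.card_congr (Equiv.subtypeEquivRight fun l => ⟨?_, fun h => ?_⟩)
    · rintro rfl
      exact hσ l
    · exact hM _ _ ((hσ l).trans h.symm)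
  have hAi : ∀ l, (A l).IsIndecomposable := fun l => (hσ l).isIndecomposable (hi _)
  rw [hcard, QGradedModule.hasMultiplicity_iff]
  constructor
  · rintro ⟨r, B, hB, hBi, rfl⟩
    exact hB.card_shiftIso_eq hA hBi hAi (fun l => hl _ (hBi l) ((hB.isRetract l).trans hP))
      (fun l => hl _ (hAi l) ((hA.isRetract l).trans hP)) _
  · rintro rfl
    refine ⟨Fintype.card ι, _, hA.reindex (Fintype.equivFin ι).symm, fun j => hAi _, ?_⟩
    exact Nat.card_congr ((Fintype.equivFin ι).symm.subtypeEquiv fun _ => Iff.rfl)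

end IsSumOf

/-- Counting summands of an iterated decomposition is matrix multiplication. -/
theorem card_sigma_fiber {n : ℕ} {ι : Type} [Fintype ι] {ρ : Fin n → Type} [∀ l, Fintype (ρ l)]
    (σ : ι → Fin n) (τ : ∀ j, ρ j → Fin n) (i : Fin n) :
    Nat.card {x : Σ l, ρ (σ l) // τ (σ x.1) x.2 = i} =
      ∑ j, Nat.card {y // τ j y = i} * Nat.card {l // σ l = j} := by
  classical
  simp only [Nat.card_eq_fintype_card, Fintype.card_subtype, Finset.card_filter,
    Fintype.sum_sigma, Finset.mul_sum]
  rw [Finset.sum_comm]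
  exact Finset.sum_congr rfl fun l _ => by simp

section Multiplicity

variable {p : ℕ} [Fact p.Prime] {k : Type v} {R : Type u} [CommRing k] [IsLocalRing k]
  [IsNoetherianRing k] [IsAdicComplete (IsLocalRing.maximalIdeal k) k] [CommRing R] [Algebra k R]
  [IsNoetherianRing R] [ExpChar R p] {𝒜 : ℕ → Submodule k R} [GradedAlgebra 𝒜] {n : ℕ}
  {M : Fin n → QGradedModule 𝒜}

theorem finite_frob_self (hR : (frobenius R p).Finite) (e : ℕ) :
    Module.Finite R ((self 𝒜).frob p e).carrier := by
  have : Module.Finite R (self 𝒜).carrier := Module.Finite.self R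
  exact finite_frob hR _ e

theorem finite_of_isSummand_frob_self (hR : (frobenius R p).Finite) {N : QGradedModule 𝒜} {e : ℕ}
    (h : N.IsSummand ((self 𝒜).frob p e)) : Module.Finite R N.carrier := by
  obtain ⟨α, h⟩ := isSummand_iff.1 h
  have := finite_frob_self (𝒜 := 𝒜) hR e
  exact (h.finite : Module.Finite R (N.shift α).carrier)

theorem isLocalRing_endRing_of_isRetract (h0 : 𝒜 0 = 1) {N P : QGradedModule 𝒜}
    [Module.Finite R P.carrier] (hN : N.IsIndecomposable) (h : N.IsRetract P) :
    IsLocalRing N.endRing := by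
  have := h.finite
  exact hN.isLocalRing_endRing h0

/-- The list is closed under Frobenius push-forward: if M j is a summand of the e'-th push-forward
of R, an indecomposable summand of ᵉ(M j) is one of the (e'+e)-th. -/
theorem exists_isSumOf_frob (hM : IsGradedSummandList p 𝒜 M) (hR : (frobenius R p).Finite)
    (e : ℕ) (j : Fin n) : ∃ (r : ℕ) (σ : Fin r → Fin n), ((M j).frob p e).IsSumOf M σ := by
  obtain ⟨e', hj⟩ := hM.summand j
  have := finite_of_isSummand_frob_self hR hj
  have := finite_frob hR (M j) e
  obtain ⟨r, A, hA, hind⟩ := (hasDecomp_of_isNoetherian ((M j).frob p e)).exists_fin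
  obtain ⟨α, hα⟩ := isSummand_iff.1 hj
  have h1 : ∀ l, (A l).IsSummand ((self 𝒜).frob p (e' + e)) := fun l =>
    isSummand_iff.2 ⟨_, ((hA.isRetract l).shift _).trans
      ((frob_shift_gIso (M j) α e).symm.isRetract.trans
        ((hα.frob e).trans (frob_frob_gIso _ e' e).isRetract))⟩
  choose σ hσ using fun l => hM.complete _ _ (hind l) (h1 l)
  exact ⟨r, σ, A, hA, fun l => (hσ l).symm⟩

/-- The multiplicities of the `M i` in the modules `ᵉ(M j)` are well defined and multiplicative
in `e`. -/
theorem exists_multiplicity_matrix (h0 : 𝒜 0 = 1) (hM : IsGradedSummandList p 𝒜 M)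
    (hR : (frobenius R p).Finite) :
    ∃ m : ℕ → Matrix (Fin n) (Fin n) ℕ,
      (∀ e i j a, (M i).HasMultiplicity ((M j).frob p e) a ↔ a = m e i j) ∧
      (∀ e, m e = m 1 ^ e) ∧
      (∀ e i j α, ((M i).shift α).IsRetract ((M j).frob p e) → 0 < m e i j) ∧
      ∀ e j, ∃ (r : ℕ) (σ : Fin r → Fin n), ((M j).frob p e).IsSumOf M σ ∧
        ∀ i, m e i j = Nat.card {l // σ l = i} := by
  choose r σ hσ using exists_isSumOf_frob hM hR
  have hfin : ∀ j, Module.Finite R (M j).carrier := fun j =>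
    finite_of_isSummand_frob_self hR (hM.summand j).choose_spec
  have hmult : ∀ (N : QGradedModule 𝒜) [Module.Finite R N.carrier] {ι : Type} [Fintype ι]
      {σ : ι → Fin n}, N.IsSumOf M σ → ∀ i a,
      (M i).HasMultiplicity N a ↔ a = Nat.card {l // σ l = i} := fun N _ ι _ σ h i a =>
    h.hasMultiplicity_iff hM.indecomposable
      (fun X hX hXN => isLocalRing_endRing_of_isRetract (P := N) h0 hX hXN)
      (GIso.refl N).isRetract hM.not_iso i
  have hff : ∀ j e, Module.Finite R ((M j).frob p e).carrier := fun j e => finite_frob hR _ e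
  let m : ℕ → Matrix (Fin n) (Fin n) ℕ := fun e => Matrix.of fun i j =>
    Nat.card {l // σ e j l = i}
  have hm : ∀ e i j a, (M i).HasMultiplicity ((M j).frob p e) a ↔ a = m e i j :=
    fun e i j a => hmult _ (hσ e j) i a
  have huniq : ∀ e j {ι : Type} [Fintype ι] {τ : ι → Fin n}, ((M j).frob p e).IsSumOf M τ →
      ∀ i, m e i j = Nat.card {l // τ l = i} := fun e j ι _ τ h i =>
    (hmult _ h i _).1 ((hm e i j _).2 rfl)
  refine ⟨m, hm, fun e => ?_, fun e i j α h => ?_, fun e j => ⟨_, _, hσ e j, fun i => rfl⟩⟩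
  · induction e with
    | zero =>
      ext i j
      rw [huniq 0 j ((isSumOf_unit j).shiftIso (frob_zero_gIso (M j)).symm.shiftIso), pow_zero,
        Matrix.one_apply]
      split_ifs with h
      · subst h
        simp
      · have : IsEmpty {l : Unit // j = i} := ⟨fun x => h x.2.symm⟩
        exact Nat.card_of_isEmpty
    | succ e ih =>
      rw [pow_succ', ← ih]
      ext i j
      obtain ⟨A, hA, hAσ⟩ := hσ e j
      -- Decompose ᵉ(M j), push each summand forward once more and decompose it by the e = 1 data;
      -- shifts are ignored by the count.
      have h1 := IsSumOf.sigma (hA.frob (p := p) 1) (τ := fun l => σ 1 (σ e j l)) fun l =>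
        (hσ 1 (σ e j l)).shiftIso ((hAσ l).frob 1)
      rw [huniq (e + 1) j (h1.shiftIso (frob_frob_gIso _ e 1).shiftIso), Matrix.mul_apply]
      exact card_sigma_fiber (σ e j) (σ 1) i
  · obtain ⟨A, hA, hAσ⟩ := hσ e j
    have hi := (shiftIso_shift (M := M i) α).isIndecomposable (hM.indecomposable i)
    have := isLocalRing_endRing_of_isRetract h0 hi h
    obtain ⟨f, g, hf, hg, hgf⟩ := h
    obtain ⟨l, hl⟩ := hA.exists_gIso_of_retract
      (fun l => (hAσ l).isIndecomposable (hM.indecomposable _)) hf hg hgf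
    refine Nat.card_pos_iff.2 ⟨⟨l, hM.not_iso _ _ ((hAσ l).trans ?_)⟩, inferInstance⟩
    exact hl.symm.shiftIso.trans (shiftIso_shift α).symm

end Multiplicity

end QGradedModule

/-! ### Lengths of fibres -/

section Fibre

variable {R : Type*} [CommRing R] (m : Ideal R)

/-- The length of `N / m N`. -/
noncomputable def fibreLength (N : Type*) [AddCommGroup N] [Module R N] : ℕ∞ :=
  Module.length R (N ⧸ (m • ⊤ : Submodule R N))

/-- The map `N / m N → N' / m N'` induced by a linear map. -/
def fibreMap {N N' : Type*} [AddCommGroup N] [Module R N] [AddCommGroup N'] [Module R N']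
    (f : N →ₗ[R] N') :
    (N ⧸ (m • ⊤ : Submodule R N)) →ₗ[R] N' ⧸ (m • ⊤ : Submodule R N') :=
  Submodule.mapQ _ _ f (Submodule.map_le_iff_le_comap.1 (by
    rw [Submodule.map_smul'']
    exact Submodule.smul_mono le_rfl le_top))

theorem fibreLength_congr {N N' : Type*} [AddCommGroup N] [Module R N] [AddCommGroup N']
    [Module R N'] (f : N ≃ₗ[R] N') : fibreLength m N = fibreLength m N' :=
  LinearEquiv.length_eq (Submodule.Quotient.equiv _ _ f (by
    rw [Submodule.map_smul'', Submodule.map_top, LinearEquiv.range]))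

/-- N/mN is a finite-dimensional vector space over R/m. -/
theorem fibreLength_ne_top {m : Ideal R} [hm : m.IsMaximal] (N : Type*) [AddCommGroup N]
    [Module R N] [Module.Finite R N] : fibreLength m N ≠ ⊤ := by
  let := Ideal.Quotient.field m
  have : Module.Finite (R ⧸ m) (N ⧸ (m • ⊤ : Submodule R N)) :=
    Module.Finite.of_restrictScalars_finite R _ _
  have h : Module.length R (N ⧸ (m • ⊤ : Submodule R N)) =
      Module.length (R ⧸ m) (N ⧸ (m • ⊤ : Submodule R N)) :=
    Module.length_eq_of_surjective Ideal.Quotient.mk_surjective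
  rw [fibreLength, h]
  exact Module.length_ne_top

theorem fibreLength_pos {m : Ideal R} {N : Type*} [AddCommGroup N] [Module R N]
    (h : (m • ⊤ : Submodule R N) ≠ ⊤) : 0 < fibreLength m N := by
  have := Submodule.Quotient.nontrivial_iff.2 h
  exact Module.length_pos

theorem QGradedModule.IsDecomp.fibreLength_eq_sum {k : Type*} [CommRing k] [Algebra k R]
    {𝒜 : ℕ → Submodule k R} {ι : Type*} [Fintype ι] {N : QGradedModule 𝒜}
    {A : ι → QGradedModule 𝒜} (h : N.IsDecomp A) :
    fibreLength m N.carrier = ∑ l, fibreLength m (A l).carrier := by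
  classical
  obtain ⟨i, q, -, -, h1, h2, h3⟩ := h
  let e : (N.carrier ⧸ (m • ⊤ : Submodule R N.carrier)) ≃ₗ[R]
      ∀ l, (A l).carrier ⧸ (m • ⊤ : Submodule R (A l).carrier) :=
    LinearEquiv.ofLinear (LinearMap.pi fun l => fibreMap m (q l))
      (∑ l, fibreMap m (i l) ∘ₗ LinearMap.proj l)
      (by
        refine LinearMap.ext fun y => funext fun j => ?_
        choose x hx using fun l => Submodule.mkQ_surjective _ (y l)
        have h4 : ∀ l, fibreMap m (q j) (fibreMap m (i l) (y l)) =
            if l = j then y j else 0 := by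
          intro l
          rw [← hx l]
          change Submodule.mkQ _ ((q j ∘ₗ i l) (x l)) = _
          split_ifs with hl
          · subst hl
            rw [h1, ← hx]
            rfl
          · rw [h2 _ _ (Ne.symm hl), LinearMap.zero_apply, map_zero]
        simp [h4])
      (by
        refine LinearMap.ext fun y => ?_
        obtain ⟨x, rfl⟩ := Submodule.mkQ_surjective _ y
        simp only [LinearMap.comp_apply, LinearMap.sum_apply, LinearMap.proj_apply,
          LinearMap.pi_apply, LinearMap.id_apply]
        change ∑ l, Submodule.mkQ _ (i l (q l x)) = _
        rw [← map_sum]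
        congr 1
        have := LinearMap.congr_fun h3 x
        rwa [LinearMap.sum_apply] at this)
  exact e.length_eq.trans (Module.length_pi_of_fintype _ _)

/-- For φ the e-th Frobenius, the fibre of ᵉR is R modulo the Frobenius power of I, with length
taken through φ. -/
theorem fibreLength_compHom {S : Type*} [CommRing S] (φ : S →+* R) (I : Ideal S) :
    @fibreLength S _ I R _ (Module.compHom R φ) = lengthAlong φ (R ⧸ I.map φ) := by
  let : Module S R := Module.compHom R φ
  let : Module S (R ⧸ I.map φ) := Module.compHom _ φ
  let f : R →ₗ[S] R ⧸ I.map φ :=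
    { Ideal.Quotient.mk (I.map φ) with
      map_smul' := fun r x => rfl }
  have hker : LinearMap.ker f = (I • ⊤ : Submodule S R) := by
    apply le_antisymm
    · suffices h : ∀ x ∈ I.map φ, x ∈ (I • ⊤ : Submodule S R) from
        fun x hx => h x (Ideal.Quotient.eq_zero_iff_mem.1 hx)
      intro x hx
      induction hx using Submodule.closure_induction with
      | zero => exact Submodule.zero_mem _
      | add x y _ _ hx hy => exact Submodule.add_mem _ hx hy
      | smul_mem a x hx =>
        obtain ⟨r, hr, rfl⟩ := hx
        have h1 : a • φ r = r • a := mul_comm _ _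
        rw [h1]
        exact Submodule.smul_mem_smul hr trivial
    · refine Submodule.smul_le.2 fun r hr x _ => Ideal.Quotient.eq_zero_iff_mem.2 ?_
      exact Ideal.mul_mem_right _ _ (Ideal.mem_map_of_mem φ hr)
  have hsurj : Function.Surjective f := Ideal.Quotient.mk_surjective
  change Module.length S (R ⧸ (I • ⊤ : Submodule S R)) = Module.length S (R ⧸ I.map φ)
  exact ((Submodule.quotEquivOfEq _ _ hker.symm).trans
    (f.quotKerEquivOfSurjective hsurj)).length_eq

end Fibre

/-! ### Lengths along iterated Frobenius -/

section FrobeniusLength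

variable {p : ℕ} {R : Type*} [CommRing R] [ExpChar R p]

/-- One Frobenius turns the residue field into a module of length [κ : κ^p] that is still killed by
the maximal ideal, so lengths multiply at each iteration. -/
theorem lengthAlong_iterateFrobenius {κ : Type*} [Field κ] [ExpChar κ p]
    (hfin : (frobenius κ p).Finite) (π : R →+* κ) (hπ : Function.Surjective π) (e : ℕ) :
    lengthAlong (iterateFrobenius R p e) (R ⧸ RingHom.ker π) = (frobeniusDegree p κ : ℕ∞) ^ e := by
  have hm := RingHom.ker_isMaximal_of_surjective π hπ
  induction e with
  | zero =>
    have := hm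
    rw [pow_zero, iterateFrobenius_zero]
    change Module.length R (R ⧸ RingHom.ker π) = 1
    exact Module.length_eq_one_iff.2 (isSimpleModule_iff_quot_maximal.2 ⟨_, hm, ⟨LinearEquiv.refl _ _⟩⟩)
  | succ e ih =>
    have h1 : lengthAlong (frobenius R p) (R ⧸ RingHom.ker π) = frobeniusDegree p κ := by
      rw [lengthAlong_quotient_ker _ π hπ, lengthAlong_frobenius_field hfin π hπ]
    have h2 : iterateFrobenius R p (e + 1) = (frobenius R p).comp (iterateFrobenius R p e) := by
      ext r
      simp [iterateFrobenius_def, frobenius_def, ← pow_mul, pow_succ]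
    have h3 := @lengthAlong_eq_mul _ _ _ _ (iterateFrobenius R p e) (R ⧸ RingHom.ker π) _
      (Module.compHom (R ⧸ RingHom.ker π) (frobenius R p)) _ hm 1
      ((@Module.length_ne_top_iff _ _ _ _ (_)).1 (h1.trans_ne (ENat.natCast_ne_top _)))
      fun r hr x => by
        obtain ⟨x, rfl⟩ := Ideal.Quotient.mk_surjective x
        refine Ideal.Quotient.eq_zero_iff_mem.2 (Ideal.mul_mem_right _ _ ?_)
        rw [pow_one] at hr
        exact Ideal.pow_mem_of_mem _ hr _ (expChar_pos R p)
    rw [h2, pow_succ, ← ih, ← h1]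
    exact h3

theorem lengthAlong_quotient_map_iterateFrobenius [IsNoetherianRing R] {κ : Type*} [Field κ]
    [ExpChar κ p] (hfin : (frobenius κ p).Finite) (π : R →+* κ) (hπ : Function.Surjective π)
    (e : ℕ) : lengthAlong (iterateFrobenius R p e)
      (R ⧸ (RingHom.ker π).map (iterateFrobenius R p e)) =
      (frobeniusDegree p κ : ℕ∞) ^ e *
        Module.length R (R ⧸ (RingHom.ker π).map (iterateFrobenius R p e)) := by
  have hm := RingHom.ker_isMaximal_of_surjective π hπ
  obtain ⟨s, hs⟩ := exists_pow_le_map_iterateFrobenius p (RingHom.ker π) e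
  rw [lengthAlong_eq_mul _ hm s (isFiniteLength_quotient_pow hm hs),
    lengthAlong_iterateFrobenius hfin π hπ]
  intro r hr x
  obtain ⟨x, rfl⟩ := Ideal.Quotient.mk_surjective x
  exact Ideal.Quotient.eq_zero_iff_mem.2 (Ideal.mul_mem_right _ _ (hs hr))

end FrobeniusLength

/-! ### Strongly F-regular rings -/

section StronglyFRegular

variable {R : Type u} [CommRing R] (p : ℕ) [Fact p.Prime] [CharP R p]

/-- There is an `R`-linear map `ᵉR → R` with `c ↦ 1`. -/
def FrobeniusSplits (e : ℕ) (c : R) : Prop :=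
  ∃ φ : R →+ R, (∀ r x, φ (r ^ p ^ e * x) = r * φ x) ∧ φ c = 1

variable {p}

theorem IsStronglyFRegular.exists_frobeniusSplits (h : IsStronglyFRegular p R) {c : R}
    (hc : ∀ P ∈ minimalPrimes R, c ∉ P) : ∃ e, FrobeniusSplits p e c := by
  obtain ⟨e, φ, hφ⟩ := h.splits c hc
  refine ⟨e, ⟨⟨fun x => φ x, φ.map_zero⟩, φ.map_add⟩, fun r x => φ.map_smul r x, ?_⟩
  have h1 := LinearMap.congr_fun hφ 1
  rw [LinearMap.comp_apply, LinearMap.toSpanSingleton_apply, one_smul] at h1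
  exact h1

/-- Choose a outside P but in all other minimal primes, and b in P but in none of the others. Then
ab = 0 and a + b is a nonzerodivisor outside all minimal primes. If φ splits it, then bφ(a) = aφ(b)
= 0, so φ(a)φ(b) = 0 while φ(a) + φ(b) = 1. Thus φ(a) is idempotent; the value 0 would give a = 0,
and the value 1 gives b = 0, so P is the only minimal prime and P = 0. -/
theorem IsStronglyFRegular.isDomain [IsNoetherianRing R] [Nontrivial R]
    (h : IsStronglyFRegular p R) (hid : ∀ e : R, e * e = e → e = 0 ∨ e = 1) : IsDomain R := by
  have := h.isReduced
  have hred : sInf (minimalPrimes R) = ⊥ := by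
    rw [minimalPrimes, Ideal.sInf_minimalPrimes]
    exact nilradical_eq_zero R
  have hfin : (minimalPrimes R).Finite := minimalPrimes.finite_of_isNoetherianRing R
  obtain ⟨P, hP⟩ : (minimalPrimes R).Nonempty :=
    Set.nonempty_coe_sort.1 (Ideal.nonempty_minimalPrimes bot_ne_top)
  have hPp : P.IsPrime := hP.isPrime
  let s : Finset (Ideal R) := hfin.toFinset.erase P
  have hs : ∀ Q ∈ s, Q ∈ minimalPrimes R ∧ Q ≠ P := fun Q hQ => by
    rw [Finset.mem_erase, hfin.mem_toFinset] at hQ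
    exact ⟨hQ.2, hQ.1⟩
  have hmin : ∀ Q ∈ minimalPrimes R, ∀ Q' ∈ minimalPrimes R, Q ≤ Q' → Q = Q' :=
    fun Q hQ Q' hQ' hle => le_antisymm hle (hQ'.2 hQ.1 hle)
  obtain ⟨a, ha, haP⟩ : ∃ a ∈ s.inf id, a ∉ P := by
    by_contra! hcon
    obtain ⟨Q, hQ, hle⟩ := (hPp.inf_le').1 (show s.inf id ≤ P from hcon)
    exact (hs Q hQ).2 (hmin _ (hs Q hQ).1 _ hP hle)
  obtain ⟨b, hb, hbs⟩ : ∃ b ∈ P, ∀ Q ∈ s, b ∉ Q := by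
    by_contra! hcon
    have h1 : (P : Set R) ⊆ ⋃ Q ∈ (s : Set (Ideal R)), (Q : Set R) := fun b hb => by
      obtain ⟨Q, hQ, hbQ⟩ := hcon b hb
      exact Set.mem_biUnion hQ hbQ
    obtain ⟨Q, hQ, hle⟩ := (Ideal.subset_union_prime ⊥ ⊥
      fun Q hQ _ _ => (hs Q hQ).1.isPrime).1 h1
    exact (hs Q hQ).2 (hmin _ hP _ (hs Q hQ).1 hle).symm
  have has : ∀ Q ∈ s, a ∈ Q := fun Q hQ => (Finset.inf_le hQ : s.inf id ≤ Q) ha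
  have hmem : ∀ Q ∈ minimalPrimes R, Q = P ∨ Q ∈ s := fun Q hQ => by
    by_cases hQP : Q = P
    · exact Or.inl hQP
    · exact Or.inr (Finset.mem_erase.2 ⟨hQP, hfin.mem_toFinset.2 hQ⟩)
  have hab : a * b = 0 := by
    rw [← Ideal.mem_bot, ← hred, Ideal.mem_sInf]
    intro Q hQ
    rcases hmem Q hQ with rfl | hQ'
    · exact Ideal.mul_mem_left _ _ hb
    · exact Ideal.mul_mem_right _ _ (has Q hQ')
  have hc : ∀ Q ∈ minimalPrimes R, a + b ∉ Q := by
    intro Q hQ hcQ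
    rcases hmem Q hQ with rfl | hQ'
    · exact haP ((Ideal.add_mem_iff_left _ hb).1 hcQ)
    · exact hbs Q hQ' ((Ideal.add_mem_iff_right _ (has Q hQ')).1 hcQ)
  have hc0 : ∀ x, (a + b) * x = 0 → x = 0 := by
    intro x hx
    rw [← Ideal.mem_bot, ← hred, Ideal.mem_sInf]
    intro Q hQ
    exact (hQ.isPrime.mem_or_mem (show (a + b) * x ∈ Q by rw [hx]; exact Q.zero_mem)).resolve_left
      (hc Q hQ)
  obtain ⟨e, φ, hφ, h1⟩ := h.exists_frobeniusSplits hc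
  have hpe : p ^ e ≠ 0 := pow_ne_zero e (Fact.out : p.Prime).ne_zero
  have hbu : b * φ a = 0 := by
    rw [← hφ, ← Nat.succ_pred_eq_of_ne_zero hpe, pow_succ, mul_assoc, mul_comm b a, hab, mul_zero,
      map_zero]
  have hav : a * φ b = 0 := by
    rw [← hφ, ← Nat.succ_pred_eq_of_ne_zero hpe, pow_succ, mul_assoc, hab, mul_zero, map_zero]
  rw [map_add] at h1
  have huv : φ a * φ b = 0 := hc0 _ (by
    linear_combination (φ b) * hbu + (φ a) * hav)
  rcases hid (φ a) (by linear_combination (φ a) * h1 - huv) with h2 | h2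
  · rw [h2, zero_add] at h1
    rw [h1, mul_one] at hav
    exact (haP (hav ▸ P.zero_mem)).elim
  · rw [h2, mul_one] at hbu
    have hP0 : P = ⊥ := by
      rw [← hred]
      refine le_antisymm (le_sInf fun Q hQ => ?_) (sInf_le hP)
      rcases hmem Q hQ with rfl | hQ'
      · exact le_rfl
      · exact (hbs Q hQ' (hbu ▸ Q.zero_mem)).elim
    rw [hP0] at hPp
    exact IsDomain.of_bot_isPrime R

theorem IsStronglyFRegular.exists_frobeniusSplits_of_ne_zero [IsDomain R]
    (h : IsStronglyFRegular p R) {c : R} (hc : c ≠ 0) : ∃ e, FrobeniusSplits p e c := by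
  refine h.exists_frobeniusSplits fun P hP hcP => hc ?_
  rw [IsDomain.minimalPrimes_eq_singleton_bot, Set.mem_singleton_iff] at hP
  rwa [hP, Ideal.mem_bot] at hcP

/-- The definition permits e = 0, so c = 1 need not give a Frobenius splitting. A nonzero non-unit c
rules out e = 0, and x ↦ φ(c x^(p^e)) then descends from level e + 1 to level 1. A field has no such
c, but there every injection splits. -/
theorem IsStronglyFRegular.frobeniusSplits_one [IsDomain R] (h : IsStronglyFRegular p R) :
    FrobeniusSplits p 1 (1 : R) := by
  by_cases hF : IsField R
  · let := hF.toField
    let f : R →ₗ[R] FrobeniusModule p 1 R :=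
      LinearMap.toSpanSingleton R (FrobeniusModule p 1 R) (FrobeniusModule.of p 1 1)
    have hf : LinearMap.ker f = ⊥ := by
      rw [LinearMap.ker_eq_bot']
      intro r hr
      have hr' : r ^ p ^ 1 * 1 = 0 := hr
      rw [mul_one] at hr'
      exact pow_eq_zero_iff (pow_ne_zero 1 (Fact.out : p.Prime).ne_zero) |>.1 hr'
    obtain ⟨g, hg⟩ := LinearMap.exists_leftInverse_of_injective f hf
    refine ⟨⟨⟨fun x => g x, g.map_zero⟩, g.map_add⟩, fun r x => g.map_smul r x, ?_⟩
    have h1 := LinearMap.congr_fun hg 1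
    rw [LinearMap.comp_apply, LinearMap.toSpanSingleton_apply, one_smul] at h1
    exact h1
  · obtain ⟨c, hc0, hc⟩ := Ring.exists_not_isUnit_of_not_isField hF
    obtain ⟨e, φ, hφ, h1⟩ := h.exists_frobeniusSplits_of_ne_zero hc0
    cases e with
    | zero =>
      refine (hc (IsUnit.of_mul_eq_one (φ 1) ?_)).elim
      rw [← hφ, pow_zero, pow_one, mul_one, h1]
    | succ e =>
      refine ⟨φ.comp ((AddMonoidHom.mulLeft c).comp (iterateFrobenius R p e).toAddMonoidHom),
        fun r x => ?_, ?_⟩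
      · simp only [AddMonoidHom.comp_apply, AddMonoidHom.coe_mulLeft,
          RingHom.toAddMonoidHom_eq_coe, AddMonoidHom.coe_coe, iterateFrobenius_def]
        rw [mul_pow, ← pow_mul, ← pow_add, add_comm 1 e, mul_left_comm, hφ]
      · simpa using h1

theorem FrobeniusSplits.one_iterate (h : FrobeniusSplits p 1 (1 : R)) (s : ℕ) :
    FrobeniusSplits p s (1 : R) := by
  obtain ⟨ψ, hψ, h1⟩ := h
  induction s with
  | zero => exact ⟨AddMonoidHom.id R, fun r x => by simp, rfl⟩
  | succ s ih =>
    obtain ⟨φ, hφ, h2⟩ := ih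
    refine ⟨φ.comp ψ, fun r x => ?_, ?_⟩
    · rw [AddMonoidHom.comp_apply, pow_succ, pow_mul]
      rw [pow_one] at hψ
      rw [hψ, hφ, AddMonoidHom.comp_apply]
    · rw [AddMonoidHom.comp_apply, h1, h2]

/-- Premultiplying by c^(p^s - 1) turns c into c^(p^s), which a splitting ψ of the s-th Frobenius
sends back to c. -/
theorem FrobeniusSplits.add {e : ℕ} {c : R} (h : FrobeniusSplits p e c)
    (h1 : FrobeniusSplits p 1 (1 : R)) (s : ℕ) : FrobeniusSplits p (e + s) c := by
  obtain ⟨φ, hφ, hc⟩ := h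
  obtain ⟨ψ, hψ, h1⟩ := h1.one_iterate s
  refine ⟨φ.comp (ψ.comp (AddMonoidHom.mulLeft (c ^ (p ^ s - 1)))), fun r x => ?_, ?_⟩
  · simp only [AddMonoidHom.comp_apply, AddMonoidHom.coe_mulLeft]
    rw [pow_add, pow_mul, mul_left_comm, hψ, hφ]
  · simp only [AddMonoidHom.comp_apply, AddMonoidHom.coe_mulLeft]
    rw [← pow_succ, Nat.sub_add_cancel (Nat.one_le_pow _ _ (Fact.out : p.Prime).pos),
      ← mul_one (c ^ _), hψ, h1, mul_one, hc]

end StronglyFRegular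

/-! ### Idempotents of graded rings -/

section GradedIdempotents

variable {k : Type v} {R : Type u} [CommRing k] [IsLocalRing k] [CommRing R] [Algebra k R]
  {𝒜 : ℕ → Submodule k R} [GradedAlgebra 𝒜]

/-- A graded ring whose degree zero part is the image of a local ring has only trivial
idempotents. -/
theorem eq_zero_or_eq_one_of_idempotent (h0 : 𝒜 0 = 1) (e : R) (he : e * e = e) :
    e = 0 ∨ e = 1 := by
  classical
  -- By induction on n: in the component e_n = Σ e_i e_(n-i), every term contains a factor of
  -- smaller degree, or e_0 = 0.
  have key : ∀ e : R, e * e = e → (DirectSum.decompose 𝒜 e 0 : R) = 0 → e = 0 := by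
    intro e he h
    have h1 : ∀ n, (DirectSum.decompose 𝒜 e n : R) = 0 := by
      intro n
      induction n using Nat.strong_induction_on with
      | _ n ih =>
        rcases Nat.eq_zero_or_pos n with rfl | hn
        · exact h
        · have h2 := DirectSum.coe_mul_apply 𝒜 (DirectSum.decompose 𝒜 e) (DirectSum.decompose 𝒜 e) n
          rw [← DirectSum.decompose_mul, he] at h2
          rw [h2]
          refine Finset.sum_eq_zero fun ij hij => ?_
          have h3 : ij.1 + ij.2 = n := (Finset.mem_filter.1 hij).2
          rcases Nat.lt_or_ge ij.1 n with h4 | h4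
          · rw [ih _ h4, zero_mul]
          · rw [show ij.2 = 0 by omega, h, mul_zero]
    apply (DirectSum.decompose 𝒜).injective
    ext n
    simp [h1 n]
  obtain ⟨c, hc⟩ := Submodule.mem_one.1 (h0.le (DirectSum.decompose 𝒜 e 0).2)
  have hc' : algebraMap k R c = GradedRing.projZeroRingHom 𝒜 e := by
    rw [hc, GradedRing.projZeroRingHom_apply]
  have hcc : algebraMap k R c * (1 - algebraMap k R c) = 0 := by
    rw [mul_sub, mul_one, hc', ← map_mul, he, sub_self]
  rcases IsLocalRing.isUnit_or_isUnit_one_sub_self c with h | h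
  · right
    have h1 := (h.map (algebraMap k R)).mul_right_eq_zero.1 hcc
    refine (sub_eq_zero.1 (key (1 - e) (by linear_combination he) ?_)).symm
    rw [← GradedRing.projZeroRingHom_apply, map_sub, map_one, ← hc', h1]
  · left
    have h1 := h.map (algebraMap k R)
    rw [map_sub, map_one] at h1
    refine key e he ?_
    rw [← hc]
    exact h1.mul_left_eq_zero.1 hcc

end GradedIdempotents

/-! ### Free summands of Frobenius push-forwards -/

namespace QGradedModule

section Truncation

variable {k : Type v} {R : Type u} [CommRing k] [CommRing R] [Algebra k R]
  {𝒜 : ℕ → Submodule k R} [GradedAlgebra 𝒜] {N : QGradedModule 𝒜}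

theorem mem_piece_self {n : ℕ} {a : R} (ha : a ∈ 𝒜 n) : a ∈ (self 𝒜).piece n := by
  have h : (𝒜 n).toAddSubgroup ≤ ⨆ (j : ℕ) (_ : (j : ℚ) = (n : ℚ)), (𝒜 j).toAddSubgroup :=
    le_iSup₂_of_le n rfl le_rfl
  exact h ha

theorem one_mem_piece_self : (1 : R) ∈ (self 𝒜).piece 0 := by
  have := mem_piece_self (SetLike.GradedOne.one_mem (A := 𝒜))
  rwa [Nat.cast_zero] at this

theorem smul_mem_piece {α β : ℚ} {r : R} {x : N.carrier} (hr : r ∈ (self 𝒜).piece α)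
    (hx : x ∈ N.piece β) : r • x ∈ N.piece (α + β) := by
  have h : (self 𝒜).piece α ≤
      (N.piece (α + β)).comap ((LinearMap.toSpanSingleton R N.carrier x).toAddMonoidHom) := by
    refine iSup₂_le fun n hn a ha => ?_
    rw [← hn]
    exact N.smul_mem n β a x ha hx
  exact h hr

/-- The homogeneous component of degree `-β` of a linear map `N → R`. -/
theorem exists_truncation (f : N.carrier →ₗ[R] R) (β : ℚ) : ∃ g : N.carrier →ₗ[R] R,
    ∀ α, ∀ x ∈ N.piece α, g x = (self 𝒜).proj (α - β) (f x) := by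
  classical
  let g : N.carrier →+ R := (DirectSum.toAddMonoid fun α =>
    (((self 𝒜).proj (α - β)).comp f.toAddMonoidHom).comp (N.piece α).subtype).comp
      N.decomp.symm.toAddMonoidHom
  have hg : ∀ α, ∀ x ∈ N.piece α, g x = (self 𝒜).proj (α - β) (f x) := by
    intro α x hx
    change DirectSum.toAddMonoid _ (N.decomp.symm x) = _
    rw [N.decomp_symm_of_mem hx]
    exact DirectSum.toAddMonoid_of _ _ _
  refine ⟨⟨g.toAddHom, fun r x => ?_⟩, hg⟩
  change g (r • x) = r * g x
  induction x using homogeneous_induction with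
  | hzero => rw [smul_zero, map_zero, mul_zero]
  | hadd x y hx hy => rw [smul_add, map_add, map_add, mul_add, hx, hy]
  | hom α x hx =>
    induction r using DirectSum.Decomposition.inductionOn 𝒜 with
    | zero => rw [zero_smul, map_zero, zero_mul]
    | add a b ha hb => rw [add_smul, map_add, add_mul, ha, hb]
    | @homogeneous n a =>
      rw [hg _ _ (N.smul_mem n α a x a.2 hx), hg _ _ hx, map_smul]
      have h1 := (self 𝒜).proj_smul a.2 (n + α - β) (f x)
      rw [show (n : ℚ) + α - β - n = α - β by ring] at h1
      exact h1

/-- If some linear map `N → R` takes a homogeneous element of degree `β` to `1`, then `R` is, up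
to a shift, a graded direct summand of `N`. -/
theorem isRetract_self_of_apply_eq_one (f : N.carrier →ₗ[R] R) {β : ℚ} {m : N.carrier}
    (hm : m ∈ N.piece β) (hfm : f m = 1) : ((self 𝒜).shift (-β)).IsRetract N := by
  obtain ⟨g, hg⟩ := exists_truncation f β
  have hgm : g m = 1 := by
    rw [hg _ _ hm, hfm, sub_self]
    exact (self 𝒜).proj_of_mem (one_mem_piece_self (R := R))
  refine ⟨LinearMap.toSpanSingleton R N.carrier m, g, fun α r hr => ?_, fun α x hx => ?_, ?_⟩
  · have := smul_mem_piece (N := N) (show r ∈ (self 𝒜).piece (α + -β) from hr) hm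
    rwa [neg_add_cancel_right] at this
  · change g x ∈ (self 𝒜).piece (α + -β)
    rw [hg _ _ hx, ← sub_eq_add_neg]
    exact (self 𝒜).proj_mem _ _
  · refine LinearMap.ext fun (r : R) => ?_
    change g (r • m) = r
    rw [map_smul, hgm, smul_eq_mul, mul_one]

theorem isIndecomposable_self [Nontrivial R] (h : ∀ e : R, e * e = e → e = 0 ∨ e = 1) :
    (self 𝒜).IsIndecomposable := by
  rw [isIndecomposable_iff]
  refine ⟨(inferInstance : Nontrivial R), fun f _ hf => ?_⟩
  change R →ₗ[R] R at f
  change f ∘ₗ f = f at hf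
  change f = 0 ∨ f = LinearMap.id
  have h1 : ∀ r, f r = r * f 1 := fun r => by
    rw [← smul_eq_mul, ← map_smul, smul_eq_mul, mul_one]
  have h2 : f 1 * f 1 = f 1 := by
    rw [← h1]
    exact LinearMap.congr_fun hf 1
  rcases h _ h2 with h3 | h3
  · exact Or.inl (LinearMap.ext fun (r : R) => (h1 r).trans (by rw [h3, mul_zero]; rfl))
  · exact Or.inr (LinearMap.ext fun (r : R) => (h1 r).trans (by rw [h3, mul_one]; rfl))

end Truncation

section FreeSummand

variable {p : ℕ} [Fact p.Prime] {k : Type v} {R : Type u} [CommRing k] [CommRing R] [CharP R p]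
  [Algebra k R] {𝒜 : ℕ → Submodule k R} [GradedAlgebra 𝒜] {N : QGradedModule 𝒜}

theorem exists_isRetract_frob_self (h : FrobeniusSplits p 1 (1 : R)) :
    ∃ α, ((self 𝒜).shift α).IsRetract ((self 𝒜).frob p 1) := by
  obtain ⟨φ, hφ, h1⟩ := h
  let f : ((self 𝒜).frob p 1).carrier →ₗ[R] R := ⟨φ.toAddHom, fun r (x : R) => hφ r x⟩
  refine ⟨_, isRetract_self_of_apply_eq_one f (β := 0) (m := (1 : R)) ?_ h1⟩
  change (1 : R) ∈ (self 𝒜).piece ((p : ℚ) ^ 1 * 0)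
  rw [mul_zero]
  exact one_mem_piece_self

/-- An embedding f of N in ᵉR sends a nonzero homogeneous element to a nonzero c of R. A map
splitting c at level s + e, composed with f, is an R-linear map from ˢN to R taking that element to
1. -/
theorem exists_isRetract_frob_of_isSummand [IsDomain R] (h : IsStronglyFRegular p R) {e : ℕ}
    (hN : N.IsSummand ((self 𝒜).frob p e)) [Nontrivial N.carrier] :
    ∃ (s : ℕ) (α : ℚ), ((self 𝒜).shift α).IsRetract (N.frob p s) := by
  obtain ⟨α, f, g, hf, hg, hgf⟩ := isSummand_iff.1 hN
  obtain ⟨β, m, hm, hm0⟩ : ∃ β, ∃ m ∈ N.piece β, m ≠ 0 := by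
    by_contra! hcon
    obtain ⟨x, hx⟩ := exists_ne (0 : N.carrier)
    exact hx (N.eq_zero_of_forall_proj fun β => hcon β _ (N.proj_mem β x))
  let f' : N.carrier → R := f
  have hf' : ∀ (r : R) (x : N.carrier), f' (r • x) = r ^ p ^ e * f' x := f.map_smul
  let c : R := f m
  have hc : c ≠ 0 := fun h0 => by
    have h1 : g (f m) = m := LinearMap.congr_fun hgf m
    have h2 : f m = 0 := h0
    rw [h2, map_zero] at h1
    exact hm0 h1.symm
  obtain ⟨s, hs⟩ := h.exists_frobeniusSplits_of_ne_zero hc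
  have hs' := hs.add h.frobeniusSplits_one e
  rw [add_comm] at hs'
  obtain ⟨φ, hφ, h1⟩ := hs'
  let F : (N.frob p s).carrier →ₗ[R] R :=
    { toFun := fun x => φ (f' x)
      map_add' := fun x y => (congrArg φ (f.map_add x y)).trans (φ.map_add _ _)
      map_smul' := fun r x => by
        have h2 : ∀ y : N.carrier, φ (f' (r ^ p ^ s • y)) = r * φ (f' y) := fun y => by
          rw [hf', ← pow_mul, ← pow_add, add_comm s e, hφ]
        exact h2 x }
  refine ⟨s, _, isRetract_self_of_apply_eq_one F (β := β / (p : ℚ) ^ s) (m := m) ?_ h1⟩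
  change m ∈ N.piece ((p : ℚ) ^ s * (β / (p : ℚ) ^ s))
  rwa [mul_div_cancel₀ _ (pow_ne_zero s (Nat.cast_ne_zero.2 (Fact.out : p.Prime).ne_zero))]

end FreeSummand

end QGradedModule

/-! ### Nonvanishing of fibres -/

theorem Ideal.pow_smul_top_eq_top {R N : Type*} [CommRing R] [AddCommGroup N] [Module R N]
    {m : Ideal R} (h : (m • ⊤ : Submodule R N) = ⊤) (s : ℕ) :
    (m ^ s • ⊤ : Submodule R N) = ⊤ := by
  induction s with
  | zero => rw [pow_zero, Ideal.one_eq_top, Submodule.top_smul]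
  | succ s ih => rw [pow_succ, Submodule.mul_smul, h, ih]

/-- Substitute for Nakayama when R is not local: N = mN would give N = m^s N = m^[q] N with q = p^e,
but g maps m^[q] N into m. -/
theorem smul_top_ne_top_of_surjective_frobenius {p : ℕ} {R : Type v} {N : Type u} [CommRing R]
    [IsNoetherianRing R] [ExpChar R p] [AddCommGroup N] [Module R N] {e : ℕ} {m : Ideal R}
    (hm : m ≠ ⊤) {g : FrobeniusModule p e N →ₗ[R] R} (hg : Function.Surjective g) :
    (m • ⊤ : Submodule R N) ≠ ⊤ := by
  intro h
  obtain ⟨s, hs⟩ := exists_pow_le_map_iterateFrobenius p m e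
  have h1 : (m.map (iterateFrobenius R p e) • ⊤ : Submodule R N) = ⊤ :=
    top_le_iff.1 ((Ideal.pow_smul_top_eq_top h s).ge.trans (Submodule.smul_mono_left hs))
  have h2 : ∀ x ∈ (m.map (iterateFrobenius R p e) • ⊤ : Submodule R N), g x ∈ m := by
    intro x hx
    induction hx using Submodule.smul_induction_on' with
    | add x _ y _ hx hy =>
      have h3 : g (x + y) = g x + g y := g.map_add x y
      rw [h3]
      exact m.add_mem hx hy
    | smul a ha y _ =>
      induction ha using Submodule.closure_induction with
      | zero =>
        have h3 : g ((0 : R) • y) = 0 := by rw [zero_smul]; exact g.map_zero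
        rw [h3]
        exact m.zero_mem
      | add a b _ _ ha hb =>
        have h3 : g ((a + b) • y) = g (a • y) + g (b • y) := by
          rw [add_smul]
          exact g.map_add _ _
        rw [h3]
        exact m.add_mem ha hb
      | smul_mem a r hr =>
        obtain ⟨r, hr, rfl⟩ := hr
        have h3 : g ((a • iterateFrobenius R p e r) • y) = r * g (a • y) := by
          rw [smul_eq_mul, mul_comm, mul_smul]
          exact g.map_smul r (a • y)
        rw [h3]
        exact m.mul_mem_right _ hr
  obtain ⟨x, hx⟩ := hg 1
  refine hm ((Ideal.eq_top_iff_one m).2 (hx ▸ h2 x ?_))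
  rw [h1]
  exact Submodule.mem_top

/-! ### Asymptotics of the multiplicities -/

namespace QGradedModule

theorem IsSumOf.fibreLength_eq_sum {k : Type v} {R : Type u} [CommRing k] [CommRing R]
    [Algebra k R] {𝒜 : ℕ → Submodule k R} {n : ℕ} {M : Fin n → QGradedModule 𝒜}
    {N : QGradedModule 𝒜} {ι : Type} [Fintype ι] {σ : ι → Fin n} (h : N.IsSumOf M σ)
    (m : Ideal R) : fibreLength m N.carrier =
      ∑ i, (Nat.card {l // σ l = i} : ℕ∞) * fibreLength m (M i).carrier := by
  classical
  obtain ⟨A, hA, hσ⟩ := h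
  have h1 : ∀ l, fibreLength m (A l).carrier = fibreLength m (M (σ l)).carrier := fun l => by
    obtain ⟨α, f, -⟩ := hσ l
    exact (fibreLength_congr m f).symm
  rw [hA.fibreLength_eq_sum, Finset.sum_congr rfl fun l _ => h1 l,
    ← Finset.sum_fiberwise Finset.univ σ]
  refine Finset.sum_congr rfl fun i _ => ?_
  rw [Finset.sum_congr rfl fun l hl => by rw [(Finset.mem_filter.1 hl).2], Finset.sum_const,
    nsmul_eq_mul, Nat.card_eq_fintype_card, Fintype.card_subtype]

section Main

variable {p : ℕ} [Fact p.Prime] {k : Type v} {R : Type u} [CommRing k] [IsLocalRing k]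
  [IsNoetherianRing k] [IsAdicComplete (IsLocalRing.maximalIdeal k) k] [CommRing R] [CharP R p]
  [Algebra k R] [IsNoetherianRing R] {𝒜 : ℕ → Submodule k R} [GradedAlgebra 𝒜] {n : ℕ}
  {M : Fin n → QGradedModule 𝒜}

/-- Any two indices are joined by a path through i₀, and the loop there pads all paths to a common
length. -/
theorem exists_pow_pos {n : ℕ} (E : Matrix (Fin n) (Fin n) ℕ) (i₀ : Fin n) (h : 0 < E i₀ i₀)
    (h1 : ∀ i, ∃ a, 0 < (E ^ a) i i₀) (h2 : ∀ j, ∃ b, 0 < (E ^ b) i₀ j) :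
    ∃ t, 0 < t ∧ ∀ i j, 0 < (E ^ t) i j := by
  have hmul : ∀ {a b i l j}, 0 < (E ^ a) i l → 0 < (E ^ b) l j → 0 < (E ^ (a + b)) i j := by
    intro a b i l j ha hb
    rw [pow_add, Matrix.mul_apply]
    exact (Nat.mul_pos ha hb).trans_le (Finset.single_le_sum
      (f := fun l => (E ^ a) i l * (E ^ b) l j) (fun _ _ => Nat.zero_le _) (Finset.mem_univ l))
  have hloop : ∀ s, 0 < (E ^ s) i₀ i₀ := by
    intro s
    induction s with
    | zero => simp
    | succ s ih => exact hmul ih (by rwa [pow_one])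
  choose a ha using h1
  choose b hb using h2
  refine ⟨∑ i, a i + 1 + ∑ j, b j, by omega, fun i j => ?_⟩
  have hai := Finset.single_le_sum (f := a) (fun _ _ => Nat.zero_le _) (Finset.mem_univ i)
  have hbj := Finset.single_le_sum (f := b) (fun _ _ => Nat.zero_le _) (Finset.mem_univ j)
  have h3 : ∑ i, a i + 1 + ∑ j, b j =
      a i + (∑ i, a i - a i + 1 + (∑ j, b j - b j)) + b j := by omega
  rw [h3]
  exact hmul (hmul (ha i) (hloop _)) (hb j)

theorem exists_shiftIso_self [Nontrivial R] (h0 : 𝒜 0 = 1) (hM : IsGradedSummandList p 𝒜 M) :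
    ∃ i, (M i).ShiftIso (self 𝒜) := by
  obtain ⟨i, hi⟩ := hM.complete 0 (self 𝒜)
    (isIndecomposable_self (eq_zero_or_eq_one_of_idempotent h0))
    (isSummand_iff.2 ⟨0, (shift_zero_gIso _).isRetract.trans (frob_zero_gIso _).symm.isRetract⟩)
  exact ⟨i, hi.symm⟩

theorem fibreLength_frob_self {κ : Type w} [Field κ] [CharP κ p] (hκ : (frobenius κ p).Finite)
    (π : R →+* κ) (hπ : Function.Surjective π) (e : ℕ) :
    fibreLength (RingHom.ker π) ((self 𝒜).frob p e).carrier = (frobeniusDegree p κ : ℕ∞) ^ e *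
        Module.length R (R ⧸ (RingHom.ker π).map (iterateFrobenius R p e)) := by
  rw [← lengthAlong_quotient_map_iterateFrobenius hκ π hπ]
  exact fibreLength_compHom (iterateFrobenius R p e) (RingHom.ker π)

/-- The multiplicities grow like `(p ^ d * [κ : κ ^ p]) ^ e`, where `d` governs the growth of the
lengths of the quotients of `R` by the Frobenius powers of a maximal ideal with residue
field `κ`. -/
theorem exists_multiplicity_limits [Nontrivial R] (h0 : 𝒜 0 = 1)
    (hM : IsGradedSummandList p 𝒜 M) (hR : IsStronglyFRegular p R) {κ : Type w} [Field κ]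
    [CharP κ p] (hκ : (frobenius κ p).Finite) (π : R →+* κ) (hπ : Function.Surjective π) {d : ℕ}
    (hlow : ∃ D : ℕ, ∀ e : ℕ, ((p ^ (d * e) : ℕ) : ℕ∞) ≤
      D * Module.length R (R ⧸ (RingHom.ker π).map (iterateFrobenius R p e)))
    (hup : ∃ B : ℕ, ∀ e : ℕ, Module.length R (R ⧸ (RingHom.ker π).map (iterateFrobenius R p e)) ≤
      (B * p ^ (d * e) : ℕ)) :
    ∃ m : ℕ → Matrix (Fin n) (Fin n) ℕ,
      (∀ e i j a, (M i).HasMultiplicity ((M j).frob p e) a ↔ a = m e i j) ∧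
      (∀ i j, ∃ L : ℝ, 0 < L ∧ Filter.Tendsto
        (fun e : ℕ => (m e i j : ℝ) / ((p : ℝ) ^ (d * e) * (frobeniusDegree p κ : ℝ) ^ e))
        Filter.atTop (nhds L)) ∧
      (PerfectField κ → ∀ i j, ∃ L : ℝ, 0 < L ∧ Filter.Tendsto
        (fun e : ℕ => (m e i j : ℝ) / (p : ℝ) ^ (d * e)) Filter.atTop (nhds L)) ∧
      ∃ t : ℕ, 0 < t ∧ ∀ i j, 0 < (m 1 ^ t) i j := by
  have hdom : IsDomain R := hR.isDomain (eq_zero_or_eq_one_of_idempotent h0)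
  have hmax := RingHom.ker_isMaximal_of_surjective π hπ
  obtain ⟨m, hm, hpow, hpos, hsum⟩ := exists_multiplicity_matrix h0 hM hR.fFinite
  obtain ⟨i₀, hi₀⟩ := exists_shiftIso_self h0 hM
  have hret : ∀ {e j α}, ((self 𝒜).shift α).IsRetract ((M j).frob p e) → 0 < m e i₀ j := by
    intro e j α h
    obtain ⟨β, hβ⟩ := shiftIso_iff.1 hi₀
    exact hpos e i₀ j (α + β) ((shift_shift_gIso _ β α).symm.isRetract.trans
      ((hβ.shift α).isRetract.trans h))
  have hfrob : ∀ e, ∃ α, (((self 𝒜).frob p e).shift α).GIso ((M i₀).frob p e) := fun e =>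
    shiftIso_iff.1 (hi₀.symm.frob e)
  have hleft : ∀ i, ∃ a, 0 < (m 1 ^ a) i i₀ := by
    intro i
    obtain ⟨e, he⟩ := hM.summand i
    obtain ⟨α, hα⟩ := isSummand_iff.1 he
    obtain ⟨β, hβ⟩ := hfrob e
    refine ⟨e, ?_⟩
    rw [← hpow]
    exact hpos e i i₀ (β + α) ((shift_shift_gIso _ α β).symm.isRetract.trans
      ((hα.shift β).trans hβ.isRetract))
  have hright' : ∀ j, ∃ (s : ℕ) (α : ℚ), ((self 𝒜).shift α).IsRetract ((M j).frob p s) := by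
    intro j
    obtain ⟨e, he⟩ := hM.summand j
    have := (hM.indecomposable j).1
    exact exists_isRetract_frob_of_isSummand hR he
  have hright : ∀ j, ∃ b, 0 < (m 1 ^ b) i₀ j := by
    intro j
    obtain ⟨s, α, h⟩ := hright' j
    exact ⟨s, hpow s ▸ hret h⟩
  have hloop : 0 < m 1 i₀ i₀ := by
    obtain ⟨α, hα⟩ := exists_isRetract_frob_self (𝒜 := 𝒜) hR.frobeniusSplits_one
    obtain ⟨β, hβ⟩ := hfrob 1
    exact hret ((shift_shift_gIso _ α β).symm.isRetract.trans
      ((hα.shift β).trans hβ.isRetract))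
  obtain ⟨t, ht0, ht⟩ := exists_pow_pos (m 1) i₀ hloop hleft hright
  have hfin : ∀ j, Module.Finite R (M j).carrier := fun j =>
    finite_of_isSummand_frob_self hR.fFinite (hM.summand j).choose_spec
  -- The weights are positive because some push-forward of M i has R as a retract, hence surjects
  -- onto R.
  have hμ : ∀ i, ∃ μ : ℕ, 0 < μ ∧ fibreLength (RingHom.ker π) (M i).carrier = μ := by
    intro i
    obtain ⟨μ, hμ⟩ := ENat.ne_top_iff_exists.1
      (fibreLength_ne_top (m := RingHom.ker π) (M i).carrier)
    refine ⟨μ, ?_, hμ.symm⟩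
    obtain ⟨s, α, f, g, -, -, hgf⟩ := hright' i
    let g' : FrobeniusModule p s (M i).carrier →ₗ[R] R := g
    have h1 := fibreLength_pos (smul_top_ne_top_of_surjective_frobenius hmax.ne_top (g := g')
      fun r => ⟨f r, LinearMap.congr_fun hgf r⟩)
    rw [← hμ] at h1
    exact_mod_cast h1
  choose μ hμ0 hμ using hμ
  obtain ⟨D, hD⟩ := hlow
  obtain ⟨B, hB⟩ := hup
  have hlen : ∀ e, ∃ ℓ : ℕ, Module.length R
      (R ⧸ (RingHom.ker π).map (iterateFrobenius R p e)) = ℓ := fun e =>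
    (ENat.ne_top_iff_exists.1 (ne_top_of_le_ne_top (ENat.natCast_ne_top _) (hB e))).imp
      fun _ h => h.symm
  choose ℓ hℓ using hlen
  have hD' : ∀ e, p ^ (d * e) ≤ D * ℓ e := fun e => by
    have := hD e
    rw [hℓ] at this
    exact_mod_cast this
  have hB' : ∀ e, ℓ e ≤ B * p ^ (d * e) := fun e => by
    have := hB e
    rw [hℓ] at this
    exact_mod_cast this
  have hδ := frobeniusDegree_pos hκ
  set δ := frobeniusDegree p κ with hδ_def
  have hp : 0 < p := (Fact.out : p.Prime).pos
  -- The fibre length of ᵉR computed twice: from its decomposition into the M i, and directly as a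
  -- length along Frobenius.
  have hident : ∀ e, ∑ i, μ i * m e i i₀ = δ ^ e * ℓ e := by
    intro e
    obtain ⟨r, σ, hσ, hcard⟩ := hsum e i₀
    have h1 := hσ.fibreLength_eq_sum (RingHom.ker π)
    obtain ⟨α, f, -⟩ := hi₀.frob (p := p) e
    rw [fibreLength_congr _ f, fibreLength_frob_self hκ π hπ, hℓ] at h1
    have h2 : ((δ ^ e * ℓ e : ℕ) : ℕ∞) = ((∑ i, μ i * m e i i₀ : ℕ) : ℕ∞) := by
      push_cast
      rw [h1]
      refine Finset.sum_congr rfl fun i _ => ?_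
      rw [hμ, hcard, mul_comm]
    exact_mod_cast h2.symm
  let A : Matrix (Fin n) (Fin n) ℝ := (Nat.castRingHom ℝ).mapMatrix (m 1)
  have hA : ∀ e i j, (A ^ e) i j = m e i j := fun e i j => by
    rw [hpow, ← map_pow]
    rfl
  have hD0 : 0 < D := by
    rcases Nat.eq_zero_or_pos D with h | h
    · have h1 := hD' 0
      rw [h, zero_mul] at h1
      exact absurd h1 (not_le.2 (pow_pos hp _))
    · exact h
  have hlpow : ∀ e : ℕ, ((p : ℝ) ^ d * δ) ^ e = (p : ℝ) ^ (d * e) * (δ : ℝ) ^ e := fun e => by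
    rw [mul_pow, pow_mul]
  have hident' : ∀ e : ℕ, ∑ i, (μ i : ℝ) * (A ^ e) i i₀ = (δ : ℝ) ^ e * ℓ e := fun e => by
    simp only [hA]
    exact_mod_cast hident e
  have hlim : ∀ i j, ∃ L : ℝ, 0 < L ∧ Filter.Tendsto
      (fun e : ℕ => (m e i j : ℝ) / ((p : ℝ) ^ (d * e) * (δ : ℝ) ^ e)) Filter.atTop (nhds L) := by
    intro i j
    have : Nonempty (Fin n) := ⟨i₀⟩
    -- Only the column i₀ is bounded by lengths; primitivity transfers the growth rate to all
    -- entries.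
    have h1 := exists_tendsto_pow_div_of_bounds (A := A) (t := t) (l := (p : ℝ) ^ d * δ)
      (c := 1 / D) (C := B) (fun i j => Nat.cast_nonneg _) ht0.ne' (fun i j => by
        rw [hA, hpow]
        exact_mod_cast ht i j) (by positivity) (by positivity) (fun i => (μ i : ℝ))
      (fun i => by exact_mod_cast hμ0 i) i₀ (fun e => by
        rw [hident', hlpow]
        have h2 : (p : ℝ) ^ (d * e) ≤ D * ℓ e := by exact_mod_cast hD' e
        rw [one_div, inv_mul_le_iff₀ (by positivity)]
        calc (p : ℝ) ^ (d * e) * (δ : ℝ) ^ e ≤ (D * ℓ e) * (δ : ℝ) ^ e := by gcongr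
          _ = D * ((δ : ℝ) ^ e * ℓ e) := by ring) (fun e => by
        rw [hident', hlpow]
        have h2 : (ℓ e : ℝ) ≤ B * (p : ℝ) ^ (d * e) := by exact_mod_cast hB' e
        calc (δ : ℝ) ^ e * ℓ e ≤ (δ : ℝ) ^ e * (B * (p : ℝ) ^ (d * e)) := by gcongr
          _ = B * ((p : ℝ) ^ (d * e) * (δ : ℝ) ^ e) := by ring) i j
    simpa only [hA, hlpow] using h1
  refine ⟨m, hm, hlim, fun hperf i j => ?_, t, ht0, ht⟩
  have h1 : δ = 1 := frobeniusDegree_eq_one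
  simpa only [h1, Nat.cast_one, one_pow, mul_one] using hlim i j

end Main

end QGradedModule

/-! ### Ungraded modules as graded modules concentrated in degree zero -/

section Trivial

variable (R : Type u) [CommRing R]

/-- The grading of a ring with everything in degree zero. -/
def trivialGrading : ℕ → Submodule R R := fun n => if n = 0 then ⊤ else ⊥

theorem trivialGrading_zero : trivialGrading R 0 = ⊤ := if_pos rfl

theorem trivialGrading_of_ne_zero {n : ℕ} (h : n ≠ 0) : trivialGrading R n = ⊥ := if_neg h

theorem mem_trivialGrading_zero (x : R) : x ∈ trivialGrading R 0 :=
  (trivialGrading_zero R).ge trivial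

noncomputable instance : GradedAlgebra (trivialGrading R) where
  one_mem := mem_trivialGrading_zero R 1
  mul_mem i j a b ha hb := by
    by_cases hi : i = 0
    · by_cases hj : j = 0
      · subst hi hj
        exact mem_trivialGrading_zero R _
      · rw [trivialGrading_of_ne_zero R hj, Submodule.mem_bot] at hb
        rw [hb, mul_zero]
        exact Submodule.zero_mem _
    · rw [trivialGrading_of_ne_zero R hi, Submodule.mem_bot] at ha
      rw [ha, zero_mul]
      exact Submodule.zero_mem _
  decompose' x := DirectSum.of (fun n => trivialGrading R n) 0 ⟨x, mem_trivialGrading_zero R x⟩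
  left_inv x := DirectSum.coeAddMonoidHom_of _ _ _
  right_inv y := by
    let F : R →+ DirectSum ℕ fun n => trivialGrading R n :=
      (DirectSum.of (fun n => trivialGrading R n) 0).comp
        { toFun := fun x => ⟨x, mem_trivialGrading_zero R x⟩
          map_zero' := rfl
          map_add' := fun _ _ => rfl }
    suffices h : F.comp (DirectSum.coeAddMonoidHom (trivialGrading R)) = AddMonoidHom.id _ from
      DFunLike.congr_fun h y
    refine DirectSum.addHom_ext fun n x => ?_
    rw [AddMonoidHom.comp_apply, DirectSum.coeAddMonoidHom_of]
    by_cases hn : n = 0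
    · subst hn
      rfl
    · obtain rfl : x = 0 := Subtype.ext ((trivialGrading_of_ne_zero R hn).le x.2)
      rw [map_zero]
      exact map_zero F

variable {R}

namespace QGradedModule

/-- A module as a graded module concentrated in degree zero. -/
def concentrated (N : Type u) [AddCommGroup N] [Module R N] :
    QGradedModule (trivialGrading R) where
  carrier := N
  piece α := if α = 0 then ⊤ else ⊥
  indep α := by
    dsimp only
    by_cases h : α = 0
    · refine disjoint_iff_inf_le.2 (inf_le_right.trans (iSup₂_le fun β hβ => ?_))
      rw [if_neg (h ▸ hβ)]
    · rw [if_neg h]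
      exact disjoint_bot_left
  iSup_piece := top_le_iff.1 (le_iSup_of_le 0 (by rw [if_pos rfl]))
  smul_mem n α a m ha hm := by
    by_cases hn : n = 0
    · subst hn
      rw [Nat.cast_zero, zero_add]
      split_ifs with h
      · trivial
      · rw [if_neg h, AddSubgroup.mem_bot] at hm
        rw [hm, smul_zero]
        exact AddSubgroup.zero_mem _
    · rw [trivialGrading_of_ne_zero R hn, Submodule.mem_bot] at ha
      rw [ha, zero_smul]
      exact AddSubgroup.zero_mem _

/-- A graded module is concentrated in degree zero. -/
def IsConcentrated (N : QGradedModule (trivialGrading R)) : Prop := N.piece 0 = ⊤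

variable {M N : QGradedModule (trivialGrading R)}

theorem isConcentrated_concentrated (N : Type u) [AddCommGroup N] [Module R N] :
    (concentrated (R := R) N).IsConcentrated :=
  if_pos (c := (0 : ℚ) = 0) (t := (⊤ : AddSubgroup N)) (e := ⊥) rfl

theorem isConcentrated_self : (self (trivialGrading R)).IsConcentrated :=
  top_le_iff.1 fun x _ => by
    have := mem_piece_self (mem_trivialGrading_zero R x)
    rwa [Nat.cast_zero] at this

theorem IsConcentrated.frob {p : ℕ} [Fact p.Prime] [ExpChar R p] (h : N.IsConcentrated) (e : ℕ) :
    (N.frob p e).IsConcentrated := by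
  change N.piece ((p : ℚ) ^ e * 0) = ⊤
  rw [mul_zero]
  exact h

theorem IsConcentrated.mem (h : N.IsConcentrated) (x : N.carrier) : x ∈ N.piece 0 :=
  (show N.piece 0 = ⊤ from h).ge trivial

theorem IsConcentrated.isHomogeneous (h : N.IsConcentrated) (A : Submodule R N.carrier) :
    N.IsHomogeneous A := by
  rw [isHomogeneous_iff]
  intro x hx α
  rw [N.proj_of_mem_eq_ite (h.mem x)]
  split_ifs
  · exact hx
  · exact A.zero_mem

theorem IsConcentrated.sub (h : N.IsConcentrated) (A : Submodule R N.carrier) :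
    (N.sub A (h.isHomogeneous A)).IsConcentrated :=
  top_le_iff.1 fun x _ => h.mem (A.subtype x)

theorem IsConcentrated.isHom (hM : M.IsConcentrated) (hN : N.IsConcentrated)
    (f : M.carrier →ₗ[R] N.carrier) : IsHom f := by
  intro α x hx
  by_cases h : α = 0
  · subst h
    exact hN.mem _
  · have h1 := M.proj_of_mem_ne hx h
    rw [M.proj_of_mem (hM.mem x)] at h1
    rw [h1, map_zero]
    exact AddSubgroup.zero_mem _

theorem IsConcentrated.shiftIso_iff (hM : M.IsConcentrated) (hN : N.IsConcentrated) :
    M.ShiftIso N ↔ Nonempty (M.carrier ≃ₗ[R] N.carrier) := by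
  constructor
  · rintro ⟨α, f, -⟩
    exact ⟨f⟩
  · rintro ⟨f⟩
    exact GIso.shiftIso ⟨f, f.symm, hM.isHom hN _, hN.isHom hM _, by ext; simp, by ext; simp⟩

theorem IsConcentrated.isIndecomposable_iff (h : N.IsConcentrated) :
    N.IsIndecomposable ↔ IsIndecomposableModule R N.carrier :=
  and_congr_right fun _ => ⟨fun h1 A B => h1 A B (h.isHomogeneous A) (h.isHomogeneous B),
    fun h1 A B _ _ => h1 A B⟩

theorem IsConcentrated.isSummand_iff (hM : M.IsConcentrated) (hN : N.IsConcentrated) :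
    M.IsSummand N ↔ IsModuleSummand R M.carrier N.carrier := by
  constructor
  · rintro ⟨A, B, hA, hB, hAB, h⟩
    exact ⟨A, B, hAB, (hM.shiftIso_iff (hN.sub A)).1 h⟩
  · rintro ⟨A, B, hAB, h⟩
    exact ⟨A, B, hN.isHomogeneous A, hN.isHomogeneous B, hAB, (hM.shiftIso_iff (hN.sub A)).2 h⟩

theorem IsConcentrated.hasMultiplicity_iff (hM : M.IsConcentrated) (hN : N.IsConcentrated)
    {a : ℕ} : M.HasMultiplicity N a ↔ _root_.HasMultiplicity R M.carrier N.carrier a := by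
  have h1 : ∀ {r : ℕ} (A : Fin r → Submodule R N.carrier),
      Nat.card {i // M.ShiftIso (N.sub (A i) (hN.isHomogeneous (A i)))} =
        Nat.card {i // Nonempty (M.carrier ≃ₗ[R] A i)} := fun A =>
    Nat.card_congr (Equiv.subtypeEquivRight fun i => hM.shiftIso_iff (hN.sub (A i)))
  constructor
  · rintro ⟨r, A, hA, hint, hind, hcard⟩
    exact ⟨r, A, hint, fun i => (hN.sub (A i)).isIndecomposable_iff.1 (hind i),
      (h1 A).symm.trans hcard⟩
  · rintro ⟨r, A, hint, hind, hcard⟩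
    exact ⟨r, A, fun i => hN.isHomogeneous (A i), hint,
      fun i => (hN.sub (A i)).isIndecomposable_iff.2 (hind i), (h1 A).trans hcard⟩

end QGradedModule

open QGradedModule in
theorem IsSummandList.isGradedSummandList {p : ℕ} [Fact p.Prime] [ExpChar R p] {n : ℕ}
    {M : Fin n → ModuleCat.{u} R} (h : IsSummandList p R M) :
    IsGradedSummandList p (trivialGrading R) fun i => concentrated (M i) where
  indecomposable i :=
    (isConcentrated_concentrated (M i)).isIndecomposable_iff.2 (h.indecomposable i)
  summand i := by
    obtain ⟨e, he⟩ := h.summand i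
    exact ⟨e, ((isConcentrated_concentrated (M i)).isSummand_iff (isConcentrated_self.frob e)).2 he⟩
  not_iso i j hij := h.not_iso i j
    (((isConcentrated_concentrated (M i)).shiftIso_iff (isConcentrated_concentrated (M j))).1 hij)
  complete e N hN hNe := by
    -- N may sit in any rational degree, so it is replaced by the isomorphic submodule A of ᵉR,
    -- which is concentrated in degree zero.
    obtain ⟨A, B, hA, hB, hAB, hiso⟩ := hNe
    have hc := (isConcentrated_self (R := R)).frob (p := p) e
    have hAi := (hc.sub A).isIndecomposable_iff.1 (hiso.isIndecomposable hN)
    obtain ⟨i, hi⟩ := h.complete e (ModuleCat.of R A) hAi ⟨A, B, hAB, ⟨LinearEquiv.refl R A⟩⟩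
    exact ⟨i, hiso.trans (((hc.sub A).shiftIso_iff (isConcentrated_concentrated (M i))).2 hi)⟩

end Trivial

/-! ### The complete and the graded case -/

theorem mainTheorem5 (p : ℕ) [Fact p.Prime] :
    -- complete case
    (∀ (R : Type u) [CommRing R] [CharP R p] [IsLocalRing R] [IsNoetherianRing R]
      [IsAdicComplete (IsLocalRing.maximalIdeal R) R],
      (frobenius (IsLocalRing.ResidueField R) p).Finite →
      IsStronglyFRegular p R → HasFFRT p R →
      ∀ d : ℕ, ringKrullDim R = d →
      ∀ (n : ℕ) (M : Fin n → ModuleCat.{u} R), IsSummandList p R M →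
      ∃ m : ℕ → Matrix (Fin n) (Fin n) ℕ,
        (∀ e i j a, HasMultiplicity R (M i) (FrobeniusModule p e (M j)) a ↔ a = m e i j) ∧
        (∀ i j, ∃ L : ℝ, 0 < L ∧ Filter.Tendsto
          (fun e : ℕ => (m e i j : ℝ) /
            ((p : ℝ) ^ (d * e) * (frobeniusDegree p (IsLocalRing.ResidueField R) : ℝ) ^ e))
          Filter.atTop (nhds L)) ∧
        (PerfectField (IsLocalRing.ResidueField R) → ∀ i j, ∃ L : ℝ, 0 < L ∧ Filter.Tendsto
          (fun e : ℕ => (m e i j : ℝ) / (p : ℝ) ^ (d * e)) Filter.atTop (nhds L)) ∧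
        ∃ t : ℕ, 0 < t ∧ ∀ i j, 0 < (m 1 ^ t) i j) ∧
    -- graded case
    (∀ (k : Type v) (R : Type u) [Field k] [CharP k p] [CommRing R] [CharP R p] [Algebra k R]
      [Algebra.FiniteType k R] (𝒜 : ℕ → Submodule k R) [GradedAlgebra 𝒜],
      𝒜 0 = 1 →
      (frobenius k p).Finite →
      IsStronglyFRegular p R → HasGradedFFRT p 𝒜 →
      ∀ d : ℕ, ringKrullDim R = d →
      ∀ (n : ℕ) (M : Fin n → QGradedModule 𝒜), IsGradedSummandList p 𝒜 M →
      ∃ m : ℕ → Matrix (Fin n) (Fin n) ℕ,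
        (∀ e i j a, (M i).HasMultiplicity ((M j).frob p e) a ↔ a = m e i j) ∧
        (∀ i j, ∃ L : ℝ, 0 < L ∧ Filter.Tendsto
          (fun e : ℕ => (m e i j : ℝ) / ((p : ℝ) ^ (d * e) * (frobeniusDegree p k : ℝ) ^ e))
          Filter.atTop (nhds L)) ∧
        (PerfectField k → ∀ i j, ∃ L : ℝ, 0 < L ∧ Filter.Tendsto
          (fun e : ℕ => (m e i j : ℝ) / (p : ℝ) ^ (d * e)) Filter.atTop (nhds L)) ∧
        ∃ t : ℕ, 0 < t ∧ ∀ i j, 0 < (m 1 ^ t) i j) := by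
  constructor
  · intro R _ _ _ _ _ hκ hR _ d hd n M hM
    have h0 : trivialGrading R 0 = 1 := by
      rw [trivialGrading_zero, eq_comm, eq_top_iff]
      exact fun x _ => Submodule.mem_one.2 ⟨x, rfl⟩
    have hker : RingHom.ker (IsLocalRing.residue R) = IsLocalRing.maximalIdeal R :=
      IsLocalRing.ker_residue
    have hheight : (IsLocalRing.maximalIdeal R).height ≤ d := by
      have := Ideal.height_le_ringKrullDim_of_ne_top
        (IsLocalRing.maximalIdeal.isMaximal R).ne_top
      rw [hd] at this
      exact_mod_cast this
    obtain ⟨m, hm, h1, h2, h3⟩ := QGradedModule.exists_multiplicity_limits (d := d) h0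
      hM.isGradedSummandList hR hκ (IsLocalRing.residue R) IsLocalRing.residue_surjective
      (by
        rw [hker]
        exact exists_pow_le_mul_length_quotient_frobenius
          (exists_pow_le_mul_length_quotient_pow hd) p)
      (by
        rw [hker]
        exact exists_length_quotient_frobenius_le p hheight)
    refine ⟨m, fun e i j a => ?_, h1, h2, h3⟩
    rw [← hm]
    exact ((QGradedModule.isConcentrated_concentrated (M i)).hasMultiplicity_iff
      ((QGradedModule.isConcentrated_concentrated (M j)).frob e)).symm
  · intro k R _ _ _ _ _ _ 𝒜 _ h0 hk hR _ d hd n M hM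
    -- The zero ring has Krull dimension ⊥, which is not a natural number.
    have : Nontrivial R := by
      by_contra h
      rw [not_nontrivial_iff_subsingleton] at h
      rw [ringKrullDim_eq_bot_of_subsingleton] at hd
      exact WithBot.bot_ne_coe hd
    have : IsNoetherianRing R := Algebra.FiniteType.isNoetherianRing k R
    -- A field is complete for its maximal ideal 0, so it can serve as the complete local base ring.
    have : IsAdicComplete (IsLocalRing.maximalIdeal k) k := by
      rw [IsLocalRing.maximalIdeal_eq_bot]
      infer_instance
    obtain ⟨π, hπ⟩ := exists_augmentation 𝒜 h0 (algebraMap k R).injective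
    have hπk : ∀ a, π (algebraMap k R a) = a := fun a => by
      apply (algebraMap k R).injective
      rw [hπ, DirectSum.decompose_of_mem_same 𝒜 (SetLike.algebraMap_mem_graded 𝒜 a)]
    have hsurj : Function.Surjective π := fun a => ⟨_, hπk a⟩
    have hmax := RingHom.ker_isMaximal_of_surjective π hsurj
    have hheight : (RingHom.ker π).height ≤ d := by
      have := Ideal.height_le_ringKrullDim_of_ne_top hmax.ne_top
      rw [hd] at this
      exact_mod_cast this
    exact QGradedModule.exists_multiplicity_limits h0 hM hR hk π hsurj
      (exists_pow_le_mul_length_quotient_frobenius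
        (exists_pow_le_mul_length_quotient_ker_pow 𝒜 hd π hπ hπk) p)
      (exists_length_quotient_frobenius_le p hheight)
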